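/- Let $\mathsf s\in\mathbb N$, let $\mathcal Y$ be a measurable space and let $\rho(\mathrm dy\mid t)$, $t\in\mathbb R^{\mathsf s}$, be a Markov kernel from $\mathbb R^{\mathsf s}$ to $\mathcal Y$ (not depending on $d$). For $d\ge 1$ and an orthonormal frame $W\in\mathrm{Stf}_{\mathsf s}(\mathbb R^d)=\{W\in\mathbb R^{d\times\mathsf s}:W^{\mathsf T}W=I_{\mathsf s}\}$, the Gaussian multi-index model is the law of $(y,x)$ with $x\sim\mathcal N(0,I_d)$ and $y\mid x\sim\rho(\cdot\mid W^{\mathsf T}x)$; let $\nu^Y$ be the law of $y$. In the directional model only $(y,z)$ with $z=x/\|x\|_2$ is observed. **Notation.** Tensors in $(\mathbb R^d)^{\otimes k}$ carry the Frobenius norm, and $\|\cdot\|$ applied to a tensor-valued function of $y$ is the norm of $L^2(\nu^Y)$. On symmetric tensors, $\tau(A)_{i_1\dots i_{k-2}}=\sum_j A_{jj i_1\dots i_{k-2}}$ is the partial trace, and $\mathsf P_{\mathsf{tf}}$ is the orthogonal projection onto the symmetric tensors with $\tau(A)=0$ (onto all symmetric tensors when the order is at most $1$). Let $\gamma_d$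 be the standard Gaussian density, $\mathrm{He}_k(x)=\frac{(-1)^k}{\sqrt{k!}}\frac{\nabla^k\gamma_d(x)}{\gamma_d(x)}$ the Hermite tensor, and $\mathcal H_{d,\ell}(z)=\kappa_{d,\ell}\sqrt{N_{d,\ell}}\,\mathsf P_{\mathsf{tf}}(z^{\otimes\ell})$ the harmonic tensor, where $N_{d,\ell}$ is the dimension of the space of degree-$\ell$ spherical harmonics on $\mathbb S^{d-1}$ and $\kappa_{d,\ell}=\sqrt{2^\ell(d/2-1)_\ell/(d-2)_\ell}$, with $(a)_\ell=a(a+1)\cdots(a+\ell-1)$. Put $$\psi_k(y)=\mathbb E[\mathrm{He}_k(x)\mid y],\qquad \tilde\xi_\ell(y)=\mathbb E[\mathcal H_{d,\ell}(z)\mid y].$$ The generative exponent is $k_*=\min\{k\ge1:\|\psi_k\|>0\}$, and for $1\le\ell\le k_*$, with $m=\lceil (k_*-\ell)/2\rceil$, the contraction index is $$j_*(\ell)=\min\{j\ge0:\ \|\mathsf P_{\mathsf{tf}}(\tau^{m+j}(\psi_{\ell+2m+2j}))\|>0\}\in\{0,1,\dots\}\cup\{\infty\},$$ with $\min\emptyset=\infty$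 and $d^{-\infty}=0$. **Assumption.** There are constants $C>\sqrt{\mathsf s}$ and $J,d_0$ with $\|\psi_j\|\le C^{-j/2}$ for all $j\ge J$, all $d\ge d_0$ and all $W\in\mathrm{Stf}_{\mathsf s}(\mathbb R^d)$. Below, all constants are independent of $d$ and $W$. **(1)** For every $\ell\ge1$ there are constants $c,c'>0$ and $D$ such that for all $d\ge D$ and all $W\in\mathrm{Stf}_{\mathsf s}(\mathbb R^d)$, if $k_*$ exists and $\ell\le k_*$, then $$c\,d^{-2\lceil (k_*-\ell)/2\rceil-2j_*(\ell)}\ \le\ \|\tilde\xi_\ell\|^2\ \le\ c'\,d^{-2\lceil (k_*-\ell)/2\rceil-2j_*(\ell)} .$$ **(2)** Consequently degree $\ell=k_*$ is optimal up to constants, simultaneously for samples and for runtime. Let $\delta_\ell=1$ for odd $\ell$ and $\delta_\ell=0$ for even $\ell$, and consider, at harmonic degree $\ell\ge1$, the sample and query lower bounds $d^{\ell/2}/\|\tilde\xi_\ell\|^2$ and $d^{\ell}/\|\tilde\xi_\ell\|^2$, and the sample complexity $d^{\max(\ell/2,1)}/\|\tilde\xi_\ell\|^2$ and runtime $d^{\max(\ell,3/2)+\delta_\ell/2}\log(d)/\|\tilde\xi_\ell\|^2$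 of degree-$\ell$ harmonic tensor unfolding (all equal to $+\infty$ if $\tilde\xi_\ell=0$). There are constants $c,c'>0$ and $D$ such that, for all $d\ge D$ and all $W\in\mathrm{Stf}_{\mathsf s}(\mathbb R^d)$ for which $k_*$ exists, each of these four quantities at degree $k_*$ is at most $c'$ times its value at any degree $\ell\ge1$; and at degree $k_*$ they lie between $c$ and $c'$ times $d^{k_*/2}$, $d^{k_*}$, $d^{\max(k_*/2,1)}$ and $d^{\max(k_*,3/2)+\delta_{k_*}/2}\log d$, respectively. -/

import Mathlib

open MeasureTheory ProbabilityTheory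
open scoped ENNReal

noncomputable section

namespace DirMIM

/-! ### Tensors -/

/-- Order-`k` tensors over `ℝ^d`, with the Frobenius inner product and norm. -/
abbrev Tensor (d k : ℕ) : Type := EuclideanSpace ℝ (Fin k → Fin d)

/-- The subspace of symmetric tensors. -/
def symTensors (d k : ℕ) : Submodule ℝ (Tensor d k) where
  carrier := {A | ∀ (σ : Equiv.Perm (Fin k)) (i : Fin k → Fin d), A (i ∘ σ) = A i}
  zero_mem' := by intro σ i; rfl
  add_mem' := by
    intro A B hA hB σ i
    simp only [PiLp.add_apply, hA σ i, hB σ i]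
  smul_mem' := by
    intro c A hA σ i
    simp only [PiLp.smul_apply, hA σ i]

/-- The partial trace `τ(A)_{i₁ … i_k} = ∑_j A_{j j i₁ … i_k}`. -/
def partialTrace (d k : ℕ) : Tensor d (k + 2) →ₗ[ℝ] Tensor d k where
  toFun A := WithLp.toLp 2 fun i => ∑ j : Fin d,
    A (Fin.cons j (Fin.cons j i : Fin (k + 1) → Fin d) : Fin (k + 2) → Fin d)
  map_add' A B := by
    ext i
    simp [Finset.sum_add_distrib]
  map_smul' c A := by
    ext i
    simp [Finset.mul_sum]

/-- The iterated partial trace `τ^j`, from tensors of order `ℓ + 2j` to tensors of order `ℓ`. -/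
def iterTrace (d ℓ : ℕ) : (j : ℕ) → Tensor d (ℓ + 2 * j) →ₗ[ℝ] Tensor d ℓ
  | 0 => LinearMap.id
  | j + 1 => iterTrace d ℓ j ∘ₗ partialTrace d (ℓ + 2 * j)

/-- The subspace of traceless symmetric tensors (all symmetric tensors, when the order is at
most one). -/
def tracelessSym (d : ℕ) : (ℓ : ℕ) → Submodule ℝ (Tensor d ℓ)
  | 0 => symTensors d 0
  | 1 => symTensors d 1
  | ℓ + 2 => symTensors d (ℓ + 2) ⊓ LinearMap.ker (partialTrace d ℓ)

/-- The orthogonal projection onto traceless symmetric tensors. -/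
def projTF (d ℓ : ℕ) : Tensor d ℓ →L[ℝ] Tensor d ℓ := (tracelessSym d ℓ).starProjection

/-- The rank-one tensor `z^{⊗ℓ}`. -/
def tensorPower {d : ℕ} (ℓ : ℕ) (z : EuclideanSpace ℝ (Fin d)) : Tensor d ℓ :=
  WithLp.toLp 2 fun i => ∏ a : Fin ℓ, z (i a)

/-! ### Harmonic and Hermite tensors -/

/-- The dimension `N_{d,ℓ}` of the space of degree-`ℓ` spherical harmonics on the unit sphere
of `ℝ^d`: `1`, `d`, and `(d + 2ℓ - 2) / ℓ * (d + ℓ - 3).choose (ℓ - 1)` for `ℓ ≥ 2`. -/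
def harmonicDim (d : ℕ) : ℕ → ℝ
  | 0 => 1
  | 1 => d
  | ℓ + 2 => ((d : ℝ) + 2 * ℓ + 2) / (ℓ + 2) * ((d + ℓ - 1).choose (ℓ + 1) : ℝ)

/-- The constant `κ_{d,ℓ} = √(2^ℓ (d/2 - 1)_ℓ / (d - 2)_ℓ)`, with rising factorials; it is
meaningful for `d ≥ 3`. -/
def kappa (d ℓ : ℕ) : ℝ :=
  √(2 ^ ℓ * (ascPochhammer ℝ ℓ).eval ((d : ℝ) / 2 - 1) / (ascPochhammer ℝ ℓ).eval ((d : ℝ) - 2))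

/-- The harmonic tensor `κ_{d,ℓ} √N_{d,ℓ} P_tf(z^{⊗ℓ})`. -/
def harmonicTensor (d ℓ : ℕ) (z : EuclideanSpace ℝ (Fin d)) : Tensor d ℓ :=
  (kappa d ℓ * √(harmonicDim d ℓ)) • projTF d ℓ (tensorPower ℓ z)

/-- The density of the standard Gaussian law on `ℝ^d`. -/
def gaussianDensity (d : ℕ) (x : EuclideanSpace ℝ (Fin d)) : ℝ :=
  (2 * Real.pi) ^ (-(d : ℝ) / 2) * Real.exp (-‖x‖ ^ 2 / 2)

/-- The normalized Hermite tensor `(-1)^k / √(k!) * ∇^k γ_d(x) / γ_d(x)`. -/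
def hermiteTensor (d k : ℕ) (x : EuclideanSpace ℝ (Fin d)) : Tensor d k :=
  WithLp.toLp 2 fun i =>
    (-1) ^ k / √(k.factorial : ℝ) *
      (iteratedFDeriv ℝ k (gaussianDensity d) x
        (fun a => EuclideanSpace.single (i a) (1 : ℝ)) / gaussianDensity d x)

/-! ### The models -/

/-- Orthonormal `s`-frames in `ℝ^d`. -/
def Stiefel (d s : ℕ) : Set (Matrix (Fin d) (Fin s) ℝ) := {W | W.transpose * W = 1}

/-- The map `x ↦ Wᵀ x`. -/
def frameProj {d s : ℕ} (W : Matrix (Fin d) (Fin s) ℝ) (x : EuclideanSpace ℝ (Fin d)) :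
    EuclideanSpace ℝ (Fin s) :=
  WithLp.toLp 2 (W.transpose.mulVec x.ofLp)

lemma measurable_frameProj {d s : ℕ} (W : Matrix (Fin d) (Fin s) ℝ) :
    Measurable (frameProj W) := by
  have h : Continuous (frameProj W) := by
    unfold frameProj
    fun_prop
  exact h.measurable

variable {Y : Type*} [MeasurableSpace Y]

/-- The Gaussian multi-index model: the law of `(y, x)` with `x` standard Gaussian in `ℝ^d` and
`y` of conditional law `ρ(· | Wᵀ x)` given `x`. -/
def gaussianMIM {d s : ℕ} (ρ : Kernel (EuclideanSpace ℝ (Fin s)) Y)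
    (W : Matrix (Fin d) (Fin s) ℝ) : Measure (Y × EuclideanSpace ℝ (Fin d)) :=
  (stdGaussian (EuclideanSpace ℝ (Fin d)) ⊗ₘ
    ρ.comap (frameProj W) (measurable_frameProj W)).map Prod.swap

/-- The directional multi-index model: the law of `(y, x / ‖x‖)` when `(y, x)` follows the
Gaussian multi-index model. -/
def directionalMIM {d s : ℕ} (ρ : Kernel (EuclideanSpace ℝ (Fin s)) Y)
    (W : Matrix (Fin d) (Fin s) ℝ) : Measure (Y × EuclideanSpace ℝ (Fin d)) :=
  (gaussianMIM ρ W).map fun p => (p.1, ‖p.2‖⁻¹ • p.2)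

instance {d s : ℕ} (ρ : Kernel (EuclideanSpace ℝ (Fin s)) Y) [IsMarkovKernel ρ]
    (W : Matrix (Fin d) (Fin s) ℝ) : IsProbabilityMeasure (gaussianMIM ρ W) := by
  unfold gaussianMIM
  exact Measure.isProbabilityMeasure_map measurable_swap.aemeasurable

instance {d s : ℕ} (ρ : Kernel (EuclideanSpace ℝ (Fin s)) Y) [IsMarkovKernel ρ]
    (W : Matrix (Fin d) (Fin s) ℝ) : IsProbabilityMeasure (directionalMIM ρ W) := by
  unfold directionalMIM
  exact Measure.isProbabilityMeasure_map (by fun_prop)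

variable {d s : ℕ} (ρ : Kernel (EuclideanSpace ℝ (Fin s)) Y) [IsMarkovKernel ρ]
  (W : Matrix (Fin d) (Fin s) ℝ)

/-- The law of the label `y`. -/
def labelLaw : Measure Y := (gaussianMIM ρ W).fst

/-- The Hermite coefficient `ψ_k(y) = E[He_k(x) | y]`. -/
def hermiteCoeff (k : ℕ) (y : Y) : Tensor d k :=
  ∫ x, hermiteTensor d k x ∂((gaussianMIM ρ W).condKernel y)

/-- `‖ψ_k‖²` in `L²` of the law of the label. -/
def hermiteNormSq (k : ℕ) : ℝ := ∫ y, ‖hermiteCoeff ρ W k y‖ ^ 2 ∂(labelLaw ρ W)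

/-- The generative exponent: the least `k ≥ 1` with `‖ψ_k‖² > 0`. If there is no such `k`, the
value is `0`. -/
def genExponent : ℕ := sInf {k : ℕ | 1 ≤ k ∧ 0 < hermiteNormSq ρ W k}

/-- `⌈(k - ℓ) / 2⌉`, for the generative exponent `k`. -/
def halfGap (ℓ : ℕ) : ℕ := ⌈((genExponent ρ W : ℝ) - ℓ) / 2⌉₊

/-- The contraction index: the least `j ≥ 0` for which
`P_tf(τ^{⌈(k-ℓ)/2⌉+j}(ψ_{ℓ+2⌈(k-ℓ)/2⌉+2j}))` is nonzero in `L²`, where `k` is the generative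
exponent; it is `⊤` if there is no such `j`. -/
def contractionIndex (ℓ : ℕ) : ℕ∞ :=
  ⨅ j ∈ {j : ℕ | 0 < ∫ y, ‖projTF d ℓ (iterTrace d ℓ (halfGap ρ W ℓ + j)
    (hermiteCoeff ρ W (ℓ + 2 * (halfGap ρ W ℓ + j)) y))‖ ^ 2 ∂(labelLaw ρ W)}, (j : ℕ∞)

/-- The rate `d^{-2⌈(k-ℓ)/2⌉ - 2j}` with `j` the contraction index, and with `d^{-∞} = 0`. -/
def directionalRate (ℓ : ℕ) : ℝ :=
  open Classical in
  if contractionIndex ρ W ℓ = ⊤ then 0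
  else (d : ℝ) ^ (-(2 * (halfGap ρ W ℓ : ℝ)) - 2 * ((contractionIndex ρ W ℓ).toNat : ℝ))

/-- The harmonic coefficient `E[H_{d,ℓ}(z) | y]` of the directional model. -/
def harmonicCoeff (ℓ : ℕ) (y : Y) : Tensor d ℓ :=
  ∫ z, harmonicTensor d ℓ z ∂((directionalMIM ρ W).condKernel y)

/-- The squared `L²` norm of the harmonic coefficient of the directional model. -/
def harmonicNormSq (ℓ : ℕ) : ℝ := ∫ y, ‖harmonicCoeff ρ W ℓ y‖ ^ 2 ∂(directionalMIM ρ W).fst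

/-! ### Complexities at a given harmonic degree -/

/-- `1` if `ℓ` is odd and `0` if it is even. -/
def parity (ℓ : ℕ) : ℝ := ((ℓ % 2 : ℕ) : ℝ)

/-- The degree-`ℓ` sample lower bound `d^{ℓ/2} / ‖ξ_ℓ‖²` (infinite if `ξ_ℓ = 0`). -/
def sampleAlign (ℓ : ℕ) : ℝ≥0∞ :=
  ENNReal.ofReal ((d : ℝ) ^ ((ℓ : ℝ) / 2)) / ENNReal.ofReal (harmonicNormSq ρ W ℓ)

/-- The degree-`ℓ` query lower bound `d^ℓ / ‖ξ_ℓ‖²` (infinite if `ξ_ℓ = 0`). -/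
def queryAlign (ℓ : ℕ) : ℝ≥0∞ :=
  ENNReal.ofReal ((d : ℝ) ^ (ℓ : ℝ)) / ENNReal.ofReal (harmonicNormSq ρ W ℓ)

/-- The sample complexity `d^{max(ℓ/2, 1)} / ‖ξ_ℓ‖²` of tensor unfolding at degree `ℓ`. -/
def unfoldingSamples (ℓ : ℕ) : ℝ≥0∞ :=
  ENNReal.ofReal ((d : ℝ) ^ max ((ℓ : ℝ) / 2) 1) / ENNReal.ofReal (harmonicNormSq ρ W ℓ)

/-- The runtime `d^{max(ℓ, 3/2) + δ_ℓ/2} log d / ‖ξ_ℓ‖²` of tensor unfolding at degree `ℓ`. -/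
def unfoldingRuntime (ℓ : ℕ) : ℝ≥0∞ :=
  ENNReal.ofReal ((d : ℝ) ^ (max (ℓ : ℝ) (3 / 2) + parity ℓ / 2) * Real.log d) /
    ENNReal.ofReal (harmonicNormSq ρ W ℓ)

/-- `f` is comparable to the real number `r` with constants `c ≤ c'`. -/
def Comparable (c c' : ℝ) (f : ℝ≥0∞) (r : ℝ) : Prop :=
  ENNReal.ofReal (c * r) ≤ f ∧ f ≤ ENNReal.ofReal (c' * r)

end DirMIM

end

open MeasureTheory ProbabilityTheory
open scoped ENNReal

namespace DirMIM

/-! ### The action of a matrix on tensors -/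

/-! Everything is pulled back to dimension `s`. The label depends on x only through Wᵀx, a standard
Gaussian vector of dimension `s`, so a conditional mean given y is determined by integrals against
bounded functions q(Wᵀx) (`setIntegral_gaussianMIM`, `condMean_gaussianMIM`). Write h_k for
`hermiteProd k 1`. Its conditional mean is W^{⊗k} applied to the conditional mean in `baseMIM`, a
model which involves neither d nor W (`hermiteCoeff_ae_eq`). This is why the constants are uniform.

For the direction, a traceless symmetric A satisfies ⟨A, x^{⊗ℓ}⟩ = ⟨A, h_ℓ(x)⟩
(`inner_hermiteProd_eq_inner_tensorPower`), and ‖x‖^{-ℓ} is a Gamma integral of exp(-t‖x‖²)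
(`integral_homogeneous_direction`). Averages over directions thus become mixtures of Gaussian
averages at variance 1/v, v = 1 + 2t. Up to a scalar, the harmonic coefficient is P_tf W^{⊗ℓ}
applied to the conditional mean of `mixTensor`, a mixture with a beta weight of the heat flow v ↦
`heatTensor ℓ v` (`harmonicNormSq_eq_mixTensor`).

In the variable θ = 1 - 1/v, differentiating the flow gives -1/2 times the partial trace of the flow
of order two higher (`hasDerivAt_heatTensor`). Under the weight θ is of order 1/d, so the j-th
Taylor term is τ^j(h_{ℓ+2j}) with relative size d^{-j}. If J is the first order whose trace has a
nonzero conditional mean, the squared norm is of order d^{-2J} (`exists_mixTensor_energy_bounds`,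
`exists_harmonicNormSq_bounds`). Since Hermite coefficients of positive order below k_* vanish, J =
⌈(k_* - ℓ)/2⌉ + j_*(ℓ) (`directionalRate_eq`). The projection P_tf costs only a constant, by testing
against an isotropic complex frame (`norm_sq_le_norm_projTF_frameTensor`). If no such J exists, the
averaged flow is flat at v = 1 and analytic in v, hence zero, and both sides of the estimate vanish
(`integral_smul_heatTensor_eq_zero`).

For optimality: at ℓ = k_* one has J = 0, so the norm is of order one. A degree ℓ ≤ k_* loses at
least d^{-2⌈(k_* - ℓ)/2⌉}. For ℓ > k_* the bound ‖ξ_ℓ‖² ≤ s^ℓ, valid for all ℓ and d ≥ 3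
(`harmonicNormSq_le`), is beaten by the growth of the numerators in ℓ once s² ≤ d. -/

lemma sum_fin_succ_fun {α M : Type*} [Fintype α] [AddCommMonoid M] {k : ℕ}
    (f : (Fin (k + 1) → α) → M) :
    ∑ i, f i = ∑ j : α, ∑ i : Fin k → α, f (Fin.cons j i) := by
  rw [← (Fin.consEquiv (fun _ => α)).sum_comp, Fintype.sum_prod_type]
  rfl

lemma inner_tensor {d k : ℕ} (A B : Tensor d k) : inner ℝ A B = ∑ i, A i * B i := by
  simp [PiLp.inner_apply, mul_comm]

lemma norm_sq_tensor {d k : ℕ} (A : Tensor d k) : ‖A‖ ^ 2 = ∑ i, A i * A i := by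
  rw [← real_inner_self_eq_norm_sq, inner_tensor]

/-- The action `W^{⊗k}` of a matrix on tensors of order `k`. -/
noncomputable def frameTensor {d s : ℕ} (W : Matrix (Fin d) (Fin s) ℝ) (k : ℕ) :
    Tensor s k →ₗ[ℝ] Tensor d k where
  toFun B := WithLp.toLp 2 fun i => ∑ b : Fin k → Fin s, (∏ a, W (i a) (b a)) * B b
  map_add' A B := by
    ext i
    simp [mul_add, Finset.sum_add_distrib]
  map_smul' c A := by
    ext i
    simp [Finset.mul_sum, mul_left_comm]

lemma frameTensor_apply {d s : ℕ} (W : Matrix (Fin d) (Fin s) ℝ) (k : ℕ) (B : Tensor s k)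
    (i : Fin k → Fin d) :
    frameTensor W k B i = ∑ b : Fin k → Fin s, (∏ a, W (i a) (b a)) * B b := rfl

/-- Contracting two framed tensors sees the frames only through VᵀV'. A general commutative ring is
needed because complex frames occur below, with VᵀV formed without conjugation. -/
lemma sum_prod_mul_sum_prod {R : Type*} [CommRing R] {d s r k : ℕ}
    (V : Matrix (Fin d) (Fin s) R) (V' : Matrix (Fin d) (Fin r) R)
    (B : (Fin k → Fin s) → R) (C : (Fin k → Fin r) → R) :
    ∑ i : Fin k → Fin d, (∑ b, (∏ a, V (i a) (b a)) * B b) * (∑ b, (∏ a, V' (i a) (b a)) * C b)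
      = ∑ b, ∑ b', (∏ a, (V.transpose * V') (b a) (b' a)) * (B b * C b') := by
  simp_rw [Finset.sum_mul_sum]
  rw [Finset.sum_comm]
  refine Finset.sum_congr rfl fun b _ => ?_
  rw [Finset.sum_comm]
  refine Finset.sum_congr rfl fun b' _ => ?_
  simp_rw [Matrix.mul_apply, Matrix.transpose_apply, Finset.prod_univ_sum, Finset.sum_mul,
    Finset.prod_mul_distrib, Fintype.piFinset_univ]
  exact Finset.sum_congr rfl fun i _ => by ring

lemma sum_prod_smul_one {R : Type*} [CommRing R] {s k : ℕ} (c : R)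
    (B C : (Fin k → Fin s) → R) :
    ∑ b, ∑ b', (∏ a, (c • (1 : Matrix (Fin s) (Fin s) R)) (b a) (b' a)) * (B b * C b')
      = c ^ k * ∑ b, B b * C b := by
  rw [Finset.mul_sum]
  refine Finset.sum_congr rfl fun b _ => ?_
  rw [Finset.sum_eq_single b]
  · simp
  · intro b' _ hb'
    obtain ⟨a, ha⟩ := Function.ne_iff.mp hb'
    rw [Finset.prod_eq_zero (Finset.mem_univ a), zero_mul]
    simp [Ne.symm ha]
  · simp

lemma inner_frameTensor {d s k : ℕ} {W : Matrix (Fin d) (Fin s) ℝ} (hW : W ∈ Stiefel d s)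
    (A B : Tensor s k) : inner ℝ (frameTensor W k A) (frameTensor W k B) = inner ℝ A B := by
  have hW' : W.transpose * W = (1 : ℝ) • 1 := by rw [one_smul]; exact hW
  simp_rw [inner_tensor, frameTensor_apply]
  rw [sum_prod_mul_sum_prod, hW', sum_prod_smul_one]
  simp

lemma norm_frameTensor {d s k : ℕ} {W : Matrix (Fin d) (Fin s) ℝ} (hW : W ∈ Stiefel d s)
    (A : Tensor s k) : ‖frameTensor W k A‖ = ‖A‖ := by
  rw [← sq_eq_sq₀ (norm_nonneg _) (norm_nonneg _), ← real_inner_self_eq_norm_sq,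
    ← real_inner_self_eq_norm_sq, inner_frameTensor hW]

lemma inner_frameTensor_right {d s k : ℕ} (W : Matrix (Fin d) (Fin s) ℝ)
    (A : Tensor d k) (B : Tensor s k) :
    inner ℝ A (frameTensor W k B) = inner ℝ (frameTensor W.transpose k A) B := by
  simp_rw [inner_tensor, frameTensor_apply, Finset.mul_sum, Finset.sum_mul]
  rw [Finset.sum_comm]
  refine Finset.sum_congr rfl fun b _ => Finset.sum_congr rfl fun i _ => ?_
  simp only [Matrix.transpose_apply]
  ring

lemma sum_prod_comp_perm {R : Type*} [CommRing R] {d s k : ℕ} (V : Matrix (Fin d) (Fin s) R)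
    {B : (Fin k → Fin s) → R} (hB : ∀ (σ : Equiv.Perm (Fin k)) b, B (b ∘ σ) = B b)
    (σ : Equiv.Perm (Fin k)) (i : Fin k → Fin d) :
    ∑ b, (∏ a, V ((i ∘ σ) a) (b a)) * B b = ∑ b, (∏ a, V (i a) (b a)) * B b := by
  refine Fintype.sum_equiv (Equiv.arrowCongr σ (Equiv.refl (Fin s))) _ _ fun b => ?_
  rw [← Equiv.prod_comp σ fun a => V (i a) _]
  congr 1
  · exact Finset.prod_congr rfl fun a _ => by simp
  · exact (hB σ.symm b).symm

/-- Tracing two slots likewise sees V only through VᵀV: orthonormal columns make the trace commute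
with the frame, and isotropic columns kill it. -/
lemma sum_cons_cons {R : Type*} [CommRing R] {d s k : ℕ} (V : Matrix (Fin d) (Fin s) R)
    (B : (Fin (k + 2) → Fin s) → R) (i : Fin k → Fin d) :
    ∑ j : Fin d, ∑ b : Fin (k + 2) → Fin s,
      (∏ a, V ((Fin.cons j (Fin.cons j i : Fin (k + 1) → Fin d) : Fin (k + 2) → Fin d) a) (b a))
        * B b
      = ∑ b₀, ∑ b₁, (V.transpose * V) b₀ b₁ * ∑ b : Fin k → Fin s, (∏ a, V (i a) (b a)) *
        B (Fin.cons b₀ (Fin.cons b₁ b : Fin (k + 1) → Fin s)) := by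
  simp_rw [sum_fin_succ_fun, Fin.prod_univ_succ, Fin.cons_zero, Fin.cons_succ, Matrix.mul_apply,
    Matrix.transpose_apply, Finset.sum_mul, Finset.mul_sum]
  rw [Finset.sum_comm]
  refine Finset.sum_congr rfl fun b₀ _ => ?_
  rw [Finset.sum_comm]
  refine Finset.sum_congr rfl fun b₁ _ => Finset.sum_congr rfl fun j _ =>
    Finset.sum_congr rfl fun b _ => ?_
  simp only [Fin.cons_zero]
  ring

lemma partialTrace_frameTensor {d s k : ℕ} {W : Matrix (Fin d) (Fin s) ℝ} (hW : W ∈ Stiefel d s)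
    (B : Tensor s (k + 2)) :
    partialTrace d k (frameTensor W (k + 2) B) = frameTensor W k (partialTrace s k B) := by
  have hW' : W.transpose * W = 1 := hW
  ext i
  have h := sum_cons_cons W (fun b => B b) i
  rw [hW'] at h
  refine h.trans ?_
  simp only [Matrix.one_apply, ite_mul, one_mul, zero_mul, Finset.sum_ite_eq, Finset.mem_univ,
    if_true, frameTensor_apply]
  rw [Finset.sum_comm]
  refine Finset.sum_congr rfl fun b _ => ?_
  rw [← Finset.mul_sum]
  rfl

lemma iterTrace_frameTensor {d s ℓ : ℕ} {W : Matrix (Fin d) (Fin s) ℝ} (hW : W ∈ Stiefel d s)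
    (j : ℕ) (B : Tensor s (ℓ + 2 * j)) :
    iterTrace d ℓ j (frameTensor W (ℓ + 2 * j) B) = frameTensor W ℓ (iterTrace s ℓ j B) := by
  induction j with
  | zero => rfl
  | succ j ih =>
    change iterTrace d ℓ j (partialTrace d (ℓ + 2 * j) (frameTensor W (ℓ + 2 * j + 2) B)) = _
    rw [partialTrace_frameTensor hW, ih]
    rfl

lemma partialTrace_mem_symTensors {d k : ℕ} {B : Tensor d (k + 2)}
    (hB : B ∈ symTensors d (k + 2)) : partialTrace d k B ∈ symTensors d k := by
  intro σ i
  change ∑ j : Fin d, B (Fin.cons j (Fin.cons j (i ∘ σ) : Fin (k + 1) → Fin d)) =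
    ∑ j : Fin d, B (Fin.cons j (Fin.cons j i : Fin (k + 1) → Fin d))
  refine Finset.sum_congr rfl fun j _ => ?_
  -- The permutation σ is extended to `Fin (k + 2)` by fixing the two traced slots.
  have h := hB (Equiv.Perm.decomposeFin.symm (0, Equiv.Perm.decomposeFin.symm (0, σ)))
    (Fin.cons j (Fin.cons j i : Fin (k + 1) → Fin d))
  rw [← h]
  refine congrArg B ?_
  funext a
  refine Fin.cases ?_ (fun a => ?_) a
  · simp
  · refine Fin.cases ?_ (fun a => ?_) a
    · simp
    · simp

lemma iterTrace_mem_symTensors {d ℓ : ℕ} (j : ℕ) {B : Tensor d (ℓ + 2 * j)}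
    (hB : B ∈ symTensors d (ℓ + 2 * j)) : iterTrace d ℓ j B ∈ symTensors d ℓ := by
  induction j with
  | zero => exact hB
  | succ j ih => exact ih (partialTrace_mem_symTensors (k := ℓ + 2 * j) hB)

lemma tracelessSym_le_symTensors (d ℓ : ℕ) : tracelessSym d ℓ ≤ symTensors d ℓ := by
  match ℓ with
  | 0 => exact le_rfl
  | 1 => exact le_rfl
  | ℓ + 2 => exact inf_le_left

/-! ### Completing a frame -/

lemma exists_orthogonal_extension {d s : ℕ} {W : Matrix (Fin d) (Fin s) ℝ} (hW : W ∈ Stiefel d s) :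
    ∃ (hs : s ≤ d) (U : Matrix (Fin d) (Fin d) ℝ), U ∈ Stiefel d d ∧
      ∀ j a, U j (Fin.castLE hs a) = W j a := by
  have hW' : W.transpose * W = 1 := hW
  let w : Fin s → EuclideanSpace ℝ (Fin d) := fun a => WithLp.toLp 2 fun j => W j a
  have hw : Orthonormal ℝ w := by
    rw [orthonormal_iff_ite]
    intro a b
    have := congrFun (congrFun hW' a) b
    rw [Matrix.mul_apply, Matrix.one_apply] at this
    rw [← this]
    simp [w, PiLp.inner_apply, mul_comm]
  have hs : s ≤ d := by
    simpa using hw.linearIndependent.fintype_card_le_finrank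
  -- The frame is padded by zeros to a family indexed by `Fin d`; orthonormality is required only on
  -- the first s indices.
  let v : Fin d → EuclideanSpace ℝ (Fin d) := fun j => if h : j.1 < s then w ⟨j, h⟩ else 0
  have hv : ∀ a : Fin s, v (Fin.castLE hs a) = w a := fun a => by simp [v]
  obtain ⟨b, hb⟩ := Orthonormal.exists_orthonormalBasis_extension_of_card_eq (𝕜 := ℝ)
    (ι := Fin d) (E := EuclideanSpace ℝ (Fin d)) (by simp) (v := v) (s := {j | j.1 < s}) (by
      rw [orthonormal_iff_ite]
      rintro ⟨i, hi⟩ ⟨j, hj⟩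
      have := orthonormal_iff_ite.mp hw ⟨i, hi⟩ ⟨j, hj⟩
      have h1 : v i = w ⟨i, hi⟩ := dif_pos hi
      have h2 : v j = w ⟨j, hj⟩ := dif_pos hj
      simp only [Set.domRestrict_apply, h1, h2, this]
      simp [Fin.ext_iff])
  refine ⟨hs, Matrix.of fun i j => b j i, ?_, ?_⟩
  · ext i j
    have := orthonormal_iff_ite.mp b.orthonormal i j
    rw [Matrix.mul_apply, Matrix.one_apply, ← this]
    simp [PiLp.inner_apply, mul_comm]
  · intro j a
    have := hb (Fin.castLE hs a) a.2
    simp [this, hv, w]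

/-! ### Traceless projections of framed tensors -/

lemma re_isotropic_mem_tracelessSym {d s ℓ : ℕ} {V : Matrix (Fin d) (Fin s) ℂ}
    (hV : V.transpose * V = 0) {B : Tensor s ℓ} (hB : B ∈ symTensors s ℓ) :
    (WithLp.toLp 2 fun i => (∑ b : Fin ℓ → Fin s, (∏ a, V (i a) (b a)) * (B b : ℂ)).re :
      Tensor d ℓ) ∈ tracelessSym d ℓ := by
  have h : (WithLp.toLp 2 fun i => (∑ b : Fin ℓ → Fin s, (∏ a, V (i a) (b a)) * (B b : ℂ)).re :
      Tensor d ℓ) ∈ symTensors d ℓ := fun σ i => congrArg Complex.re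
    (sum_prod_comp_perm V (B := fun b => (B b : ℂ)) (fun σ b => congrArg _ (hB σ b)) σ i)
  match ℓ with
  | 0 => exact h
  | 1 => exact h
  | ℓ + 2 =>
    refine ⟨h, ?_⟩
    refine LinearMap.mem_ker.mpr ?_
    ext i
    have := sum_cons_cons V (fun b => (B b : ℂ)) i
    rw [hV] at this
    have h2 := congrArg Complex.re this
    rw [Complex.re_sum] at h2
    refine h2.trans ?_
    simp

/-- Testing against a traceless tensor bounds the projection from below. The test tensor is A =
Re(V^{⊗ℓ}B) with V = W + iU', where U' has s orthonormal columns orthogonal to W; this is where 2s ≤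
d enters. It is traceless because VᵀV = 0, it pairs with W^{⊗ℓ}B to ‖B‖² because VᵀW = 1, and ‖A‖² ≤
2^ℓ‖B‖² because VᵀV̄ = 2. Cauchy-Schwarz concludes, without any loss in d. -/
lemma norm_sq_le_norm_projTF_frameTensor {d s ℓ : ℕ} {W : Matrix (Fin d) (Fin s) ℝ}
    (hW : W ∈ Stiefel d s) (hd : 2 * s ≤ d) {B : Tensor s ℓ} (hB : B ∈ symTensors s ℓ) :
    ‖B‖ ^ 2 ≤ 2 ^ ℓ * ‖projTF d ℓ (frameTensor W ℓ B)‖ ^ 2 := by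
  obtain ⟨hs, U, hU, hUW⟩ := exists_orthogonal_extension hW
  have hU' : U.transpose * U = 1 := hU
  -- The columns s, …, 2s - 1 of the orthogonal completion serve as U'.
  let e : Fin s → Fin d := fun a => ⟨s + a, by omega⟩
  let V : Matrix (Fin d) (Fin s) ℂ := fun j a => W j a + Complex.I * U j (e a)
  have hWW : ∀ a b, ∑ j, W j a * W j b = if a = b then 1 else 0 := fun a b => by
    have := congrFun (congrFun hW a) b
    simpa [Matrix.mul_apply, Matrix.one_apply] using this
  have hUU : ∀ a b, ∑ j, U j a * U j b = if a = b then 1 else 0 := fun a b => by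
    have := congrFun (congrFun hU' a) b
    simpa [Matrix.mul_apply, Matrix.one_apply] using this
  have hWU : ∀ a b, ∑ j, W j a * U j (e b) = 0 := fun a b => by
    simp_rw [← hUW]
    rw [hUU, if_neg]
    simp [e, Fin.ext_iff]
    omega
  have hUe : ∀ a b, ∑ j, U j (e a) * U j (e b) = if a = b then 1 else 0 := fun a b => by
    rw [hUU]; simp [e, Fin.ext_iff]
  have cast1 : ∀ f : Fin d → ℝ, ∑ j, (f j : ℂ) = ((∑ j, f j : ℝ) : ℂ) := fun f => by push_cast; rfl
  have hVV : V.transpose * V = 0 := by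
    ext a b
    have : ∀ j, V j a * V j b = ((W j a * W j b : ℝ) : ℂ) - ((U j (e a) * U j (e b) : ℝ) : ℂ) +
        Complex.I * (((W j a * U j (e b) : ℝ) : ℂ) + ((W j b * U j (e a) : ℝ) : ℂ)) := fun j => by
      simp only [V]; push_cast; linear_combination (U j (e a) * U j (e b) : ℂ) * Complex.I_sq
    simp only [Matrix.mul_apply, Matrix.transpose_apply, this, Finset.sum_add_distrib,
      Finset.sum_sub_distrib, ← Finset.mul_sum, cast1, hWW, hUe, hWU]
    simp
  have hVW : V.transpose * W.map (algebraMap ℝ ℂ) = (1 : ℂ) • 1 := by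
    ext a b
    have : ∀ j, V j a * (W j b : ℂ) = ((W j a * W j b : ℝ) : ℂ) +
        Complex.I * (((W j b * U j (e a) : ℝ) : ℂ)) := fun j => by
      simp only [V]; push_cast; ring
    simp only [Matrix.mul_apply, Matrix.transpose_apply, Matrix.map_apply,
      Complex.coe_algebraMap, this, Finset.sum_add_distrib,
      ← Finset.mul_sum, cast1, hWW, hWU]
    simp only [Matrix.smul_apply, Matrix.one_apply]
    split_ifs <;> norm_num
  have hVc : V.transpose * V.map (starRingEnd ℂ) = (2 : ℂ) • 1 := by
    ext a b
    have : ∀ j, V j a * starRingEnd ℂ (V j b) = ((W j a * W j b : ℝ) : ℂ) +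
        ((U j (e a) * U j (e b) : ℝ) : ℂ) +
        Complex.I * (((W j b * U j (e a) : ℝ) : ℂ) - ((W j a * U j (e b) : ℝ) : ℂ)) := fun j => by
      simp only [V, map_add, map_mul, Complex.conj_I, Complex.conj_ofReal]
      push_cast; linear_combination -(U j (e a) * U j (e b) : ℂ) * Complex.I_sq
    simp only [Matrix.mul_apply, Matrix.transpose_apply, Matrix.map_apply, this,
      Finset.sum_add_distrib, Finset.sum_sub_distrib, ← Finset.mul_sum, cast1, hWW, hUe, hWU]
    simp only [Matrix.smul_apply, Matrix.one_apply]
    split_ifs <;> norm_num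
  let c : (Fin ℓ → Fin d) → ℂ := fun i => ∑ b : Fin ℓ → Fin s, (∏ a, V (i a) (b a)) * (B b : ℂ)
  let A : Tensor d ℓ := WithLp.toLp 2 fun i => (c i).re
  have hA : ‖A‖ ^ 2 ≤ 2 ^ ℓ * ‖B‖ ^ 2 := by
    have h := sum_prod_mul_sum_prod (k := ℓ) V (V.map (starRingEnd ℂ)) (fun b => (B b : ℂ))
      (fun b => (B b : ℂ))
    rw [hVc, sum_prod_smul_one] at h
    have h1 : ∀ i, (∑ b : Fin ℓ → Fin s, (∏ a, V (i a) (b a)) * (B b : ℂ)) *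
        (∑ b : Fin ℓ → Fin s, (∏ a, (V.map (starRingEnd ℂ)) (i a) (b a)) * (B b : ℂ))
        = ((Complex.normSq (c i) : ℝ) : ℂ) := fun i => by
      rw [← Complex.mul_conj]
      simp [c, map_sum, map_mul, map_prod]
    rw [Finset.sum_congr rfl fun i _ => h1 i] at h
    have h2 : ∑ i, Complex.normSq (c i) = 2 ^ ℓ * ‖B‖ ^ 2 := by
      rw [norm_sq_tensor]
      exact_mod_cast h
    rw [← h2, norm_sq_tensor]
    refine Finset.sum_le_sum fun i _ => ?_
    simp only [A, Complex.normSq_apply]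
    nlinarith [mul_self_nonneg (c i).im]
  have hin : inner ℝ A (frameTensor W ℓ B) = ‖B‖ ^ 2 := by
    have h := sum_prod_mul_sum_prod (k := ℓ) V (W.map (algebraMap ℝ ℂ)) (fun b => (B b : ℂ))
      (fun b => (B b : ℂ))
    rw [hVW, sum_prod_smul_one] at h
    have h1 : ∀ i, (∑ b : Fin ℓ → Fin s, (∏ a, V (i a) (b a)) * (B b : ℂ)) *
        (∑ b : Fin ℓ → Fin s, (∏ a, (W.map (algebraMap ℝ ℂ)) (i a) (b a)) * (B b : ℂ))
        = c i * ((frameTensor W ℓ B i : ℝ) : ℂ) := fun i => by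
      simp [c, frameTensor_apply]
    rw [Finset.sum_congr rfl fun i _ => h1 i] at h
    have h2 := congrArg Complex.re h
    rw [inner_tensor, norm_sq_tensor]
    simp only [Complex.re_sum, Complex.re_mul_ofReal, one_pow, one_mul] at h2
    refine h2.trans ?_
    simp
  have hAt : A ∈ tracelessSym d ℓ := re_isotropic_mem_tracelessSym hVV hB
  have hproj : inner ℝ A (frameTensor W ℓ B) = inner ℝ A (projTF d ℓ (frameTensor W ℓ B)) := by
    unfold projTF
    rw [← Submodule.inner_starProjection_left_eq_right,
      Submodule.starProjection_eq_self_iff.mpr hAt]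
  have h3 : ‖B‖ ^ 2 ≤ ‖A‖ * ‖projTF d ℓ (frameTensor W ℓ B)‖ := by
    rw [← hin, hproj]
    exact real_inner_le_norm _ _
  rcases (norm_nonneg B).eq_or_lt with h0 | h0
  · rw [← h0]; simp
  · have h4 : (‖B‖ ^ 2) ^ 2 ≤ (‖A‖ * ‖projTF d ℓ (frameTensor W ℓ B)‖) ^ 2 := by gcongr
    have h5 : ‖B‖ ^ 2 * ‖B‖ ^ 2 ≤
        ‖B‖ ^ 2 * (2 ^ ℓ * ‖projTF d ℓ (frameTensor W ℓ B)‖ ^ 2) := by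
      calc ‖B‖ ^ 2 * ‖B‖ ^ 2 = (‖B‖ ^ 2) ^ 2 := by ring
        _ ≤ _ := h4
        _ = ‖A‖ ^ 2 * ‖projTF d ℓ (frameTensor W ℓ B)‖ ^ 2 := by ring
        _ ≤ (2 ^ ℓ * ‖B‖ ^ 2) * ‖projTF d ℓ (frameTensor W ℓ B)‖ ^ 2 := by gcongr
        _ = _ := by ring
    exact le_of_mul_le_mul_left h5 (by positivity)

lemma projTF_mem (d ℓ : ℕ) (A : Tensor d ℓ) : projTF d ℓ A ∈ tracelessSym d ℓ :=
  Submodule.starProjection_apply_mem _ _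

lemma projTF_eq_self {d ℓ : ℕ} {A : Tensor d ℓ} (hA : A ∈ tracelessSym d ℓ) : projTF d ℓ A = A :=
  Submodule.starProjection_eq_self_iff.mpr hA

lemma inner_projTF_left {d ℓ : ℕ} (A B : Tensor d ℓ) :
    inner ℝ (projTF d ℓ A) B = inner ℝ A (projTF d ℓ B) :=
  Submodule.inner_starProjection_left_eq_right _ _ _

lemma norm_projTF_le {d ℓ : ℕ} (A : Tensor d ℓ) : ‖projTF d ℓ A‖ ≤ ‖A‖ :=
  Submodule.norm_starProjection_apply_le _ _

/-! ### Scaled Hermite polynomials -/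

/-- The scaled Hermite polynomials `v^{n/2} h_n(√v x)`, with `h_n` the monic (probabilists')
Hermite polynomials. -/
noncomputable def hermiteScaled : ℕ → ℝ → ℝ → ℝ
  | 0, _, _ => 1
  | 1, v, x => v * x
  | n + 2, v, x => v * (x * hermiteScaled (n + 1) v x - (n + 1) * hermiteScaled n v x)

/-- The predecessor `n - 1` is truncated at n = 0, where its coefficient vanishes. -/
lemma hermiteScaled_succ (n : ℕ) (v x : ℝ) :
    hermiteScaled (n + 1) v x =
      v * (x * hermiteScaled n v x - n * hermiteScaled (n - 1) v x) := by
  cases n with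
  | zero => simp [hermiteScaled]
  | succ n => simp [hermiteScaled]

lemma hermiteScaled_sq (n : ℕ) (r x : ℝ) :
    hermiteScaled n (r ^ 2) x = r ^ n * hermiteScaled n 1 (r * x) := by
  induction n using Nat.twoStepInduction with
  | zero => simp [hermiteScaled]
  | one => simp [hermiteScaled]; ring
  | more n h1 h2 => simp only [hermiteScaled, h1, h2]; ring

lemma continuous_hermiteScaled (n : ℕ) (v : ℝ) : Continuous (hermiteScaled n v) := by
  induction n using Nat.twoStepInduction with
  | zero => simp only [hermiteScaled]; fun_prop
  | one => simp only [hermiteScaled]; fun_prop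
  | more n h1 h2 => simp only [hermiteScaled]; fun_prop

lemma hasDerivAt_hermiteScaled_one (n : ℕ) (x : ℝ) :
    HasDerivAt (hermiteScaled n 1) (n * hermiteScaled (n - 1) 1 x) x := by
  induction n using Nat.twoStepInduction with
  | zero =>
    simp only [hermiteScaled]
    simpa using hasDerivAt_const x (1 : ℝ)
  | one =>
    simpa [hermiteScaled] using hasDerivAt_id' x
  | more n h1 h2 =>
    have h := (((hasDerivAt_id x).mul h2).sub (h1.const_mul ((n : ℝ) + 1))).const_mul (1 : ℝ)
    simp only [hermiteScaled]
    refine h.congr_deriv ?_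
    have := hermiteScaled_succ n 1 x
    simp only [Nat.add_sub_cancel, id, Nat.cast_add, Nat.cast_one] at this ⊢
    have e : n + 2 - 1 = n + 1 := by omega
    rw [e, this]
    push_cast
    ring

lemma hasDerivAt_hermiteScaled_mul_exp (n : ℕ) (x : ℝ) :
    HasDerivAt (fun x => hermiteScaled n 1 x * Real.exp (-x ^ 2 / 2))
      (-(hermiteScaled (n + 1) 1 x * Real.exp (-x ^ 2 / 2))) x := by
  have h1 : HasDerivAt (fun x : ℝ => -x ^ 2 / 2) (-x) x := by
    refine (((hasDerivAt_id x).pow 2).neg.div_const 2).congr_deriv ?_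
    simp; ring
  refine ((hasDerivAt_hermiteScaled_one n x).mul h1.exp).congr_deriv ?_
  rw [hermiteScaled_succ]
  ring

/-- The growth is recorded in v as well as in x: the powers of v are later absorbed by the beta
weight. -/
lemma exists_abs_hermiteScaled_le (n : ℕ) :
    ∃ K : ℝ, 1 ≤ K ∧ ∀ v x : ℝ, 1 ≤ v → |hermiteScaled n v x| ≤ K * v ^ n * (1 + |x|) ^ n := by
  induction n using Nat.twoStepInduction with
  | zero => exact ⟨1, le_rfl, fun v x _ => by simp [hermiteScaled]⟩
  | one =>
    refine ⟨1, le_rfl, fun v x hv => ?_⟩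
    simp only [hermiteScaled, abs_mul, abs_of_nonneg (zero_le_one.trans hv)]
    have := abs_nonneg x
    nlinarith
  | more n h1 h2 =>
    obtain ⟨K1, hK1, h1⟩ := h1
    obtain ⟨K2, hK2, h2⟩ := h2
    refine ⟨K2 + (n + 1) * K1, by nlinarith [Nat.cast_nonneg (α := ℝ) n], fun v x hv => ?_⟩
    have h0 : 0 ≤ v := zero_le_one.trans hv
    have hx := abs_nonneg x
    have a1 : |x * hermiteScaled (n + 1) v x| ≤ K2 * v ^ (n + 1) * (1 + |x|) ^ (n + 2) := by
      rw [abs_mul]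
      calc |x| * |hermiteScaled (n + 1) v x|
          ≤ (1 + |x|) * (K2 * v ^ (n + 1) * (1 + |x|) ^ (n + 1)) := by
            gcongr
            · linarith
            · exact h2 v x hv
        _ = _ := by ring
    have a2 : |((n : ℝ) + 1) * hermiteScaled n v x| ≤
        (n + 1) * K1 * v ^ (n + 1) * (1 + |x|) ^ (n + 2) := by
      rw [abs_mul, abs_of_nonneg (by positivity), mul_assoc, mul_assoc]
      refine mul_le_mul_of_nonneg_left ((h1 v x hv).trans ?_) (by positivity)
      rw [mul_assoc]
      gcongr <;> linarith
    simp only [hermiteScaled, abs_mul, abs_of_nonneg h0]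
    calc v * |x * hermiteScaled (n + 1) v x - (n + 1) * hermiteScaled n v x|
        ≤ v * (K2 * v ^ (n + 1) * (1 + |x|) ^ (n + 2) +
          (n + 1) * K1 * v ^ (n + 1) * (1 + |x|) ^ (n + 2)) := by
          gcongr
          exact (abs_sub _ _).trans (add_le_add a1 a2)
      _ = _ := by ring

/-! ### Hermite tensors as products -/

/-- The number of occurrences of `j` among the entries of a multi-index. -/
def indexCount {d k : ℕ} (i : Fin k → Fin d) (j : Fin d) : ℕ := ∑ a, if i a = j then 1 else 0

lemma indexCount_cons {d k : ℕ} (m : Fin d) (i : Fin k → Fin d) (j : Fin d) :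
    indexCount (Fin.cons m i : Fin (k + 1) → Fin d) j =
      (if m = j then 1 else 0) + indexCount i j := by
  rw [indexCount, Fin.sum_univ_succ]
  simp only [Fin.cons_zero, Fin.cons_succ, indexCount]

lemma indexCount_comp_perm {d k : ℕ} (i : Fin k → Fin d) (σ : Equiv.Perm (Fin k)) (j : Fin d) :
    indexCount (i ∘ σ) j = indexCount i j :=
  Equiv.sum_comp σ fun a => if i a = j then 1 else 0

lemma sum_indexCount {d k : ℕ} (i : Fin k → Fin d) : ∑ j, indexCount i j = k := by
  unfold indexCount
  rw [Finset.sum_comm]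
  simp

/-- The tensor with entries `∏_j q_{n_j}(v, x_j)`, with `q` the scaled Hermite polynomials and
`n_j` the number of occurrences of `j` in the multi-index. -/
noncomputable def hermiteProd {d : ℕ} (k : ℕ) (v : ℝ) (x : EuclideanSpace ℝ (Fin d)) :
    Tensor d k :=
  WithLp.toLp 2 fun i => ∏ j, hermiteScaled (indexCount i j) v (x j)

lemma hermiteProd_apply {d : ℕ} (k : ℕ) (v : ℝ) (x : EuclideanSpace ℝ (Fin d))
    (i : Fin k → Fin d) :
    hermiteProd k v x i = ∏ j, hermiteScaled (indexCount i j) v (x j) := rfl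

lemma hermiteProd_mem_symTensors {d : ℕ} (k : ℕ) (v : ℝ) (x : EuclideanSpace ℝ (Fin d)) :
    hermiteProd k v x ∈ symTensors d k := by
  intro σ i
  simp only [hermiteProd_apply, indexCount_comp_perm]

lemma hermiteProd_sq {d : ℕ} (k : ℕ) (r : ℝ) (x : EuclideanSpace ℝ (Fin d)) :
    hermiteProd k (r ^ 2) x = r ^ k • hermiteProd k 1 (r • x) := by
  ext i
  simp only [hermiteProd_apply, PiLp.smul_apply, hermiteScaled_sq, Finset.prod_mul_distrib,
    Finset.prod_pow_eq_pow_sum, sum_indexCount, smul_eq_mul]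

lemma continuous_hermiteProd {d : ℕ} (k : ℕ) (v : ℝ) :
    Continuous (hermiteProd (d := d) k v) := by
  refine (PiLp.continuous_toLp 2 _).comp
    (continuous_pi fun i => continuous_finsetProd _ fun j _ => ?_)
  exact (continuous_hermiteScaled _ _).comp (by fun_prop)

lemma exists_norm_hermiteProd_le (d k : ℕ) :
    ∃ K : ℝ, 1 ≤ K ∧ ∀ (v : ℝ) (x : EuclideanSpace ℝ (Fin d)), 1 ≤ v →
      ‖hermiteProd k v x‖ ≤ K * v ^ k * (1 + ‖x‖) ^ k := by
  choose K hK hle using exists_abs_hermiteScaled_le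
  refine ⟨1 + ∑ i : Fin k → Fin d, ∏ j, K (indexCount i j), ?_, fun v x hv => ?_⟩
  · have : 0 ≤ ∑ i : Fin k → Fin d, ∏ j, K (indexCount i j) :=
      Finset.sum_nonneg fun i _ => Finset.prod_nonneg fun j _ => zero_le_one.trans (hK _)
    linarith
  have h0 : 0 ≤ v := zero_le_one.trans hv
  have h1 : ‖hermiteProd k v x‖ ≤ ∑ i : Fin k → Fin d, |hermiteProd k v x i| := by
    rw [EuclideanSpace.norm_eq]
    refine Real.sqrt_le_iff.mpr ⟨Finset.sum_nonneg fun i _ => abs_nonneg _, ?_⟩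
    simpa using Finset.sum_sq_le_sq_sum_of_nonneg (s := Finset.univ)
      (f := fun i => |hermiteProd k v x i|) fun i _ => abs_nonneg _
  refine h1.trans ?_
  have h2 : ∀ i, |hermiteProd k v x i| ≤
      (∏ j, K (indexCount i j)) * (v ^ k * (1 + ‖x‖) ^ k) := fun i => by
    rw [hermiteProd_apply, Finset.abs_prod]
    calc ∏ j, |hermiteScaled (indexCount i j) v (x j)|
        ≤ ∏ j, (K (indexCount i j) * (v ^ indexCount i j * (1 + ‖x‖) ^ indexCount i j)) := by
          refine Finset.prod_le_prod (fun j _ => abs_nonneg _) fun j _ => ?_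
          refine (hle _ v (x j) hv).trans ?_
          rw [mul_assoc]
          have := PiLp.norm_apply_le x j
          rw [Real.norm_eq_abs] at this
          have := zero_le_one.trans (hK (indexCount i j))
          gcongr
      _ = _ := by
          simp only [Finset.prod_mul_distrib, Finset.prod_pow_eq_pow_sum, sum_indexCount]
  calc ∑ i : Fin k → Fin d, |hermiteProd k v x i|
      ≤ ∑ i : Fin k → Fin d, (∏ j, K (indexCount i j)) * (v ^ k * (1 + ‖x‖) ^ k) :=
        Finset.sum_le_sum fun i _ => h2 i
    _ = (∑ i : Fin k → Fin d, ∏ j, K (indexCount i j)) * (v ^ k * (1 + ‖x‖) ^ k) := by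
        rw [Finset.sum_mul]
    _ ≤ (1 + ∑ i : Fin k → Fin d, ∏ j, K (indexCount i j)) * (v ^ k * (1 + ‖x‖) ^ k) := by
        gcongr; linarith
    _ = _ := by ring

/-! ### Derivatives of the Gaussian density -/

lemma gaussianDensity_eq_prod {d : ℕ} (x : EuclideanSpace ℝ (Fin d)) :
    gaussianDensity d x = (2 * Real.pi) ^ (-(d : ℝ) / 2) * ∏ j, Real.exp (-x j ^ 2 / 2) := by
  rw [gaussianDensity, ← Real.exp_sum, EuclideanSpace.real_norm_sq_eq, ← Finset.sum_div,
    Finset.sum_neg_distrib]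

lemma gaussianDensity_pos {d : ℕ} (x : EuclideanSpace ℝ (Fin d)) : 0 < gaussianDensity d x := by
  unfold gaussianDensity; positivity

lemma contDiff_gaussianDensity (d : ℕ) {n : WithTop ℕ∞} : ContDiff ℝ n (gaussianDensity d) := by
  unfold gaussianDensity
  have : ContDiff ℝ n fun x : EuclideanSpace ℝ (Fin d) => ‖x‖ ^ 2 := contDiff_norm_sq ℝ
  fun_prop

/-- The density is a product over coordinates and (h_n e^{-x²/2})' = -h_{n+1} e^{-x²/2}, so a
derivative along e_j raises the j-th count by one and touches nothing else. -/
lemma iteratedFDeriv_gaussianDensity {d k : ℕ} (x : EuclideanSpace ℝ (Fin d)) (i : Fin k → Fin d) :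
    iteratedFDeriv ℝ k (gaussianDensity d) x (fun a => EuclideanSpace.single (i a) (1 : ℝ)) =
      (-1) ^ k * hermiteProd k 1 x i * gaussianDensity d x := by
  induction k generalizing x with
  | zero => simp [hermiteProd_apply, indexCount, hermiteScaled]
  | succ k ih =>
    rw [iteratedFDeriv_succ_apply_left]
    set m : Fin k → EuclideanSpace ℝ (Fin d) :=
      Fin.tail fun a => EuclideanSpace.single (i a) (1 : ℝ) with hm
    set j := i 0 with hj
    set i' : Fin k → Fin d := fun a => i a.succ with hi'
    have hi : i = Fin.cons j i' := (Fin.cons_self_tail i).symm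
    have hd1 : DifferentiableAt ℝ (iteratedFDeriv ℝ k (gaussianDensity d)) x :=
      ((contDiff_gaussianDensity d (n := ((k + 1 : ℕ) : ℕ∞))).differentiable_iteratedFDeriv (by
        exact_mod_cast Nat.lt_succ_self k)).differentiableAt
    have h1 : HasFDerivAt (fun y => iteratedFDeriv ℝ k (gaussianDensity d) y m)
        ((ContinuousMultilinearMap.apply ℝ _ ℝ m).comp
          (fderiv ℝ (iteratedFDeriv ℝ k (gaussianDensity d)) x)) x :=
      (ContinuousMultilinearMap.apply ℝ _ ℝ m).hasFDerivAt.comp x hd1.hasFDerivAt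
    have h2 := h1.hasLineDerivAt (EuclideanSpace.single j (1 : ℝ))
    have h3 : HasLineDerivAt ℝ (fun y => iteratedFDeriv ℝ k (gaussianDensity d) y m)
        ((-1) ^ (k + 1) * hermiteProd (k + 1) 1 x i * gaussianDensity d x) x
          (EuclideanSpace.single j (1 : ℝ)) := by
      have e1 : ∀ y : EuclideanSpace ℝ (Fin d), iteratedFDeriv ℝ k (gaussianDensity d) y m =
          (-1) ^ k * (2 * Real.pi) ^ (-(d : ℝ) / 2) *
            ∏ l, (hermiteScaled (indexCount i' l) 1 (y l) * Real.exp (-y l ^ 2 / 2)) := fun y => by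
        have := ih y i'
        rw [Finset.prod_mul_distrib]
        refine this.trans ?_
        rw [gaussianDensity_eq_prod, hermiteProd_apply]
        ring
      unfold HasLineDerivAt
      simp_rw [e1]
      -- Only the j-th factor varies along the line x + ε e_j.
      have e2 : ∀ ε : ℝ, ∏ l, (hermiteScaled (indexCount i' l) 1
            ((x + ε • EuclideanSpace.single j (1 : ℝ)) l) *
            Real.exp (-((x + ε • EuclideanSpace.single j (1 : ℝ)) l) ^ 2 / 2)) =
          (hermiteScaled (indexCount i' j) 1 (x j + ε) * Real.exp (-(x j + ε) ^ 2 / 2)) *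
          ∏ l ∈ Finset.univ.erase j,
            (hermiteScaled (indexCount i' l) 1 (x l) * Real.exp (-x l ^ 2 / 2)) := fun ε => by
        rw [← Finset.mul_prod_erase _ _ (Finset.mem_univ j)]
        congr 1
        · simp
        · refine Finset.prod_congr rfl fun l hl => ?_
          have := Finset.ne_of_mem_erase hl
          simp [this]
      simp_rw [e2]
      have h4 : HasDerivAt (fun ε : ℝ => hermiteScaled (indexCount i' j) 1 (x j + ε) *
          Real.exp (-(x j + ε) ^ 2 / 2)) (-(hermiteScaled (indexCount i' j + 1) 1 (x j) *
            Real.exp (-x j ^ 2 / 2))) 0 := by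
        have := hasDerivAt_hermiteScaled_mul_exp (indexCount i' j) (x j + 0)
        have h5 := this.comp_const_add (x j) 0
        simpa using h5
      refine ((h4.mul_const _).const_mul _).congr_deriv ?_
      rw [hermiteProd_apply, gaussianDensity_eq_prod,
        ← Finset.mul_prod_erase _ _ (Finset.mem_univ j),
        ← Finset.mul_prod_erase Finset.univ (fun l => Real.exp (-x l ^ 2 / 2)) (Finset.mem_univ j),
        Finset.prod_mul_distrib, hi]
      have e3 : ∏ l ∈ Finset.univ.erase j, hermiteScaled
          (indexCount (Fin.cons j i' : Fin (k + 1) → Fin d) l) 1 (x l) =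
          ∏ l ∈ Finset.univ.erase j, hermiteScaled (indexCount i' l) 1 (x l) := by
        refine Finset.prod_congr rfl fun l hl => ?_
        rw [indexCount_cons, if_neg (Finset.ne_of_mem_erase hl).symm, zero_add]
      rw [e3, indexCount_cons, if_pos rfl, add_comm 1]
      ring
    exact h2.unique h3

lemma hermiteTensor_eq {d k : ℕ} (x : EuclideanSpace ℝ (Fin d)) :
    hermiteTensor d k x = (√(k.factorial : ℝ))⁻¹ • hermiteProd k 1 x := by
  ext i
  simp only [hermiteTensor, iteratedFDeriv_gaussianDensity, PiLp.smul_apply, smul_eq_mul]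
  have := (gaussianDensity_pos x).ne'
  have h : ((-1 : ℝ) ^ k) * (-1) ^ k = 1 := by rw [← mul_pow]; simp
  field_simp
  linear_combination (hermiteProd k 1 x i) * h

/-! ### Equivariance under rotations -/

lemma frameTensor_transpose_frameTensor {d s k : ℕ} {W : Matrix (Fin d) (Fin s) ℝ}
    (hW : W ∈ Stiefel d s) (B : Tensor s k) :
    frameTensor W.transpose k (frameTensor W k B) = B := by
  refine ext_inner_right ℝ fun A => ?_
  rw [← inner_frameTensor_right, inner_frameTensor hW]

lemma frameProj_eq {d s : ℕ} (W : Matrix (Fin d) (Fin s) ℝ) (x : EuclideanSpace ℝ (Fin d)) :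
    frameProj W x = Matrix.toLpLin 2 2 W.transpose x := rfl

lemma transpose_mem_stiefel {d : ℕ} {U : Matrix (Fin d) (Fin d) ℝ} (hU : U ∈ Stiefel d d) :
    U.transpose ∈ Stiefel d d := by
  have : U.transpose * U = 1 := hU
  change U.transpose.transpose * U.transpose = 1
  rw [Matrix.transpose_transpose]
  exact mul_eq_one_comm.mp this

lemma norm_toLpLin_stiefel {d s : ℕ} {W : Matrix (Fin d) (Fin s) ℝ} (hW : W ∈ Stiefel d s)
    (x : EuclideanSpace ℝ (Fin s)) : ‖Matrix.toLpLin 2 2 W x‖ = ‖x‖ := by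
  have hW' : W.transpose * W = 1 := hW
  rw [← sq_eq_sq₀ (norm_nonneg _) (norm_nonneg _), EuclideanSpace.real_norm_sq_eq,
    EuclideanSpace.real_norm_sq_eq]
  have h : ∀ y : Fin d → ℝ, ∑ i, y i ^ 2 = y ⬝ᵥ y := fun y => by simp [dotProduct, sq]
  have h' : ∀ y : Fin s → ℝ, ∑ i, y i ^ 2 = y ⬝ᵥ y := fun y => by simp [dotProduct, sq]
  rw [h', ← Matrix.one_mulVec x.ofLp, ← hW', ← Matrix.mulVec_mulVec, Matrix.dotProduct_mulVec,
    Matrix.vecMul_transpose]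
  simp only [Matrix.mulVec_mulVec, hW', Matrix.one_mulVec]
  exact h _

/-- The Gaussian density is invariant under rotations, and the chain rule for iterated derivatives
transports this invariance to its derivatives. -/
lemma hermiteProd_frameProj {d k : ℕ} {U : Matrix (Fin d) (Fin d) ℝ} (hU : U ∈ Stiefel d d)
    (x : EuclideanSpace ℝ (Fin d)) :
    hermiteProd k 1 (frameProj U x) = frameTensor U.transpose k (hermiteProd k 1 x) := by
  let L : EuclideanSpace ℝ (Fin d) →L[ℝ] EuclideanSpace ℝ (Fin d) :=
    LinearMap.toContinuousLinearMap (Matrix.toLpLin 2 2 U.transpose)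
  have hL : ∀ y, frameProj U y = L y := fun y => rfl
  have hLn : ∀ y, ‖L y‖ = ‖y‖ := norm_toLpLin_stiefel (transpose_mem_stiefel hU)
  have hcomp : gaussianDensity d ∘ L = gaussianDensity d := by
    funext y
    simp [gaussianDensity, hLn]
  have hLe : ∀ j, L (EuclideanSpace.single j 1) = ∑ b, U j b • EuclideanSpace.single b (1 : ℝ) := by
    intro j
    ext l
    simp [L, Matrix.toLpLin_apply, Matrix.mulVec_single, Pi.single_apply]
  have key : frameTensor U k (hermiteProd k 1 (L x)) = hermiteProd k 1 x := by
    ext i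
    have h1 := L.iteratedFDeriv_comp_right (contDiff_gaussianDensity d (n := k)) x le_rfl
    rw [hcomp] at h1
    have h2 := congrArg (fun M => M fun a => EuclideanSpace.single (i a) (1 : ℝ)) h1
    simp only [ContinuousMultilinearMap.compContinuousLinearMap_apply,
      iteratedFDeriv_gaussianDensity, hLe, ContinuousMultilinearMap.map_sum,
      ContinuousMultilinearMap.map_smul_univ] at h2
    have h3 : gaussianDensity d (L x) = gaussianDensity d x := congrFun hcomp x
    have h4 := (gaussianDensity_pos x).ne'
    rw [frameTensor_apply]
    have h5 : ((-1 : ℝ) ^ k) ≠ 0 := by positivity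
    apply mul_left_cancel₀ h5
    apply mul_right_cancel₀ h4
    rw [h2, Finset.mul_sum, Finset.sum_mul]
    refine Finset.sum_congr rfl fun b _ => ?_
    rw [h3, smul_eq_mul]
    ring
  rw [hL, ← key, frameTensor_transpose_frameTensor hU]

/-! ### Contraction with traceless tensors -/

/-- The slice `A(j, ·)` of a tensor. -/
def slice {d k : ℕ} (A : Tensor d (k + 1)) (j : Fin d) : Tensor d k :=
  WithLp.toLp 2 fun i => A (Fin.cons j i)

lemma symTensors_apply_cons_comp {d k : ℕ} {A : Tensor d (k + 1)} (hA : A ∈ symTensors d (k + 1))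
    (j : Fin d) (i : Fin k → Fin d) (σ : Equiv.Perm (Fin k)) :
    A (Fin.cons j (i ∘ σ)) = A (Fin.cons j i) := by
  rw [← hA (Equiv.Perm.decomposeFin.symm (0, σ)) (Fin.cons j i)]
  refine congrArg A ?_
  funext a
  refine Fin.cases ?_ (fun a => ?_) a
  · simp
  · simp

lemma cons_cons_comp_swap {α : Type*} {k : ℕ} (a b : α) (i : Fin k → α) :
    (Fin.cons a (Fin.cons b i : Fin (k + 1) → α) : Fin (k + 2) → α) ∘ Equiv.swap 0 1 =
      Fin.cons b (Fin.cons a i : Fin (k + 1) → α) := by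
  funext c
  refine Fin.cases ?_ (fun c => ?_) c
  · rw [Function.comp_apply, Equiv.swap_apply_left]
    rfl
  refine Fin.cases ?_ (fun c => ?_) c
  · change (Fin.cons a (Fin.cons b i : Fin (k + 1) → α) : Fin (k + 2) → α) (Equiv.swap 0 1 1) = _
    rw [Equiv.swap_apply_right]
    rfl
  · rw [Function.comp_apply, Equiv.swap_apply_of_ne_of_ne] <;> simp [Fin.ext_iff]

lemma slice_mem_tracelessSym {d k : ℕ} {A : Tensor d (k + 1)} (hA : A ∈ tracelessSym d (k + 1))
    (j : Fin d) : slice A j ∈ tracelessSym d k := by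
  have hs : slice A j ∈ symTensors d k := fun σ i =>
    symTensors_apply_cons_comp (tracelessSym_le_symTensors _ _ hA) j i σ
  match k with
  | 0 => exact hs
  | 1 => exact hs
  | k + 2 =>
    refine ⟨hs, LinearMap.mem_ker.mpr ?_⟩
    ext i
    have h1 : partialTrace d (k + 1) A = 0 := LinearMap.mem_ker.mp hA.2
    have h2 : partialTrace d (k + 1) A (Fin.cons j i) = 0 := by rw [h1]; rfl
    change ∑ m : Fin d, A (Fin.cons j (Fin.cons m (Fin.cons m i : Fin (k + 1) → Fin d) :
      Fin (k + 2) → Fin d)) = 0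
    refine Eq.trans (Finset.sum_congr rfl fun m _ => ?_) h2
    -- Two transpositions move the frozen index j behind the traced pair (m, m).
    have h3 := hA.1 (Equiv.swap 0 1)
      (Fin.cons j (Fin.cons m (Fin.cons m i : Fin (k + 1) → Fin d) : Fin (k + 2) → Fin d))
    have h4 := symTensors_apply_cons_comp hA.1 m
      (Fin.cons j (Fin.cons m i : Fin (k + 1) → Fin d) : Fin (k + 2) → Fin d) (Equiv.swap 0 1)
    rw [cons_cons_comp_swap] at h3 h4
    exact h3.symm.trans h4.symm

/-- This is the contribution of the lowering term in h_{n+1} = x h_n - n h_{n-1}. The count n_j is a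
sum over the slots of i with value j, and by symmetry every slot contributes as slot 0 does; there
the sum is a partial trace of A. -/
lemma sum_cons_mul_indexCount_eq_zero {d k : ℕ} {A : Tensor d (k + 1)}
    (hA : A ∈ tracelessSym d (k + 1)) (x : EuclideanSpace ℝ (Fin d)) :
    ∑ j, ∑ i : Fin k → Fin d, A (Fin.cons j i) * ((indexCount i j : ℝ) *
      (hermiteScaled (indexCount i j - 1) 1 (x j) *
        ∏ l ∈ Finset.univ.erase j, hermiteScaled (indexCount i l) 1 (x l))) = 0 := by
  match k with
  | 0 => simp [indexCount]
  | k + 1 =>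
    have hs := tracelessSym_le_symTensors _ _ hA
    let R : Fin d → (Fin (k + 1) → Fin d) → ℝ := fun j i =>
      hermiteScaled (indexCount i j - 1) 1 (x j) *
        ∏ l ∈ Finset.univ.erase j, hermiteScaled (indexCount i l) 1 (x l)
    have hR : ∀ j i (σ : Equiv.Perm (Fin (k + 1))), R j (i ∘ σ) = R j i := fun j i σ => by
      simp only [R, indexCount_comp_perm]
    have hR2 : ∀ j (i : Fin k → Fin d), R j (Fin.cons j i) = hermiteProd k 1 x i := fun j i => by
      simp only [R, hermiteProd_apply]
      rw [← Finset.mul_prod_erase _ _ (Finset.mem_univ j), indexCount_cons, if_pos rfl,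
        Nat.add_sub_cancel_left]
      congr 1
      refine Finset.prod_congr rfl fun l hl => ?_
      rw [indexCount_cons, if_neg (Finset.ne_of_mem_erase hl).symm, zero_add]
    have h1 : ∀ j, ∑ i : Fin (k + 1) → Fin d, A (Fin.cons j i) * ((indexCount i j : ℝ) * R j i) =
        (k + 1) * ∑ i : Fin k → Fin d,
          A (Fin.cons j (Fin.cons j i : Fin (k + 1) → Fin d)) * hermiteProd k 1 x i := fun j => by
      have h2 : ∀ i : Fin (k + 1) → Fin d, A (Fin.cons j i) * ((indexCount i j : ℝ) * R j i) =
          ∑ a, (if i a = j then 1 else 0) * (A (Fin.cons j i) * R j i) := fun i => by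
        rw [← Finset.sum_mul, indexCount]
        push_cast
        ring
      have h3 : ∀ a : Fin (k + 1), ∑ i : Fin (k + 1) → Fin d,
          (if i a = j then 1 else 0) * (A (Fin.cons j i) * R j i) =
          ∑ i : Fin (k + 1) → Fin d, (if i 0 = j then 1 else 0) * (A (Fin.cons j i) * R j i) := by
        intro a
        refine Fintype.sum_equiv (Equiv.arrowCongr (Equiv.swap 0 a) (Equiv.refl (Fin d))) _ _
          fun i => ?_
        have e : (Equiv.arrowCongr (Equiv.swap 0 a) (Equiv.refl (Fin d))) i =
          i ∘ (Equiv.swap 0 a) := by funext b; simp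
        rw [e, hR, symTensors_apply_cons_comp hs]
        simp
      simp_rw [h2]
      rw [Finset.sum_comm, Finset.sum_congr rfl fun a _ => h3 a, Finset.sum_const,
        sum_fin_succ_fun, Finset.sum_eq_single j]
      · simp [hR2]
      · intro m _ hm
        simp [hm]
      · simp
    rw [Finset.sum_congr rfl fun j _ => h1 j, ← Finset.mul_sum, Finset.sum_comm]
    refine mul_eq_zero_of_right _ (Finset.sum_eq_zero fun i _ => ?_)
    rw [← Finset.sum_mul]
    have h4 : partialTrace d k A i = 0 := by rw [LinearMap.mem_ker.mp hA.2]; rfl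
    exact mul_eq_zero_of_left h4 _

lemma hermiteProd_cons {d k : ℕ} (x : EuclideanSpace ℝ (Fin d)) (j : Fin d) (i : Fin k → Fin d) :
    hermiteProd (k + 1) 1 x (Fin.cons j i) = x j * hermiteProd k 1 x i -
      (indexCount i j : ℝ) * (hermiteScaled (indexCount i j - 1) 1 (x j) *
        ∏ l ∈ Finset.univ.erase j, hermiteScaled (indexCount i l) 1 (x l)) := by
  rw [hermiteProd_apply, hermiteProd_apply, ← Finset.mul_prod_erase _ _ (Finset.mem_univ j),
    ← Finset.mul_prod_erase _ _ (Finset.mem_univ j)]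
  have e : ∏ l ∈ Finset.univ.erase j, hermiteScaled
      (indexCount (Fin.cons j i : Fin (k + 1) → Fin d) l) 1 (x l) =
      ∏ l ∈ Finset.univ.erase j, hermiteScaled (indexCount i l) 1 (x l) := by
    refine Finset.prod_congr rfl fun l hl => ?_
    rw [indexCount_cons, if_neg (Finset.ne_of_mem_erase hl).symm, zero_add]
  rw [e, indexCount_cons, if_pos rfl, add_comm 1, hermiteScaled_succ]
  ring

/-- The Hermite tensor and the tensor power differ by terms in which two slots are traced, and A
annihilates these. The induction peels off one index, since slices of traceless tensors are
traceless. -/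
lemma inner_hermiteProd_eq_inner_tensorPower {d k : ℕ} {A : Tensor d k}
    (hA : A ∈ tracelessSym d k) (x : EuclideanSpace ℝ (Fin d)) :
    inner ℝ A (hermiteProd k 1 x) = inner ℝ A (tensorPower k x) := by
  induction k with
  | zero => simp [inner_tensor, hermiteProd_apply, tensorPower, indexCount, hermiteScaled]
  | succ k ih =>
    have h1 : ∀ j, ∑ i : Fin k → Fin d, A (Fin.cons j i) * hermiteProd k 1 x i =
        ∑ i : Fin k → Fin d, A (Fin.cons j i) * tensorPower k x i := fun j => by
      have := ih (slice_mem_tracelessSym hA j)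
      rwa [inner_tensor, inner_tensor] at this
    rw [inner_tensor, inner_tensor, sum_fin_succ_fun, sum_fin_succ_fun]
    have h2 := sum_cons_mul_indexCount_eq_zero hA x
    have h3 : ∀ j (i : Fin k → Fin d), A (Fin.cons j i) * hermiteProd (k + 1) 1 x (Fin.cons j i) =
        x j * (A (Fin.cons j i) * hermiteProd k 1 x i) - A (Fin.cons j i) * ((indexCount i j : ℝ) *
      (hermiteScaled (indexCount i j - 1) 1 (x j) *
        ∏ l ∈ Finset.univ.erase j, hermiteScaled (indexCount i l) 1 (x l))) := fun j i => by
      rw [hermiteProd_cons]; ring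
    simp_rw [h3, Finset.sum_sub_distrib]
    rw [h2, sub_zero]
    refine Finset.sum_congr rfl fun j _ => ?_
    rw [← Finset.mul_sum, h1, Finset.mul_sum]
    refine Finset.sum_congr rfl fun i _ => ?_
    simp only [tensorPower, Fin.prod_univ_succ, Fin.cons_zero, Fin.cons_succ]
    ring

/-! ### The standard Gaussian measure -/

lemma integrable_gaussianDensity (d : ℕ) : Integrable (gaussianDensity d) := by
  have h := GaussianFourier.integrable_cexp_neg_mul_sq_norm_add (V := EuclideanSpace ℝ (Fin d))
    (b := 1 / 2) (by norm_num) 0 0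
  have h2 := (h.re).const_mul ((2 * Real.pi) ^ (-(d : ℝ) / 2))
  refine h2.congr (Filter.Eventually.of_forall fun x => ?_)
  have e : (-(1 / 2 : ℂ) * (‖x‖ : ℂ) ^ 2 +
      0 * ((inner ℝ (0 : EuclideanSpace ℝ (Fin d)) x : ℝ) : ℂ)) =
      ((-‖x‖ ^ 2 / 2 : ℝ) : ℂ) := by push_cast; ring
  simp only [gaussianDensity, e]
  congr 1

lemma measurable_gaussianDensity (d : ℕ) : Measurable (gaussianDensity d) :=
  (contDiff_gaussianDensity d (n := 0)).continuous.measurable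

lemma integral_withDensity_gaussianDensity {d : ℕ} {F : Type*} [NormedAddCommGroup F]
    [NormedSpace ℝ F] (f : EuclideanSpace ℝ (Fin d) → F) :
    ∫ x, f x ∂(volume.withDensity fun x => ENNReal.ofReal (gaussianDensity d x)) =
      ∫ x, gaussianDensity d x • f x := by
  rw [integral_withDensity_eq_integral_toReal_smul (measurable_gaussianDensity d).ennreal_ofReal
    (Filter.Eventually.of_forall fun x => ENNReal.ofReal_lt_top)]
  simp_rw [ENNReal.toReal_ofReal (gaussianDensity_pos _).le]

lemma stdGaussian_eq_withDensity (d : ℕ) :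
    stdGaussian (EuclideanSpace ℝ (Fin d)) =
      volume.withDensity fun x => ENNReal.ofReal (gaussianDensity d x) := by
  have : IsFiniteMeasure ((volume : Measure (EuclideanSpace ℝ (Fin d))).withDensity
      fun x => ENNReal.ofReal (gaussianDensity d x)) :=
    isFiniteMeasure_withDensity_ofReal (integrable_gaussianDensity d).2
  refine Measure.ext_of_charFun ?_
  funext t
  rw [charFun_stdGaussian, charFun_apply, integral_withDensity_gaussianDensity]
  have h := GaussianFourier.integral_cexp_neg_mul_sq_norm_add (V := EuclideanSpace ℝ (Fin d))
    (b := 1 / 2) (by norm_num) Complex.I t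
  have e : ∀ x : EuclideanSpace ℝ (Fin d),
      gaussianDensity d x • Complex.exp (((inner ℝ x t : ℝ) : ℂ) * Complex.I) =
      (((2 * Real.pi) ^ (-(d : ℝ) / 2) : ℝ) : ℂ) * Complex.exp (-(1 / 2) * (‖x‖ : ℂ) ^ 2 +
        Complex.I * ((inner ℝ t x : ℝ) : ℂ)) := fun x => by
    rw [gaussianDensity, Complex.exp_add, Complex.real_smul, real_inner_comm, mul_comm Complex.I]
    push_cast
    rw [mul_assoc]
    congr 3
    ring_nf
  simp_rw [e]
  rw [integral_const_mul, h, ← mul_assoc]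
  have e2 : (((2 * Real.pi) ^ (-(d : ℝ) / 2) : ℝ) : ℂ) *
      (Real.pi / (1 / 2 : ℂ)) ^
        ((Module.finrank ℝ (EuclideanSpace ℝ (Fin d)) : ℂ) / 2) = 1 := by
    have e3 : (Real.pi / (1 / 2 : ℂ)) = ((2 * Real.pi : ℝ) : ℂ) := by push_cast; ring
    have e4 : ((Module.finrank ℝ (EuclideanSpace ℝ (Fin d)) : ℂ) / 2) = ((d / 2 : ℝ) : ℂ) := by
      simp
    rw [e3, e4, ← Complex.ofReal_cpow (by positivity), ← Complex.ofReal_mul,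
      ← Real.rpow_add (by positivity)]
    rw [show -(d : ℝ) / 2 + d / 2 = 0 by ring]
    simp
  rw [e2, one_mul, Complex.I_sq]
  congr 1
  ring

lemma integral_stdGaussian_eq {d : ℕ} {F : Type*} [NormedAddCommGroup F]
    [NormedSpace ℝ F] (f : EuclideanSpace ℝ (Fin d) → F) :
    ∫ x, f x ∂(stdGaussian (EuclideanSpace ℝ (Fin d))) = ∫ x, gaussianDensity d x • f x := by
  rw [stdGaussian_eq_withDensity, integral_withDensity_gaussianDensity]

/-- This is the change of variables x ↦ r x; the exponential is the ratio of the Gaussian density at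
r x to that at x. -/
lemma integral_exp_smul_comp_smul {d : ℕ} {F : Type*} [NormedAddCommGroup F]
    [NormedSpace ℝ F] {r : ℝ} (hr : 0 < r) (f : EuclideanSpace ℝ (Fin d) → F) :
    ∫ x, Real.exp (-((r ^ 2 - 1) / 2 * ‖x‖ ^ 2)) • f (r • x)
      ∂(stdGaussian (EuclideanSpace ℝ (Fin d))) =
    (r ^ d)⁻¹ • ∫ x, f x ∂(stdGaussian (EuclideanSpace ℝ (Fin d))) := by
  rw [integral_stdGaussian_eq, integral_stdGaussian_eq]
  have h := Measure.integral_comp_smul (volume : Measure (EuclideanSpace ℝ (Fin d)))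
    (fun x => gaussianDensity d x • f x) r
  rw [finrank_euclideanSpace, Fintype.card_fin, abs_of_pos (by positivity)] at h
  rw [← h]
  refine integral_congr_ae (Filter.Eventually.of_forall fun x => ?_)
  simp only [gaussianDensity, smul_smul, norm_smul, Real.norm_eq_abs, abs_of_pos hr]
  rw [mul_assoc, ← Real.exp_add]
  congr 3
  ring

lemma integrable_one_add_norm_pow_of_memLp {E : Type*} [NormedAddCommGroup E]
    [MeasurableSpace E] [OpensMeasurableSpace E]
    {μ : Measure E} [IsFiniteMeasure μ] (q : ℕ) (h : MemLp id (q : ℝ≥0∞) μ) :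
    Integrable (fun x => (1 + ‖x‖) ^ q) μ := by
  have h1 : MemLp (fun x : E => ‖x‖) q μ := h.norm
  have h2 : MemLp (fun x : E => 1 + ‖x‖) q μ := (memLp_const (1 : ℝ)).add h1
  have h3 := h2.integrable_norm_pow'
  have e : ∀ x : E, ‖1 + ‖x‖‖ = 1 + ‖x‖ := fun x => by
    rw [Real.norm_eq_abs, abs_of_nonneg (by positivity)]
  simpa only [e] using h3

lemma integrable_one_add_norm_pow (d q : ℕ) :
    Integrable (fun x => (1 + ‖x‖) ^ q) (stdGaussian (EuclideanSpace ℝ (Fin d))) :=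
  integrable_one_add_norm_pow_of_memLp q (IsGaussian.memLp_id _ _ (ENNReal.natCast_ne_top q))

lemma integrable_of_norm_le_pow {d q : ℕ} {F : Type*} [NormedAddCommGroup F]
    {f : EuclideanSpace ℝ (Fin d) → F} {K : ℝ}
    (hf : AEStronglyMeasurable f (stdGaussian (EuclideanSpace ℝ (Fin d))))
    (h : ∀ x, ‖f x‖ ≤ K * (1 + ‖x‖) ^ q) :
    Integrable f (stdGaussian (EuclideanSpace ℝ (Fin d))) :=
  ((integrable_one_add_norm_pow d q).const_mul K).mono' hf (Filter.Eventually.of_forall h)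

lemma integrable_hermiteProd (d k : ℕ) :
    Integrable (hermiteProd (d := d) k 1) (stdGaussian (EuclideanSpace ℝ (Fin d))) := by
  obtain ⟨K, -, hK⟩ := exists_norm_hermiteProd_le d k
  refine integrable_of_norm_le_pow (K := K) (q := k)
    (continuous_hermiteProd k 1).aestronglyMeasurable fun x => ?_
  simpa using hK 1 x le_rfl

/-! ### Orthogonality of Hermite polynomials -/

lemma integral_gaussianReal_zero_one (f : ℝ → ℝ) :
    ∫ x, f x ∂(gaussianReal 0 1) = (√(2 * Real.pi))⁻¹ * ∫ x, f x * Real.exp (-x ^ 2 / 2) := by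
  rw [integral_gaussianReal_eq_integral_smul one_ne_zero, ← integral_const_mul]
  refine integral_congr_ae (Filter.Eventually.of_forall fun x => ?_)
  simp [gaussianPDFReal]
  ring

lemma integrable_hermiteScaled_mul (m n : ℕ) :
    Integrable (fun x => hermiteScaled m 1 x * hermiteScaled n 1 x * Real.exp (-x ^ 2 / 2)) := by
  obtain ⟨K1, -, h1⟩ := exists_abs_hermiteScaled_le m
  obtain ⟨K2, -, h2⟩ := exists_abs_hermiteScaled_le n
  have h := integrable_one_add_norm_pow_of_memLp (μ := gaussianReal 0 1) (m + n)
    (memLp_id_gaussianReal' _ (ENNReal.natCast_ne_top _))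
  have h3 : Integrable (fun x => hermiteScaled m 1 x * hermiteScaled n 1 x)
      (gaussianReal 0 1) := by
    refine (h.const_mul (K1 * K2)).mono'
      ((continuous_hermiteScaled m 1).mul (continuous_hermiteScaled n 1)).aestronglyMeasurable
      (Filter.Eventually.of_forall fun x => ?_)
    have a1 := h1 1 x le_rfl
    have a2 := h2 1 x le_rfl
    simp only [one_pow, mul_one] at a1 a2
    rw [Real.norm_eq_abs, abs_mul, Real.norm_eq_abs, pow_add]
    calc _ ≤ (K1 * (1 + |x|) ^ m) * (K2 * (1 + |x|) ^ n) := by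
          gcongr
          exact (abs_nonneg _).trans a1
      _ = _ := by ring
  rw [gaussianReal_of_var_ne_zero _ one_ne_zero, integrable_withDensity_iff_integrable_smul'
    (measurable_gaussianPDF 0 1) (Filter.Eventually.of_forall fun x => gaussianPDF_lt_top)] at h3
  refine (h3.const_mul (√(2 * Real.pi))).congr (Filter.Eventually.of_forall fun x => ?_)
  have hp : √(2 * Real.pi) ≠ 0 := by positivity
  simp only [toReal_gaussianPDF, gaussianPDFReal, smul_eq_mul, NNReal.coe_one, mul_one, sub_zero]
  field_simp

/-- Integration by parts, from (h_m e^{-x²/2})' = -h_{m+1} e^{-x²/2} and h_n' = n h_{n-1}. -/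
lemma integral_hermiteScaled_succ_mul (m n : ℕ) :
    ∫ x, hermiteScaled (m + 1) 1 x * hermiteScaled n 1 x ∂(gaussianReal 0 1) =
      n * ∫ x, hermiteScaled m 1 x * hermiteScaled (n - 1) 1 x ∂(gaussianReal 0 1) := by
  simp_rw [integral_gaussianReal_zero_one]
  have h := integral_eq_zero_of_hasDerivAt_of_integrable
    (f := fun x => (hermiteScaled m 1 x * Real.exp (-x ^ 2 / 2)) * hermiteScaled n 1 x)
    (f' := fun x => -(hermiteScaled (m + 1) 1 x * Real.exp (-x ^ 2 / 2)) * hermiteScaled n 1 x +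
      (hermiteScaled m 1 x * Real.exp (-x ^ 2 / 2)) * (n * hermiteScaled (n - 1) 1 x))
    (fun x => (hasDerivAt_hermiteScaled_mul_exp m x).mul (hasDerivAt_hermiteScaled_one n x)) ?_ ?_
  · have e : ∀ x, -(hermiteScaled (m + 1) 1 x * Real.exp (-x ^ 2 / 2)) * hermiteScaled n 1 x +
        (hermiteScaled m 1 x * Real.exp (-x ^ 2 / 2)) * (n * hermiteScaled (n - 1) 1 x) =
        n * (hermiteScaled m 1 x * hermiteScaled (n - 1) 1 x * Real.exp (-x ^ 2 / 2)) -
        hermiteScaled (m + 1) 1 x * hermiteScaled n 1 x * Real.exp (-x ^ 2 / 2) := fun x => by ring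
    simp_rw [e] at h
    rw [integral_sub ((integrable_hermiteScaled_mul m (n - 1)).const_mul _)
      (integrable_hermiteScaled_mul (m + 1) n), integral_const_mul] at h
    rw [← sub_eq_zero.mp h]
    ring
  · refine (((integrable_hermiteScaled_mul m (n - 1)).const_mul (n : ℝ)).sub
      (integrable_hermiteScaled_mul (m + 1) n)).congr (Filter.Eventually.of_forall fun x => ?_)
    simp only [Pi.sub_apply]
    ring
  · refine (integrable_hermiteScaled_mul m n).congr (Filter.Eventually.of_forall fun x => ?_)
    simp only
    ring

lemma integral_hermiteScaled_mul (m n : ℕ) :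
    ∫ x, hermiteScaled m 1 x * hermiteScaled n 1 x ∂(gaussianReal 0 1) =
      if m = n then (m.factorial : ℝ) else 0 := by
  induction m generalizing n with
  | zero =>
    cases n with
    | zero => simp [hermiteScaled]
    | succ n =>
      have := integral_hermiteScaled_succ_mul n 0
      simp only [Nat.cast_zero, zero_mul] at this
      simp_rw [mul_comm (hermiteScaled 0 1 _)]
      rw [this]
      simp
  | succ m ih =>
    rw [integral_hermiteScaled_succ_mul, ih]
    cases n with
    | zero => simp
    | succ n =>
      by_cases h : m = n
      · subst h
        simp [Nat.factorial_succ]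
      · simp [h]

lemma integral_hermiteScaled (n : ℕ) :
    ∫ x, hermiteScaled n 1 x ∂(gaussianReal 0 1) = if n = 0 then 1 else 0 := by
  have := integral_hermiteScaled_mul n 0
  simp only [hermiteScaled, mul_one] at this
  rw [this]
  split_ifs with h
  · simp [h]
  · rfl

lemma integral_prod_stdGaussian {d : ℕ} (f : Fin d → ℝ → ℝ) :
    ∫ x, ∏ j, f j (x j) ∂(stdGaussian (EuclideanSpace ℝ (Fin d))) =
      ∏ j, ∫ x, f j x ∂(gaussianReal 0 1) := by
  rw [← map_pi_eq_stdGaussian]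
  have h := (MeasurableEquiv.toLp 2 (Fin d → ℝ)).measurableEmbedding.integral_map
    (μ := Measure.pi fun _ => gaussianReal 0 1)
    (fun x : EuclideanSpace ℝ (Fin d) => ∏ j, f j (x j))
  refine h.trans ?_
  exact integral_fintype_prod_eq_prod (μ := fun _ => gaussianReal 0 1) f

/-- Both sides count the permutations carrying i to i'. If there is one, they form a coset of the
stabilizer of i, which has ∏ n_j! elements; if there is none, some value occurs with different
multiplicities. -/
lemma prod_indexCount_factorial {d k : ℕ} (i i' : Fin k → Fin d) :
    (∏ j, if indexCount i j = indexCount i' j then ((indexCount i j).factorial : ℝ) else 0) =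
      ∑ σ : Equiv.Perm (Fin k), if i ∘ σ = i' then (1 : ℝ) else 0 := by
  by_cases h : ∃ σ : Equiv.Perm (Fin k), i ∘ σ = i'
  · obtain ⟨σ, rfl⟩ := h
    simp_rw [indexCount_comp_perm, if_true]
    have h1 := DomMulAct.stabilizer_card i
    have h2 : ∀ j, Fintype.card {a // i a = j} = indexCount i j := fun j => by
      rw [Fintype.card_subtype, indexCount, Finset.card_filter]
    simp_rw [h2] at h1
    rw [← Nat.cast_prod, ← h1, Fintype.card_subtype, Finset.card_filter]
    push_cast
    refine Fintype.sum_equiv (Equiv.mulRight σ) _ _ fun τ => ?_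
    have : i ∘ ⇑(Equiv.mulRight σ τ) = (i ∘ τ) ∘ σ := rfl
    rw [this]
    by_cases h3 : i ∘ τ = i
    · rw [if_pos h3, if_pos (by rw [h3])]
    · rw [if_neg h3, if_neg]
      intro h4
      exact h3 (σ.surjective.injective_comp_right h4)
  · push Not at h
    rw [Finset.sum_eq_zero fun σ _ => if_neg (h σ)]
    obtain ⟨j, hj⟩ : ∃ j, indexCount i j ≠ indexCount i' j := by
      -- If all multiplicities agreed, bijections between the fibres of i' and of i would glue to a
      -- permutation carrying i to i'.
      by_contra! hc
      have hcard : ∀ j, Fintype.card {a // i a = j} = Fintype.card {a // i' a = j} := fun j => by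
        have := hc j
        rwa [indexCount, indexCount, ← Finset.card_filter, ← Finset.card_filter,
          ← Fintype.card_subtype, ← Fintype.card_subtype] at this
      let e : ∀ j, {a // i' a = j} ≃ {a // i a = j} := fun j => Fintype.equivOfCardEq (hcard j).symm
      let σ : Equiv.Perm (Fin k) := (Equiv.sigmaFiberEquiv i').symm.trans
        ((Equiv.sigmaCongrRight e).trans (Equiv.sigmaFiberEquiv i))
      refine h σ (funext fun a => ?_)
      exact (e (i' a) ⟨a, rfl⟩).2
    exact Finset.prod_eq_zero (Finset.mem_univ j) (if_neg hj)

lemma integral_hermiteProd_mul {d k : ℕ} (i i' : Fin k → Fin d) :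
    ∫ x, hermiteProd k 1 x i * hermiteProd k 1 x i' ∂(stdGaussian (EuclideanSpace ℝ (Fin d))) =
      ∑ σ : Equiv.Perm (Fin k), if i ∘ σ = i' then (1 : ℝ) else 0 := by
  simp_rw [hermiteProd_apply, ← Finset.prod_mul_distrib]
  rw [integral_prod_stdGaussian fun j x =>
    hermiteScaled (indexCount i j) 1 x * hermiteScaled (indexCount i' j) 1 x]
  simp_rw [integral_hermiteScaled_mul]
  exact prod_indexCount_factorial i i'

lemma integrable_hermiteProd_mul {d k : ℕ} (i i' : Fin k → Fin d) :
    Integrable (fun x => hermiteProd k 1 x i * hermiteProd k 1 x i')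
      (stdGaussian (EuclideanSpace ℝ (Fin d))) := by
  obtain ⟨K, hK1, hK⟩ := exists_norm_hermiteProd_le d k
  refine integrable_of_norm_le_pow (K := K * K) (q := k + k) ?_ fun x => ?_
  · have := continuous_hermiteProd (d := d) k 1
    exact (((PiLp.continuous_apply 2 _ i).comp this).mul
      ((PiLp.continuous_apply 2 _ i').comp this)).aestronglyMeasurable
  · have h1 := (PiLp.norm_apply_le (hermiteProd k 1 x) i).trans (hK 1 x le_rfl)
    have h2 := (PiLp.norm_apply_le (hermiteProd k 1 x) i').trans (hK 1 x le_rfl)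
    rw [norm_mul]
    calc _ ≤ (K * 1 ^ k * (1 + ‖x‖) ^ k) * (K * 1 ^ k * (1 + ‖x‖) ^ k) := by gcongr
      _ = _ := by rw [pow_add]; ring

/-- By orthogonality only pairs of multi-indices related by a permutation contribute, and the
symmetry of A makes each of the k! permutations contribute ‖A‖². -/
lemma integral_inner_hermiteProd_sq {d k : ℕ} {A : Tensor d k} (hA : A ∈ symTensors d k) :
    ∫ x, (inner ℝ A (hermiteProd k 1 x)) ^ 2 ∂(stdGaussian (EuclideanSpace ℝ (Fin d))) =
      k.factorial * ‖A‖ ^ 2 := by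
  have h1 : ∀ x : EuclideanSpace ℝ (Fin d), (inner ℝ A (hermiteProd k 1 x)) ^ 2 =
      ∑ i, ∑ i', (A i * A i') * (hermiteProd k 1 x i * hermiteProd k 1 x i') := fun x => by
    rw [inner_tensor, sq, Finset.sum_mul_sum]
    exact Finset.sum_congr rfl fun i _ => Finset.sum_congr rfl fun i' _ => by ring
  simp_rw [h1]
  rw [integral_finsetSum _ fun i _ => integrable_finsetSum _ fun i' _ =>
    (integrable_hermiteProd_mul i i').const_mul _]
  simp_rw [integral_finsetSum _ fun i' _ => (integrable_hermiteProd_mul _ i').const_mul _,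
    integral_const_mul, integral_hermiteProd_mul, Finset.mul_sum]
  have h2 : ∀ i : Fin k → Fin d, ∑ i', ∑ σ : Equiv.Perm (Fin k),
      A i * A i' * (if i ∘ σ = i' then (1 : ℝ) else 0) = k.factorial * (A i * A i) := fun i => by
    rw [Finset.sum_comm]
    have : ∀ σ : Equiv.Perm (Fin k), ∑ i', A i * A i' * (if i ∘ σ = i' then (1 : ℝ) else 0) =
        A i * A i := fun σ => by
      simp [hA σ i]
    rw [Finset.sum_congr rfl fun σ _ => this σ]
    simp [Fintype.card_perm]
  rw [Finset.sum_congr rfl fun i _ => h2 i, ← Finset.mul_sum, norm_sq_tensor]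

/-! ### Marginals of the standard Gaussian measure -/

lemma inner_frameProj {d s : ℕ} (W : Matrix (Fin d) (Fin s) ℝ) (x : EuclideanSpace ℝ (Fin d))
    (y : EuclideanSpace ℝ (Fin s)) :
    inner ℝ (frameProj W x) y = inner ℝ x (Matrix.toLpLin 2 2 W y) := by
  simp only [PiLp.inner_apply, frameProj, Matrix.toLpLin_apply, Matrix.mulVec, dotProduct,
    Matrix.transpose_apply, RCLike.inner_apply, conj_trivial, Finset.mul_sum, Finset.sum_mul]
  rw [Finset.sum_comm]
  exact Finset.sum_congr rfl fun i _ => Finset.sum_congr rfl fun j _ => by ring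

lemma map_frameProj_stdGaussian {d s : ℕ} {W : Matrix (Fin d) (Fin s) ℝ} (hW : W ∈ Stiefel d s) :
    (stdGaussian (EuclideanSpace ℝ (Fin d))).map (frameProj W) =
      stdGaussian (EuclideanSpace ℝ (Fin s)) := by
  have : IsProbabilityMeasure ((stdGaussian (EuclideanSpace ℝ (Fin d))).map (frameProj W)) :=
    Measure.isProbabilityMeasure_map (measurable_frameProj W).aemeasurable
  refine Measure.ext_of_charFun ?_
  funext y
  rw [charFun_stdGaussian, charFun_apply, integral_map (measurable_frameProj W).aemeasurable
    (by fun_prop)]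
  simp_rw [inner_frameProj]
  rw [← charFun_apply, charFun_stdGaussian, norm_toLpLin_stiefel hW]

/-- Concatenation of vectors. -/
def appendVec {s n : ℕ} (p : EuclideanSpace ℝ (Fin s) × EuclideanSpace ℝ (Fin n)) :
    EuclideanSpace ℝ (Fin (s + n)) :=
  WithLp.toLp 2 (Fin.append p.1.ofLp p.2.ofLp)

lemma appendVec_castAdd {s n : ℕ} (p : EuclideanSpace ℝ (Fin s) × EuclideanSpace ℝ (Fin n))
    (a : Fin s) : appendVec p (Fin.castAdd n a) = p.1 a := by simp [appendVec]

lemma appendVec_natAdd {s n : ℕ} (p : EuclideanSpace ℝ (Fin s) × EuclideanSpace ℝ (Fin n))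
    (b : Fin n) : appendVec p (Fin.natAdd s b) = p.2 b := by simp [appendVec]

lemma measurable_appendVec {s n : ℕ} : Measurable (appendVec (s := s) (n := n)) := by
  have : Continuous (appendVec (s := s) (n := n)) := by
    refine (PiLp.continuous_toLp 2 _).comp (continuous_pi fun j => ?_)
    refine Fin.addCases (fun a => ?_) (fun b => ?_) j
    · simp only [Fin.append_left]; fun_prop
    · simp only [Fin.append_right]; fun_prop
  exact this.measurable

lemma map_appendVec (s n : ℕ) :
    ((stdGaussian (EuclideanSpace ℝ (Fin s))).prod (stdGaussian (EuclideanSpace ℝ (Fin n)))).map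
      appendVec = stdGaussian (EuclideanSpace ℝ (Fin (s + n))) := by
  have : IsProbabilityMeasure (((stdGaussian (EuclideanSpace ℝ (Fin s))).prod
      (stdGaussian (EuclideanSpace ℝ (Fin n)))).map appendVec) :=
    Measure.isProbabilityMeasure_map measurable_appendVec.aemeasurable
  refine Measure.ext_of_charFun ?_
  funext y
  let y1 : EuclideanSpace ℝ (Fin s) := WithLp.toLp 2 fun a => y (Fin.castAdd n a)
  let y2 : EuclideanSpace ℝ (Fin n) := WithLp.toLp 2 fun b => y (Fin.natAdd s b)
  have h1 : ∀ p : EuclideanSpace ℝ (Fin s) × EuclideanSpace ℝ (Fin n),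
      inner ℝ (appendVec p) y = inner ℝ p.1 y1 + inner ℝ p.2 y2 := fun p => by
    simp only [PiLp.inner_apply, Fin.sum_univ_add, appendVec_castAdd, appendVec_natAdd, y1, y2]
  have h2 : ‖y‖ ^ 2 = ‖y1‖ ^ 2 + ‖y2‖ ^ 2 := by
    simp only [EuclideanSpace.real_norm_sq_eq, Fin.sum_univ_add, y1, y2]
  rw [charFun_stdGaussian, charFun_apply, integral_map measurable_appendVec.aemeasurable
    (by fun_prop)]
  simp_rw [h1]
  have h3 : ∀ p : EuclideanSpace ℝ (Fin s) × EuclideanSpace ℝ (Fin n),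
      Complex.exp (((inner ℝ p.1 y1 + inner ℝ p.2 y2 : ℝ) : ℂ) * Complex.I) =
      Complex.exp ((inner ℝ p.1 y1 : ℝ) * Complex.I) *
        Complex.exp ((inner ℝ p.2 y2 : ℝ) * Complex.I) := fun p => by
    rw [← Complex.exp_add]; push_cast; ring_nf
  simp_rw [h3]
  rw [integral_prod_mul (fun t => Complex.exp ((inner ℝ t y1 : ℝ) * Complex.I))
    (fun u => Complex.exp ((inner ℝ u y2 : ℝ) * Complex.I)), ← charFun_apply, ← charFun_apply,
    charFun_stdGaussian, charFun_stdGaussian, ← Complex.exp_add]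
  congr 1
  rw [← add_div, ← neg_add]
  norm_cast
  rw [h2]

/-- The first coordinates of a vector. -/
def firstCoords {s n : ℕ} (x : EuclideanSpace ℝ (Fin (s + n))) : EuclideanSpace ℝ (Fin s) :=
  WithLp.toLp 2 fun a => x (Fin.castAdd n a)

lemma measurable_firstCoords {s n : ℕ} : Measurable (firstCoords (s := s) (n := n)) := by
  have : Continuous (firstCoords (s := s) (n := n)) := by
    unfold firstCoords
    fun_prop
  exact this.measurable

lemma firstCoords_appendVec {s n : ℕ}
    (p : EuclideanSpace ℝ (Fin s) × EuclideanSpace ℝ (Fin n)) :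
    firstCoords (appendVec p) = p.1 := by
  ext a
  exact appendVec_castAdd p a

/-- The remaining coordinates are independent of the first s, and Hermite polynomials of positive
degree have mean zero, so only multi-indices with all entries among the first s survive. -/
lemma integral_firstCoords_mul_hermiteProd {s n k : ℕ} {q : EuclideanSpace ℝ (Fin s) → ℝ}
    (hq : Measurable q) (i : Fin k → Fin (s + n)) :
    ∫ x, q (firstCoords x) * hermiteProd k 1 x i
      ∂(stdGaussian (EuclideanSpace ℝ (Fin (s + n)))) =
    (∫ t, q t * ∏ a, hermiteScaled (indexCount i (Fin.castAdd n a)) 1 (t a)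
      ∂(stdGaussian (EuclideanSpace ℝ (Fin s)))) *
      ∏ b, if indexCount i (Fin.natAdd s b) = 0 then 1 else 0 := by
  have hm : Measurable fun x : EuclideanSpace ℝ (Fin (s + n)) =>
      q (firstCoords x) * hermiteProd k 1 x i :=
    (hq.comp measurable_firstCoords).mul
      ((PiLp.continuous_apply 2 _ i).comp (continuous_hermiteProd k 1)).measurable
  rw [← map_appendVec, integral_map measurable_appendVec.aemeasurable hm.aestronglyMeasurable]
  simp_rw [firstCoords_appendVec, hermiteProd_apply, Fin.prod_univ_add, appendVec_castAdd,
    appendVec_natAdd, ← mul_assoc]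
  rw [integral_prod_mul
    (fun t : EuclideanSpace ℝ (Fin s) =>
      q t * ∏ a, hermiteScaled (indexCount i (Fin.castAdd n a)) 1 (t a))
    (fun u : EuclideanSpace ℝ (Fin n) =>
      ∏ b, hermiteScaled (indexCount i (Fin.natAdd s b)) 1 (u b))]
  congr 1
  rw [integral_prod_stdGaussian fun b x => hermiteScaled (indexCount i (Fin.natAdd s b)) 1 x]
  simp_rw [integral_hermiteScaled]

lemma frameTensor_mul {d r s k : ℕ} (U : Matrix (Fin d) (Fin r) ℝ) (W : Matrix (Fin r) (Fin s) ℝ)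
    (B : Tensor s k) : frameTensor (U * W) k B = frameTensor U k (frameTensor W k B) := by
  ext i
  simp_rw [frameTensor_apply, Finset.mul_sum]
  rw [Finset.sum_comm]
  refine Finset.sum_congr rfl fun b _ => ?_
  simp_rw [Matrix.mul_apply, Finset.prod_univ_sum, Finset.sum_mul, Fintype.piFinset_univ,
    Finset.prod_mul_distrib, mul_assoc]

lemma integrable_smul_hermiteProd {d s k : ℕ}
    {r : EuclideanSpace ℝ (Fin d) → EuclideanSpace ℝ (Fin s)}
    (hr : Measurable r) {q : EuclideanSpace ℝ (Fin s) → ℝ}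
    (hq : Measurable q) {M : ℝ} (hM : ∀ t, |q t| ≤ M) :
    Integrable (fun x => q (r x) • hermiteProd (d := d) k 1 x)
      (stdGaussian (EuclideanSpace ℝ (Fin d))) :=
  (integrable_hermiteProd d k).bdd_smul M (hq.comp hr).aestronglyMeasurable
    (Filter.Eventually.of_forall fun _ => hM _)

/-- The Gaussian conditional mean of a Hermite tensor given the projection on a frame. -/
lemma integral_comp_frameProj_smul_hermiteProd {d s k : ℕ} {W : Matrix (Fin d) (Fin s) ℝ}
    (hW : W ∈ Stiefel d s) {q : EuclideanSpace ℝ (Fin s) → ℝ} (hq : Measurable q) {M : ℝ}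
    (hM : ∀ t, |q t| ≤ M) :
    ∫ x, q (frameProj W x) • hermiteProd k 1 x ∂(stdGaussian (EuclideanSpace ℝ (Fin d))) =
      frameTensor W k (∫ t, q t • hermiteProd k 1 t ∂(stdGaussian (EuclideanSpace ℝ (Fin s)))) := by
  -- A rotation U completing W reduces the claim to the frame R of the first s coordinates, with W =
  -- U R; Hermite tensors are equivariant under U.
  obtain ⟨hs, U, hU, hUW⟩ := exists_orthogonal_extension hW
  obtain ⟨n, rfl⟩ := Nat.exists_eq_add_of_le hs
  have hUU : U.transpose * U = 1 := hU
  have hUt := transpose_mem_stiefel hU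
  have hL := map_frameProj_stdGaussian hUt
  let R : Matrix (Fin (s + n)) (Fin s) ℝ :=
    Matrix.of fun j a => if j = Fin.castAdd n a then 1 else 0
  have hUR : U * R = W := by
    ext j a
    rw [Matrix.mul_apply]
    have := hUW j a
    simp only [R, Matrix.of_apply, mul_ite, mul_one, mul_zero, Finset.sum_ite_eq', Finset.mem_univ,
      if_true]
    exact this
  have hproj : ∀ y, frameProj W (frameProj U.transpose y) = firstCoords y := fun y => by
    ext a
    simp only [frameProj, Matrix.transpose_transpose, Matrix.mulVec_mulVec]
    have : W.transpose * U = R.transpose := by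
      rw [← hUR, Matrix.transpose_mul, Matrix.mul_assoc, hUU, Matrix.mul_one]
    rw [this]
    simp [R, Matrix.mulVec, dotProduct, firstCoords]
  have hP : ∫ y, q (firstCoords y) • hermiteProd k 1 y
      ∂(stdGaussian (EuclideanSpace ℝ (Fin (s + n)))) =
      frameTensor R k (∫ t, q t • hermiteProd k 1 t ∂(stdGaussian (EuclideanSpace ℝ (Fin s)))) := by
    ext i
    have e1 := (EuclideanSpace.proj (𝕜 := ℝ) i).integral_comp_comm
      (integrable_smul_hermiteProd (k := k) measurable_firstCoords (s := s) (d := s + n) hq hM)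
    have e2 : ∀ b : Fin k → Fin s, (∫ t, q t • hermiteProd k 1 t
        ∂(stdGaussian (EuclideanSpace ℝ (Fin s)))) b = ∫ t, q t * hermiteProd k 1 t b
        ∂(stdGaussian (EuclideanSpace ℝ (Fin s))) := fun b =>
      ((EuclideanSpace.proj (𝕜 := ℝ) b).integral_comp_comm
        (integrable_smul_hermiteProd (k := k) measurable_id hq hM)).symm
    refine e1.symm.trans ?_
    refine (integral_firstCoords_mul_hermiteProd hq i).trans ?_
    rw [frameTensor_apply]
    -- Both sides vanish as soon as an entry of i lies beyond the first s coordinates.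
    by_cases hi : ∃ b : Fin k → Fin s, i = fun a => Fin.castAdd n (b a)
    · obtain ⟨b, rfl⟩ := hi
      rw [Finset.sum_eq_single b]
      · have c1 : ∀ a, indexCount (fun l => Fin.castAdd n (b l)) (Fin.castAdd n a) =
            indexCount b a := fun a => by simp [indexCount]
        have c2 : ∀ a, indexCount (fun l => Fin.castAdd n (b l)) (Fin.natAdd s a) = 0 := fun a => by
          simp only [indexCount, Finset.sum_eq_zero_iff]
          intro l _
          rw [if_neg]
          simp [Fin.ext_iff]
          omega
        simp only [c1, c2, e2, hermiteProd_apply]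
        simp [R]
      · intro b' _ hb'
        obtain ⟨a, ha⟩ := Function.ne_iff.mp hb'
        rw [Finset.prod_eq_zero (Finset.mem_univ a), zero_mul]
        simp only [R, Matrix.of_apply]
        rw [if_neg]
        simpa using Ne.symm ha
      · simp
    · obtain ⟨l, b, hb⟩ : ∃ l b, i l = Fin.natAdd s b := by
        by_contra! hc
        refine hi ⟨fun l => ⟨i l, ?_⟩, funext fun l => rfl⟩
        by_contra hlt
        refine hc l ⟨i l - s, by omega⟩ ?_
        ext
        simp
        omega
      rw [Finset.prod_eq_zero (Finset.mem_univ b), mul_zero, Finset.sum_eq_zero]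
      · intro b' _
        rw [Finset.prod_eq_zero (Finset.mem_univ l), zero_mul]
        simp only [R, Matrix.of_apply, hb]
        rw [if_neg]
        simp [Fin.ext_iff]
        omega
      · rw [if_neg]
        intro h0
        have := (Finset.sum_eq_zero_iff.mp h0) l (Finset.mem_univ l)
        simp [hb] at this
  have hm : AEStronglyMeasurable (fun x => q (frameProj W x) • hermiteProd k 1 x)
      ((stdGaussian (EuclideanSpace ℝ (Fin (s + n)))).map (frameProj U.transpose)) := by
    rw [hL]
    exact (integrable_smul_hermiteProd (measurable_frameProj W) hq hM).1
  calc ∫ x, q (frameProj W x) • hermiteProd k 1 x ∂(stdGaussian (EuclideanSpace ℝ (Fin (s + n))))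
      = ∫ x, q (frameProj W x) • hermiteProd k 1 x
          ∂((stdGaussian (EuclideanSpace ℝ (Fin (s + n)))).map (frameProj U.transpose)) := by
          rw [hL]
    _ = ∫ y, q (firstCoords y) • frameTensor U k (hermiteProd k 1 y)
          ∂(stdGaussian (EuclideanSpace ℝ (Fin (s + n)))) := by
        rw [integral_map (measurable_frameProj _).aemeasurable hm]
        simp_rw [hproj, hermiteProd_frameProj hUt, Matrix.transpose_transpose]
    _ = frameTensor U k (∫ y, q (firstCoords y) • hermiteProd k 1 y
          ∂(stdGaussian (EuclideanSpace ℝ (Fin (s + n))))) := by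
        have := (LinearMap.toContinuousLinearMap (frameTensor U k)).integral_comp_comm
          (integrable_smul_hermiteProd (k := k) measurable_firstCoords (s := s) (d := s + n) hq hM)
        rw [LinearMap.coe_toContinuousLinearMap'] at this
        rw [← this]
        simp_rw [map_smul]
    _ = _ := by rw [hP, ← frameTensor_mul, hUR]

/-! ### Integrals of functions of the direction -/

lemma tensorPower_smul {d : ℕ} (ℓ : ℕ) (c : ℝ) (z : EuclideanSpace ℝ (Fin d)) :
    tensorPower ℓ (c • z) = c ^ ℓ • tensorPower ℓ z := by
  ext i
  simp [tensorPower, Finset.prod_mul_distrib]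

lemma norm_tensorPower {d : ℕ} (ℓ : ℕ) (z : EuclideanSpace ℝ (Fin d)) :
    ‖tensorPower ℓ z‖ = ‖z‖ ^ ℓ := by
  rw [← sq_eq_sq₀ (norm_nonneg _) (by positivity), norm_sq_tensor, ← pow_mul, mul_comm ℓ, pow_mul,
    EuclideanSpace.real_norm_sq_eq, ← Fin.prod_const, Finset.prod_univ_sum, Fintype.piFinset_univ]
  refine Finset.sum_congr rfl fun i _ => ?_
  simp [tensorPower, ← Finset.prod_mul_distrib, sq]

lemma continuous_tensorPower {d : ℕ} (ℓ : ℕ) : Continuous (tensorPower (d := d) ℓ) := by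
  unfold tensorPower
  fun_prop

lemma integral_rpow_mul_exp_norm {d p : ℕ} (hp : 1 ≤ p) {x : EuclideanSpace ℝ (Fin d)}
    (hx : x ≠ 0) :
    ∫ t in Set.Ioi (0 : ℝ), t ^ ((p : ℝ) / 2 - 1) * Real.exp (-(t * ‖x‖ ^ 2)) =
      (‖x‖⁻¹) ^ p * Real.Gamma ((p : ℝ) / 2) := by
  have hx' : 0 < ‖x‖ := norm_pos_iff.mpr hx
  have hp' : (0 : ℝ) < p := by exact_mod_cast hp
  have h := Real.integral_rpow_mul_exp_neg_mul_Ioi (a := (p : ℝ) / 2) (r := ‖x‖ ^ 2)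
    (by positivity) (by positivity)
  simp_rw [mul_comm (‖x‖ ^ 2)] at h
  rw [h]
  congr 1
  rw [one_div, ← inv_pow, ← Real.rpow_natCast, ← Real.rpow_mul (by positivity), 
    ← Real.rpow_natCast]
  congr 1
  push_cast
  ring

lemma integrableOn_rpow_mul_exp_norm {d p : ℕ} (hp : 1 ≤ p) {x : EuclideanSpace ℝ (Fin d)}
    (hx : x ≠ 0) :
    IntegrableOn (fun t : ℝ => t ^ ((p : ℝ) / 2 - 1) * Real.exp (-(t * ‖x‖ ^ 2))) (Set.Ioi 0) := by
  have hx' : 0 < ‖x‖ := norm_pos_iff.mpr hx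
  have hp' : (0 : ℝ) < p := by exact_mod_cast hp
  -- A non-integrable function has Bochner integral zero, so the positive value just computed proves
  -- integrability.
  refine Integrable.of_integral_ne_zero ?_
  rw [integral_rpow_mul_exp_norm hp hx]
  have := Real.Gamma_pos_of_pos (s := (p : ℝ) / 2) (by positivity)
  positivity

/-- Averages over directions as mixtures of Gaussian averages, for a function which is the product
of a bounded function and a homogeneous one. -/
lemma integral_homogeneous_direction {d p : ℕ} (hp : 1 ≤ p)
    {g h : EuclideanSpace ℝ (Fin d) → ℝ} (hg : Measurable g) (hh : Measurable h) {M K : ℝ}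
    (hM : ∀ x, |g x| ≤ M) (hK0 : 0 ≤ K) (hK : ∀ x, |h x| ≤ K * ‖x‖ ^ p)
    (hhom : ∀ (c : ℝ) x, 0 ≤ c → h (c • x) = c ^ p * h x) :
    ∫ x, g x * h (‖x‖⁻¹ • x) ∂(stdGaussian (EuclideanSpace ℝ (Fin d))) =
      (Real.Gamma ((p : ℝ) / 2))⁻¹ * ∫ t in Set.Ioi (0 : ℝ), t ^ ((p : ℝ) / 2 - 1) *
        ((√(1 + 2 * t) ^ (d + p))⁻¹ *
          ∫ x, g ((√(1 + 2 * t))⁻¹ • x) * h x ∂(stdGaussian (EuclideanSpace ℝ (Fin d)))) := by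
  have hp0 : p ≠ 0 := by omega
  have hp' : (0 : ℝ) < p := by exact_mod_cast hp
  have hG := Real.Gamma_pos_of_pos (s := (p : ℝ) / 2) (by positivity)
  -- The Gamma integral is unavailable at x = 0, where homogeneity of degree p ≥ 1 makes h vanish.
  have h0 : h 0 = 0 := by
    have := hhom 0 0 le_rfl
    simpa [hp0] using this
  let F : EuclideanSpace ℝ (Fin d) → ℝ → ℝ := fun x t =>
    (t ^ ((p : ℝ) / 2 - 1) * Real.exp (-(t * ‖x‖ ^ 2))) * (g x * h x)
  have hFint : ∀ x, ∫ t in Set.Ioi (0 : ℝ), F x t =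
      Real.Gamma ((p : ℝ) / 2) * (g x * h (‖x‖⁻¹ • x)) := fun x => by
    simp only [F]
    rw [integral_mul_const]
    by_cases hx : x = 0
    · simp [hx, h0]
    · rw [integral_rpow_mul_exp_norm hp hx, hhom _ _ (by positivity)]
      ring
  have hFnorm : ∀ x, ∫ t in Set.Ioi (0 : ℝ), ‖F x t‖ =
      Real.Gamma ((p : ℝ) / 2) * |g x * h (‖x‖⁻¹ • x)| := fun x => by
    have e : ∀ t ∈ Set.Ioi (0 : ℝ), ‖F x t‖ =
        (t ^ ((p : ℝ) / 2 - 1) * Real.exp (-(t * ‖x‖ ^ 2))) * |g x * h x| := fun t ht => by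
      have : (0 : ℝ) < t := ht
      simp only [F]
      rw [norm_mul, Real.norm_eq_abs, Real.norm_eq_abs, abs_of_nonneg (a := _ * Real.exp _)
        (by positivity)]
    rw [setIntegral_congr_fun measurableSet_Ioi e, integral_mul_const]
    by_cases hx : x = 0
    · simp [hx, h0]
    · rw [integral_rpow_mul_exp_norm hp hx, hhom _ _ (by positivity), abs_mul, abs_mul, abs_mul,
        abs_of_nonneg (a := ‖x‖⁻¹ ^ p) (by positivity)]
      ring
  have hmeas : Measurable (Function.uncurry F) := by
    simp only [F, Function.uncurry_def]
    fun_prop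
  have hint : Integrable (Function.uncurry F)
      ((stdGaussian (EuclideanSpace ℝ (Fin d))).prod (volume.restrict (Set.Ioi (0 : ℝ)))) := by
    rw [integrable_prod_iff hmeas.aestronglyMeasurable]
    refine ⟨Filter.Eventually.of_forall fun x => ?_, ?_⟩
    · by_cases hx : x = 0
      · simp [F, hx, h0]
      · exact Integrable.mul_const (integrableOn_rpow_mul_exp_norm hp hx) (g x * h x)
    · simp only [Function.uncurry_apply_pair, hFnorm]
      refine Integrable.const_mul ?_ _
      have hm2 : Measurable fun x : EuclideanSpace ℝ (Fin d) => |g x * h (‖x‖⁻¹ • x)| := by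
        fun_prop
      refine Integrable.of_bound hm2.aestronglyMeasurable (M * K) 
        (Filter.Eventually.of_forall fun x => ?_)
      have hz : ‖(‖x‖⁻¹ • x : EuclideanSpace ℝ (Fin d))‖ ^ p ≤ 1 := by
        refine pow_le_one₀ (norm_nonneg _) ?_
        rw [norm_smul, norm_inv, norm_norm]
        exact inv_mul_le_one
      have hM0 : 0 ≤ M := (abs_nonneg _).trans (hM 0)
      rw [Real.norm_eq_abs, abs_abs, abs_mul]
      refine mul_le_mul (hM x) ?_ (abs_nonneg _) hM0
      by_cases hx : x = 0
      · simpa [hx, h0] using hK0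
      · have h4 := hK (‖x‖⁻¹ • x)
        rw [norm_smul, norm_inv, norm_norm, inv_mul_cancel₀ (norm_ne_zero_iff.mpr hx)] at h4
        simpa using h4
  rw [eq_inv_mul_iff_mul_eq₀ hG.ne', ← integral_const_mul]
  simp_rw [← hFint]
  rw [integral_integral_swap hint]
  refine setIntegral_congr_fun measurableSet_Ioi fun t ht => ?_
  have ht' : (0 : ℝ) < t := ht
  have hr : 0 < √(1 + 2 * t) := Real.sqrt_pos.mpr (by linarith)
  have hr2 : √(1 + 2 * t) ^ 2 = 1 + 2 * t := Real.sq_sqrt (by linarith)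
  set r := √(1 + 2 * t) with hrdef
  -- The factor exp(-t‖x‖²) is the Gaussian tilt by r with r² = 1 + 2t. The tilt costs r^{-d}, and
  -- the homogeneity of h another r^{-p}.
  have key := integral_exp_smul_comp_smul hr fun x : EuclideanSpace ℝ (Fin d) =>
    (r ^ p)⁻¹ * (g (r⁻¹ • x) * h x)
  simp only [F, smul_eq_mul] at key ⊢
  rw [integral_const_mul] at key
  have e : ∀ x : EuclideanSpace ℝ (Fin d), t ^ ((p : ℝ) / 2 - 1) * Real.exp (-(t * ‖x‖ ^ 2)) *
      (g x * h x) = t ^ ((p : ℝ) / 2 - 1) * (Real.exp (-((r ^ 2 - 1) / 2 * ‖x‖ ^ 2)) *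
        ((r ^ p)⁻¹ * (g (r⁻¹ • r • x) * h (r • x)))) := fun x => by
    rw [hhom r x hr.le, smul_smul, inv_mul_cancel₀ hr.ne', one_smul, hr2]
    have h1 : (1 + 2 * t - 1) / 2 = t := by ring
    have h2 : r ^ p ≠ 0 := by positivity
    rw [h1]
    field_simp
  simp_rw [e]
  rw [integral_const_mul, key, pow_add, mul_inv]
  ring

/-! ### Beta weights -/

/-- The weight `t^{a-1} (1+2t)^{-b}`. -/
noncomputable def betaWeight (a b t : ℝ) : ℝ := t ^ (a - 1) * (1 + 2 * t) ^ (-b)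

lemma betaWeight_nonneg {a b t : ℝ} (ht : 0 < t) : 0 ≤ betaWeight a b t := by
  unfold betaWeight; positivity

lemma measurable_betaWeight (a b : ℝ) : Measurable (betaWeight a b) := by
  unfold betaWeight; fun_prop

lemma integrableOn_betaWeight {a b : ℝ} (ha : 0 < a) (hab : a < b) :
    IntegrableOn (betaWeight a b) (Set.Ioi 0) := by
  rw [← Set.Ioc_union_Ioi_eq_Ioi zero_le_one]
  refine IntegrableOn.union ?_ ?_
  · have h : IntegrableOn (fun t : ℝ => t ^ (a - 1)) (Set.Ioc 0 1) := by
      rw [← intervalIntegrable_iff_integrableOn_Ioc_of_le zero_le_one]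
      exact intervalIntegral.intervalIntegrable_rpow' (by linarith)
    refine Integrable.mono' h (measurable_betaWeight a b).aestronglyMeasurable ?_
    refine (ae_restrict_iff' measurableSet_Ioc).mpr (Filter.Eventually.of_forall fun t ht => ?_)
    rw [Real.norm_eq_abs, abs_of_nonneg (betaWeight_nonneg ht.1)]
    have h1 : (1 + 2 * t) ^ (-b) ≤ 1 :=
      Real.rpow_le_one_of_one_le_of_nonpos (by linarith [ht.1]) (by linarith)
    have h2 : 0 ≤ t ^ (a - 1) := Real.rpow_nonneg ht.1.le _
    calc betaWeight a b t ≤ t ^ (a - 1) * 1 := mul_le_mul_of_nonneg_left h1 h2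
      _ = _ := mul_one _
  · have h : IntegrableOn (fun t : ℝ => t ^ (a - 1 - b)) (Set.Ioi 1) :=
      integrableOn_Ioi_rpow_of_lt (by linarith) one_pos
    refine Integrable.mono' h (measurable_betaWeight a b).aestronglyMeasurable ?_
    refine (ae_restrict_iff' measurableSet_Ioi).mpr (Filter.Eventually.of_forall fun t ht => ?_)
    have ht1 : (1 : ℝ) < t := ht
    have ht0 : 0 < t := zero_lt_one.trans ht1
    rw [Real.norm_eq_abs, abs_of_nonneg (betaWeight_nonneg ht0), sub_eq_add_neg (a - 1) b,
      Real.rpow_add ht0]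
    refine mul_le_mul_of_nonneg_left ?_ (by positivity)
    exact Real.rpow_le_rpow_of_nonpos ht0 (by linarith) (by linarith)

/-- The weight concentrates at t of order 1/b. With c = b/(a + 1) ≥ 1, Bernoulli's inequality 1 +
2ct ≤ (1 + 2t)^c dominates it by a rescaling of the weight with the fixed exponent a + 1. -/
lemma exists_integral_betaWeight_le {a : ℝ} (ha : 0 < a) :
    ∃ K : ℝ, 0 < K ∧ ∀ b, a + 1 ≤ b →
      ∫ t in Set.Ioi (0 : ℝ), betaWeight a b t ≤ K * b ^ (-a) := by
  set I := ∫ t in Set.Ioi (0 : ℝ), betaWeight a (a + 1) t with hI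
  have hI0 : 0 ≤ I := setIntegral_nonneg measurableSet_Ioi fun t ht => betaWeight_nonneg ht
  refine ⟨(a + 1) ^ a * (I + 1), by positivity, fun b hb => ?_⟩
  have hb0 : 0 < b := by linarith
  set c := b / (a + 1) with hc
  have hc0 : 0 < c := by positivity
  have hc1 : 1 ≤ c := by rw [hc, le_div_iff₀ (by linarith)]; linarith
  have hpt : ∀ t ∈ Set.Ioi (0 : ℝ), betaWeight a b t ≤
      c ^ (1 - a) * betaWeight a (a + 1) (c * t) := fun t ht => by
    have ht' : (0 : ℝ) < t := ht
    unfold betaWeight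
    rw [Real.mul_rpow hc0.le ht'.le, ← mul_assoc, ← mul_assoc, ← Real.rpow_add hc0,
      show 1 - a + (a - 1) = 0 by ring, Real.rpow_zero, one_mul]
    refine mul_le_mul_of_nonneg_left ?_ (by positivity)
    rw [Real.rpow_neg (by positivity), Real.rpow_neg (by positivity)]
    refine inv_anti₀ (by positivity) ?_
    have h1 : 1 + c * (2 * t) ≤ (1 + 2 * t) ^ c :=
      one_add_mul_self_le_rpow_one_add (by linarith) hc1
    calc (1 + 2 * (c * t)) ^ (a + 1) ≤ ((1 + 2 * t) ^ c) ^ (a + 1) := by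
          refine Real.rpow_le_rpow (by positivity) (by linarith) (by linarith)
      _ = (1 + 2 * t) ^ b := by
          rw [← Real.rpow_mul (by positivity), hc, div_mul_cancel₀ _ (by linarith)]
  have hint : IntegrableOn (fun t => betaWeight a (a + 1) (c * t)) (Set.Ioi 0) := by
    have := (integrableOn_Ioi_comp_mul_left_iff (betaWeight a (a + 1)) 0 hc0).mpr
      (by simpa using integrableOn_betaWeight ha (by linarith))
    exact this
  calc ∫ t in Set.Ioi (0 : ℝ), betaWeight a b t
      ≤ ∫ t in Set.Ioi (0 : ℝ), c ^ (1 - a) * betaWeight a (a + 1) (c * t) :=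
        setIntegral_mono_on (integrableOn_betaWeight ha (by linarith)) (hint.const_mul _)
          measurableSet_Ioi hpt
    _ = c ^ (1 - a) * (c⁻¹ * I) := by
        rw [integral_const_mul, integral_comp_mul_left_Ioi _ _ hc0]
        simp [hI]
    _ = c ^ (-a) * I := by
        rw [← mul_assoc]
        congr 1
        rw [← Real.rpow_neg_one c, ← Real.rpow_add hc0]
        congr 1
        ring
    _ ≤ c ^ (-a) * (I + 1) := by gcongr; linarith
    _ = _ := by
        rw [hc, Real.div_rpow hb0.le (by linarith), Real.rpow_neg (by linarith : 0 ≤ a + 1)]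
        field_simp

/-- On (0, 1/b] the factor (1 + 2t)^b is at most e², and t^{a-1} integrates to b^{-a}/a there. -/
lemma le_integral_betaWeight {a b : ℝ} (ha : 0 < a) (hab : a < b) :
    Real.exp (-2) / a * b ^ (-a) ≤ ∫ t in Set.Ioi (0 : ℝ), betaWeight a b t := by
  have hb : 0 < b := ha.trans hab
  have h : IntegrableOn (fun t : ℝ => t ^ (a - 1)) (Set.Ioc 0 b⁻¹) := by
    rw [← intervalIntegrable_iff_integrableOn_Ioc_of_le (by positivity)]
    exact intervalIntegral.intervalIntegrable_rpow' (by linarith)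
  have h1 : ∫ t in Set.Ioc (0 : ℝ) b⁻¹, Real.exp (-2) * t ^ (a - 1) =
      Real.exp (-2) / a * b ^ (-a) := by
    rw [integral_const_mul, ← intervalIntegral.integral_of_le (by positivity),
      integral_rpow (Or.inl (by linarith)), sub_add_cancel, Real.zero_rpow ha.ne', sub_zero,
      Real.inv_rpow hb.le, Real.rpow_neg hb.le]
    ring
  rw [← h1]
  have hint := integrableOn_betaWeight ha hab
  calc ∫ t in Set.Ioc (0 : ℝ) b⁻¹, Real.exp (-2) * t ^ (a - 1)
      ≤ ∫ t in Set.Ioc (0 : ℝ) b⁻¹, betaWeight a b t := by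
        refine setIntegral_mono_on (h.const_mul _) (hint.mono_set Set.Ioc_subset_Ioi_self)
          measurableSet_Ioc fun t ht => ?_
        unfold betaWeight
        rw [mul_comm]
        refine mul_le_mul_of_nonneg_left ?_ (Real.rpow_nonneg ht.1.le _)
        have h3 : (1 + 2 * t) ^ b ≤ Real.exp 2 := by
          have ht1 := ht.1
          calc (1 + 2 * t) ^ b ≤ (Real.exp (2 * t)) ^ b := by
                refine Real.rpow_le_rpow (by linarith) ?_ hb.le
                linarith [Real.add_one_le_exp (2 * t)]
            _ = Real.exp (2 * t * b) := by rw [← Real.exp_mul]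
            _ ≤ Real.exp 2 := by
                refine Real.exp_le_exp.mpr ?_
                have : t * b ≤ 1 := by
                  have := mul_le_mul_of_nonneg_right ht.2 hb.le
                  rwa [inv_mul_cancel₀ hb.ne'] at this
                linarith
        rw [Real.exp_neg, Real.rpow_neg (by linarith [ht.1])]
        exact inv_anti₀ (Real.rpow_pos_of_pos (by linarith [ht.1]) _) h3
    _ ≤ _ := setIntegral_mono_set hint
        ((ae_restrict_iff' measurableSet_Ioi).mpr
          (Filter.Eventually.of_forall fun t ht => betaWeight_nonneg ht))
        (Set.Ioc_subset_Ioi_self.eventuallyLE)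

lemma integral_betaWeight_one {c : ℝ} (hc : 0 < c) :
    ∫ t in Set.Ioi (0 : ℝ), betaWeight 1 (c + 1) t = (2 * c)⁻¹ := by
  have hder : ∀ t ∈ Set.Ioi (0 : ℝ), HasDerivAt (fun t : ℝ => -(2 * c)⁻¹ * (1 + 2 * t) ^ (-c))
      (betaWeight 1 (c + 1) t) t := fun t ht => by
    have ht' : (0 : ℝ) < t := ht
    have h1 : HasDerivAt (fun t : ℝ => 1 + 2 * t) 2 t := by
      simpa using ((hasDerivAt_id t).const_mul 2).const_add 1
    refine ((h1.rpow_const (p := -c) (Or.inl (by positivity))).const_mul _).congr_deriv ?_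
    unfold betaWeight
    rw [sub_self, Real.rpow_zero, one_mul, show -c - 1 = -(c + 1) by ring]
    field_simp
  have h := integral_Ioi_of_hasDerivAt_of_tendsto
    (f := fun t : ℝ => -(2 * c)⁻¹ * (1 + 2 * t) ^ (-c))
    (a := 0) (m := 0) ?_ hder (integrableOn_betaWeight one_pos (by linarith)) ?_
  · rw [h]; simp
  · refine ContinuousAt.continuousWithinAt ?_
    have : ContinuousAt (fun t : ℝ => (1 + 2 * t) ^ (-c)) 0 :=
      ContinuousAt.rpow_const (by fun_prop) (Or.inl (by norm_num))
    exact this.const_mul _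
  · have h1 : Filter.Tendsto (fun t : ℝ => 1 + 2 * t) Filter.atTop Filter.atTop :=
      Filter.tendsto_atTop_add_const_left _ _ (Filter.tendsto_id.const_mul_atTop two_pos)
    simpa using ((tendsto_rpow_neg_atTop hc).comp h1).const_mul (-(2 * c)⁻¹)

/-- The derivative of t^a (1 + 2t)^{-(c+a)} integrates to zero over (0, ∞). -/
lemma integral_betaWeight_succ {a c : ℝ} (ha : 0 < a) (hc : 0 < c) :
    ∫ t in Set.Ioi (0 : ℝ), betaWeight (a + 1) (c + a + 1) t =
      a / (2 * (c + a)) * ∫ t in Set.Ioi (0 : ℝ), betaWeight a (c + a) t := by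
  have i1 := integrableOn_betaWeight ha (show a < c + a by linarith)
  have i2 := integrableOn_betaWeight (show 0 < a + 1 by linarith)
    (show a + 1 < c + a + 1 by linarith)
  have hder : ∀ t ∈ Set.Ioi (0 : ℝ), HasDerivAt (fun t : ℝ => t ^ a * (1 + 2 * t) ^ (-(c + a)))
      (a * betaWeight a (c + a) t - 2 * (c + a) * betaWeight (a + 1) (c + a + 1) t) t :=
    fun t ht => by
    have ht' : (0 : ℝ) < t := ht
    have h1 : HasDerivAt (fun t : ℝ => 1 + 2 * t) 2 t := by
      simpa using ((hasDerivAt_id t).const_mul 2).const_add 1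
    refine ((Real.hasDerivAt_rpow_const (p := a) (Or.inl ht'.ne')).mul
      (h1.rpow_const (p := -(c + a)) (Or.inl (by positivity)))).congr_deriv ?_
    unfold betaWeight
    rw [show -(c + a) - 1 = -(c + a + 1) by ring, show a + 1 - 1 = a by ring]
    ring
  have h := integral_Ioi_of_hasDerivAt_of_tendsto
    (f := fun t : ℝ => t ^ a * (1 + 2 * t) ^ (-(c + a)))
    (a := 0) (m := 0) ?_ hder ((i1.const_mul _).sub (i2.const_mul _)) ?_
  · rw [integral_sub (i1.const_mul _) (i2.const_mul _), integral_const_mul,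
      integral_const_mul, Real.zero_rpow ha.ne'] at h
    have h0 : 2 * (c + a) ≠ 0 := by positivity
    field_simp
    linarith
  · refine ContinuousAt.continuousWithinAt ?_
    refine ContinuousAt.mul (Real.continuousAt_rpow_const _ _ (Or.inr ha.le)) ?_
    exact ContinuousAt.rpow_const (by fun_prop) (Or.inl (by norm_num))
  · have h1 : Filter.Tendsto (fun t : ℝ => 1 + 2 * t) Filter.atTop Filter.atTop :=
      Filter.tendsto_atTop_add_const_left _ _ (Filter.tendsto_id.const_mul_atTop two_pos)
    refine squeeze_zero' ?_ ?_ ((tendsto_rpow_neg_atTop hc).comp h1)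
    · filter_upwards [Filter.eventually_gt_atTop 0] with t ht
      positivity
    · filter_upwards [Filter.eventually_gt_atTop 0] with t ht
      calc t ^ a * (1 + 2 * t) ^ (-(c + a)) ≤ (1 + 2 * t) ^ a * (1 + 2 * t) ^ (-(c + a)) := by
            gcongr; linarith
        _ = (1 + 2 * t) ^ (-c) := by
            rw [← Real.rpow_add (by positivity)]; congr 1; ring

/-- The exact value is needed here, not only the order in d: it gives the harmonic tensors unit
variance in every direction, hence a bound s^ℓ with no further constant depending on ℓ. -/
lemma integral_betaWeight_nat {d ℓ : ℕ} (hd : 1 ≤ d) :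
    (∫ t in Set.Ioi (0 : ℝ), betaWeight ((ℓ + 1 : ℕ) : ℝ) ((d : ℝ) / 2 + (ℓ + 1 : ℕ)) t) *
      ∏ i ∈ Finset.range (ℓ + 1), ((d : ℝ) + 2 * i) = ℓ.factorial := by
  have hd' : (0 : ℝ) < d := by exact_mod_cast hd
  induction ℓ with
  | zero =>
    have := integral_betaWeight_one (c := (d : ℝ) / 2) (by positivity)
    simp only [zero_add, Nat.cast_one, this]
    simp
    field_simp
  | succ ℓ ih =>
    have h := integral_betaWeight_succ (a := ((ℓ + 1 : ℕ) : ℝ)) (c := (d : ℝ) / 2) (by positivity)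
      (by positivity)
    rw [Nat.cast_add_one (ℓ + 1), ← add_assoc, h, Finset.prod_range_succ, Nat.factorial_succ,
      Nat.cast_mul, ← ih]
    have h0 : (d : ℝ) / 2 + (ℓ + 1 : ℕ) ≠ 0 := by positivity
    field_simp

lemma sqrt_pow_inv {v : ℝ} (hv : 0 < v) (n : ℕ) : (√v ^ n)⁻¹ = v ^ (-((n : ℝ) / 2)) := by
  rw [Real.sqrt_eq_rpow, ← Real.rpow_natCast, ← Real.rpow_mul hv.le, ← Real.rpow_neg hv.le]
  congr 1
  ring

/-! ### Moments of harmonic tensors -/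

lemma abs_inner_tensorPower_le {d ℓ : ℕ} (A : Tensor d ℓ) (x : EuclideanSpace ℝ (Fin d)) :
    |inner ℝ A (tensorPower ℓ x)| ≤ ‖A‖ * ‖x‖ ^ ℓ := by
  rw [← norm_tensorPower]
  exact abs_real_inner_le_norm _ _

/-- With g = 1 and p = 2ℓ the mixture formula involves only the Gaussian second moment ℓ!‖A‖² of ⟨A,
h_ℓ⟩, at every t, and an explicit beta integral. -/
lemma integral_inner_direction_sq {d ℓ : ℕ} (hd : 1 ≤ d) (hℓ : 1 ≤ ℓ) {A : Tensor d ℓ}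
    (hA : A ∈ tracelessSym d ℓ) :
    (∫ x, (inner ℝ A (tensorPower ℓ (‖x‖⁻¹ • x))) ^ 2 ∂(stdGaussian (EuclideanSpace ℝ (Fin d)))) *
      ∏ i ∈ Finset.range ℓ, ((d : ℝ) + 2 * i) = ℓ.factorial * ‖A‖ ^ 2 := by
  obtain ⟨m, rfl⟩ := Nat.exists_eq_add_of_le' hℓ
  have hm : Measurable fun x : EuclideanSpace ℝ (Fin d) =>
      (inner ℝ A (tensorPower (m + 1) x)) ^ 2 := by
    have := continuous_tensorPower (d := d) (m + 1)
    exact Continuous.measurable (by fun_prop)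
  have h := integral_homogeneous_direction (p := 2 * (m + 1)) (by omega) (g := fun _ => 1)
    (h := fun x : EuclideanSpace ℝ (Fin d) => (inner ℝ A (tensorPower (m + 1) x)) ^ 2)
    measurable_const hm (M := 1) (K := ‖A‖ ^ 2) (by simp) (by positivity)
    (fun x => by
      rw [abs_pow, mul_comm 2, pow_mul, ← mul_pow]
      gcongr
      exact abs_inner_tensorPower_le A x)
    (fun c x _ => by
      rw [tensorPower_smul, inner_smul_right, mul_comm 2, pow_mul, ← mul_pow])
  simp only [one_mul] at h
  have h2 := integral_inner_hermiteProd_sq (tracelessSym_le_symTensors _ _ hA)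
  simp_rw [inner_hermiteProd_eq_inner_tensorPower hA] at h2
  rw [h, h2]
  have e : ∀ t ∈ Set.Ioi (0 : ℝ), t ^ (((2 * (m + 1) : ℕ) : ℝ) / 2 - 1) *
      ((√(1 + 2 * t) ^ (d + 2 * (m + 1)))⁻¹ * (((m + 1).factorial : ℝ) * ‖A‖ ^ 2)) =
      betaWeight ((m + 1 : ℕ) : ℝ) ((d : ℝ) / 2 + (m + 1 : ℕ)) t *
        (((m + 1).factorial : ℝ) * ‖A‖ ^ 2) := fun t ht => by
    have ht' : (0 : ℝ) < t := ht
    rw [sqrt_pow_inv (by positivity), betaWeight, ← mul_assoc]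
    congr 3
    · push_cast; ring
    · push_cast; ring
  rw [setIntegral_congr_fun measurableSet_Ioi e, integral_mul_const]
  have h3 := integral_betaWeight_nat (ℓ := m) hd
  have h4 : (((2 * (m + 1) : ℕ) : ℝ) / 2) = m + 1 := by push_cast; ring
  rw [h4, Real.Gamma_nat_eq_factorial]
  have h5 : (m.factorial : ℝ) ≠ 0 := by positivity
  calc _ = (m.factorial : ℝ)⁻¹ * ((∫ t in Set.Ioi (0 : ℝ),
        betaWeight ((m + 1 : ℕ) : ℝ) ((d : ℝ) / 2 + (m + 1 : ℕ)) t) *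
      ∏ i ∈ Finset.range (m + 1), ((d : ℝ) + 2 * i)) * (((m + 1).factorial : ℝ) * ‖A‖ ^ 2) := by
        ring
    _ = _ := by rw [h3, inv_mul_cancel₀ h5, one_mul]

/-- `κ² N = d (d+2) ⋯ (d+2ℓ-2) / ℓ!`. -/
lemma kappa_sq_mul_harmonicDim {d ℓ : ℕ} (hd : 3 ≤ d) (hℓ : 1 ≤ ℓ) :
    (kappa d ℓ * √(harmonicDim d ℓ)) ^ 2 * ℓ.factorial =
      ∏ i ∈ Finset.range ℓ, ((d : ℝ) + 2 * i) := by
  -- Writing d = n + 3 makes d/2 - 1 and d - 2 visibly positive and resolves the truncated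
  -- subtraction in the binomial coefficient.
  obtain ⟨n, rfl⟩ := Nat.exists_eq_add_of_le' hd
  have hasc : ∀ (m : ℕ) (x : ℝ), (ascPochhammer ℝ m).eval x = ∏ i ∈ Finset.range m, (x + i) := by
    intro m x
    induction m with
    | zero => simp
    | succ m ih => rw [ascPochhammer_succ_eval, ih, Finset.prod_range_succ]
  have hpos : ∀ (m : ℕ) (x : ℝ), 0 < x → 0 < ∏ i ∈ Finset.range m, (x + i) := fun m x hx =>
    Finset.prod_pos fun i _ => by positivity
  have hN : 0 ≤ harmonicDim (n + 3) ℓ := by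
    match ℓ with
    | 1 => simp only [harmonicDim]; positivity
    | m + 2 => simp only [harmonicDim]; positivity
  have h1 : 0 < ((n + 3 : ℕ) : ℝ) / 2 - 1 := by push_cast; linarith [Nat.cast_nonneg (α := ℝ) n]
  have h2 : 0 < ((n + 3 : ℕ) : ℝ) - 2 := by push_cast; linarith [Nat.cast_nonneg (α := ℝ) n]
  rw [mul_pow, kappa, Real.sq_sqrt hN, Real.sq_sqrt (by
    rw [hasc, hasc]
    exact (div_pos (mul_pos (by positivity) (hpos _ _ h1)) (hpos _ _ h2)).le), hasc, hasc]
  have h3 : (2 : ℝ) ^ ℓ * ∏ i ∈ Finset.range ℓ, (((n + 3 : ℕ) : ℝ) / 2 - 1 + i) =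
      ∏ i ∈ Finset.range ℓ, ((n : ℝ) + 1 + 2 * i) := by
    rw [← Finset.card_range ℓ, ← Finset.prod_const, Finset.card_range, ← Finset.prod_mul_distrib]
    refine Finset.prod_congr rfl fun i _ => ?_
    push_cast
    ring
  rw [h3]
  have h4 : ∏ i ∈ Finset.range ℓ, (((n + 3 : ℕ) : ℝ) - 2 + i) =
      ∏ i ∈ Finset.range ℓ, ((n : ℝ) + 1 + i) :=
    Finset.prod_congr rfl fun i _ => by push_cast; ring
  rw [h4]
  match ℓ with
  | 1 =>
    simp [harmonicDim]
    field_simp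
  | m + 2 =>
    have h5 : ∀ a : ℕ, ((n + 1 + a).choose a : ℝ) * a.factorial =
        ∏ i ∈ Finset.range a, ((n : ℝ) + 2 + i) := by
      intro a
      have := Nat.ascFactorial_eq_factorial_mul_choose (n + 1) a
      have h6 : ((n + 1 + 1).ascFactorial a : ℝ) = ∏ i ∈ Finset.range a, ((n : ℝ) + 2 + i) := by
        induction a with
        | zero => simp
        | succ a ih =>
          rw [Nat.ascFactorial_succ, Finset.prod_range_succ, Nat.cast_mul,
            ih (Nat.ascFactorial_eq_factorial_mul_choose _ _)]
          push_cast
          ring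
      rw [← h6, this]
      push_cast
      ring
    have h7 := h5 (m + 1)
    have h8 : ∏ i ∈ Finset.range (m + 2), ((n : ℝ) + 1 + i) =
        (∏ i ∈ Finset.range (m + 1), ((n : ℝ) + 2 + i)) * (n + 1) := by
      rw [Finset.prod_range_succ']
      congr 1
      · refine Finset.prod_congr rfl fun i _ => ?_
        push_cast; ring
      · simp
    have h9 : ∏ i ∈ Finset.range (m + 2), ((n : ℝ) + 1 + 2 * i) =
        (∏ i ∈ Finset.range (m + 1), (((n + 3 : ℕ) : ℝ) + 2 * i)) * (n + 1) := by
      rw [Finset.prod_range_succ']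
      congr 1
      · refine Finset.prod_congr rfl fun i _ => ?_
        push_cast; ring
      · simp
    have h10 : n + 3 + m - 1 = n + 1 + (m + 1) := by omega
    rw [h8, h9, ← h7, Finset.prod_range_succ _ (m + 1), harmonicDim, h10,
      Nat.factorial_succ (m + 1)]
    have c1 : ((n + 1 + (m + 1)).choose (m + 1) : ℝ) ≠ 0 := by
      have : 0 < (n + 1 + (m + 1)).choose (m + 1) := Nat.choose_pos (by omega)
      positivity
    have c2 : ((m + 1).factorial : ℝ) ≠ 0 := by positivity
    push_cast
    field_simp
    ring

/-! ### The conditional mean of a harmonic tensor given the projection on a frame -/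

/-- After the passage to Gaussian averages at scale √(1 + 2t), tracelessness replaces the tensor
power by the Hermite tensor, whose average factors through the frame. -/
lemma integral_comp_frameProj_mul_inner_direction {d s ℓ : ℕ} {W : Matrix (Fin d) (Fin s) ℝ}
    (hW : W ∈ Stiefel d s) (hℓ : 1 ≤ ℓ) {A : Tensor d ℓ} (hA : A ∈ tracelessSym d ℓ)
    {q : EuclideanSpace ℝ (Fin s) → ℝ} (hq : Measurable q) {M : ℝ} (hM : ∀ t, |q t| ≤ M) :
    ∫ x, q (frameProj W x) * inner ℝ A (tensorPower ℓ (‖x‖⁻¹ • x))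
      ∂(stdGaussian (EuclideanSpace ℝ (Fin d))) =
    (Real.Gamma ((ℓ : ℝ) / 2))⁻¹ * ∫ t in Set.Ioi (0 : ℝ), t ^ ((ℓ : ℝ) / 2 - 1) *
      ((√(1 + 2 * t) ^ (d + ℓ))⁻¹ * inner ℝ A (frameTensor W ℓ
        (∫ u, q ((√(1 + 2 * t))⁻¹ • u) • hermiteProd ℓ 1 u
          ∂(stdGaussian (EuclideanSpace ℝ (Fin s)))))) := by
  have hm : Measurable fun x : EuclideanSpace ℝ (Fin d) => inner ℝ A (tensorPower ℓ x) := by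
    have := continuous_tensorPower (d := d) ℓ
    exact Continuous.measurable (by fun_prop)
  rw [integral_homogeneous_direction hℓ (g := fun x => q (frameProj W x))
    (h := fun x => inner ℝ A (tensorPower ℓ x)) (hq.comp (measurable_frameProj W)) hm
    (fun x => hM _) (norm_nonneg A) (abs_inner_tensorPower_le A)
    (fun c x _ => by rw [tensorPower_smul, inner_smul_right])]
  congr 1
  refine integral_congr_ae (Filter.Eventually.of_forall fun t => ?_)
  simp only
  congr 2
  set r := √(1 + 2 * t)
  have hq' : Measurable fun u : EuclideanSpace ℝ (Fin s) => q (r⁻¹ • u) :=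
    hq.comp (measurable_const_smul _)
  rw [← integral_comp_frameProj_smul_hermiteProd hW hq' (fun u => hM _),
    ← integral_inner (integrable_smul_hermiteProd (measurable_frameProj W) hq' (fun u => hM _))]
  refine integral_congr_ae (Filter.Eventually.of_forall fun x => ?_)
  have : frameProj W (r⁻¹ • x) = r⁻¹ • frameProj W x := by
    simp only [frameProj_eq, map_smul]
  simp only [this, inner_smul_right, inner_hermiteProd_eq_inner_tensorPower hA]

/-- The Hermite tensors of variance `1 / v`, as densities with respect to the standard Gaussian
law. -/
noncomputable def heatTensor {s : ℕ} (k : ℕ) (v : ℝ) (t : EuclideanSpace ℝ (Fin s)) :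
    Tensor s k :=
  (√v ^ s * Real.exp (-((v - 1) / 2 * ‖t‖ ^ 2))) • hermiteProd k v t

lemma continuous_hermiteScaled_uncurry (n : ℕ) :
    Continuous fun p : ℝ × ℝ => hermiteScaled n p.1 p.2 := by
  induction n using Nat.twoStepInduction with
  | zero => simp only [hermiteScaled]; fun_prop
  | one => simp only [hermiteScaled]; fun_prop
  | more n h1 h2 => simp only [hermiteScaled]; fun_prop

lemma continuous_heatTensor (s k : ℕ) :
    Continuous fun p : ℝ × EuclideanSpace ℝ (Fin s) => heatTensor k p.1 p.2 := by
  unfold heatTensor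
  have h : Continuous fun p : ℝ × EuclideanSpace ℝ (Fin s) =>
      √p.1 ^ s * Real.exp (-((p.1 - 1) / 2 * ‖p.2‖ ^ 2)) := by fun_prop
  refine h.smul ?_
  refine (PiLp.continuous_toLp 2 _).comp
    (continuous_pi fun i => continuous_finsetProd _ fun j _ => ?_)
  exact (continuous_hermiteScaled_uncurry _).comp
    (continuous_fst.prodMk ((PiLp.continuous_apply 2 _ j).comp continuous_snd))

lemma exists_norm_heatTensor_le (s k : ℕ) :
    ∃ K : ℝ, 1 ≤ K ∧ ∀ (v : ℝ) (t : EuclideanSpace ℝ (Fin s)), 1 ≤ v →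
      ‖heatTensor k v t‖ ≤ K * v ^ (s + k) * (1 + ‖t‖) ^ k := by
  obtain ⟨K, hK1, hK⟩ := exists_norm_hermiteProd_le s k
  refine ⟨K, hK1, fun v t hv => ?_⟩
  have hv0 : 0 ≤ v := zero_le_one.trans hv
  have h1 : √v ^ s ≤ v ^ s := by
    gcongr
    exact Real.sqrt_le_iff.mpr ⟨hv0, by nlinarith⟩
  have h2 : Real.exp (-((v - 1) / 2 * ‖t‖ ^ 2)) ≤ 1 := by
    refine Real.exp_le_one_iff.mpr (neg_nonpos.mpr (mul_nonneg ?_ (by positivity)))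
    linarith
  rw [heatTensor, norm_smul, Real.norm_eq_abs, abs_of_nonneg (by positivity)]
  calc √v ^ s * Real.exp (-((v - 1) / 2 * ‖t‖ ^ 2)) * ‖hermiteProd k v t‖
      ≤ v ^ s * 1 * (K * v ^ k * (1 + ‖t‖) ^ k) := by
        gcongr
        exact hK v t hv
    _ = _ := by rw [pow_add]; ring

lemma integrable_smul_heatTensor {s k : ℕ} {v : ℝ} (hv : 1 ≤ v)
    {q : EuclideanSpace ℝ (Fin s) → ℝ} (hq : Measurable q) {M : ℝ} (hM : ∀ t, |q t| ≤ M) :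
    Integrable (fun t => q t • heatTensor k v t) (stdGaussian (EuclideanSpace ℝ (Fin s))) := by
  obtain ⟨K, -, hK⟩ := exists_norm_heatTensor_le s k
  have hc : Continuous fun t : EuclideanSpace ℝ (Fin s) => heatTensor k v t :=
    (continuous_heatTensor s k).comp (by fun_prop : Continuous fun t => (v, t))
  exact (integrable_of_norm_le_pow hc.aestronglyMeasurable fun t => hK v t hv).bdd_smul M
    hq.aestronglyMeasurable (Filter.Eventually.of_forall hM)

/-- The dilation is moved from the test function to the Hermite tensor, so that q no longer depends
on r and the mixture can be taken inside the integral. -/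
lemma integral_comp_smul_smul_hermiteProd {s ℓ : ℕ} {r : ℝ} (hr : 0 < r)
    (q : EuclideanSpace ℝ (Fin s) → ℝ) :
    ∫ u, q (r⁻¹ • u) • hermiteProd ℓ 1 u ∂(stdGaussian (EuclideanSpace ℝ (Fin s))) =
      (r ^ ℓ)⁻¹ • ∫ t, q t • heatTensor ℓ (r ^ 2) t ∂(stdGaussian (EuclideanSpace ℝ (Fin s))) := by
  have h := integral_exp_smul_comp_smul hr
    fun u : EuclideanSpace ℝ (Fin s) => q (r⁻¹ • u) • hermiteProd ℓ 1 u
  rw [eq_inv_smul_iff₀ (by positivity)] at h ⊢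
  rw [← h, ← integral_smul, ← integral_smul]
  refine integral_congr_ae (Filter.Eventually.of_forall fun t => ?_)
  simp only [heatTensor, hermiteProd_sq, smul_smul, inv_mul_cancel₀ hr.ne', one_smul,
    Real.sqrt_sq hr.le]
  congr 1
  ring

/-- The mixture of heat tensors which is proportional to the conditional mean of a harmonic
tensor. -/
noncomputable def mixTensor {s : ℕ} (d ℓ : ℕ) (t : EuclideanSpace ℝ (Fin s)) : Tensor s ℓ :=
  ∫ u in Set.Ioi (0 : ℝ), betaWeight ((ℓ : ℝ) / 2) ((d : ℝ) / 2 + ℓ) u • heatTensor ℓ (1 + 2 * u) t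

lemma betaWeight_mul_pow {a b t : ℝ} (ht : 0 < t) (n : ℕ) :
    betaWeight a b t * (1 + 2 * t) ^ n = betaWeight a (b - n) t := by
  unfold betaWeight
  rw [mul_assoc, ← Real.rpow_natCast, ← Real.rpow_add (by positivity)]
  congr 2
  ring

lemma measurable_betaWeight_smul_heatTensor (s k : ℕ) (a b : ℝ) :
    Measurable fun p : ℝ × EuclideanSpace ℝ (Fin s) =>
      betaWeight a b p.1 • heatTensor k (1 + 2 * p.1) p.2 := by
  refine ((measurable_betaWeight a b).comp measurable_fst).smul ?_
  exact ((continuous_heatTensor s k).comp (by fun_prop :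
    Continuous fun p : ℝ × EuclideanSpace ℝ (Fin s) => (1 + 2 * p.1, p.2))).measurable

lemma norm_betaWeight_smul_heatTensor_le {s ℓ : ℕ} {K : ℝ} (hK : ∀ (v : ℝ)
    (t : EuclideanSpace ℝ (Fin s)), 1 ≤ v → ‖heatTensor ℓ v t‖ ≤ K * v ^ (s + ℓ) * (1 + ‖t‖) ^ ℓ)
    (a b : ℝ) {u : ℝ} (hu : 0 < u) (t : EuclideanSpace ℝ (Fin s)) :
    ‖betaWeight a b u • heatTensor ℓ (1 + 2 * u) t‖ ≤
      betaWeight a (b - (s + ℓ : ℕ)) u * (K * (1 + ‖t‖) ^ ℓ) := by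
  rw [norm_smul, Real.norm_eq_abs, abs_of_nonneg (betaWeight_nonneg hu), ← betaWeight_mul_pow hu]
  have := mul_le_mul_of_nonneg_left (hK (1 + 2 * u) t (by linarith)) (betaWeight_nonneg hu (a := a)
    (b := b))
  refine this.trans (le_of_eq ?_)
  ring

lemma integrableOn_betaWeight_smul_heatTensor {s ℓ : ℕ} {a b : ℝ} (ha : 0 < a)
    (hab : a < b - (s + ℓ : ℕ)) (t : EuclideanSpace ℝ (Fin s)) :
    IntegrableOn (fun u => betaWeight a b u • heatTensor ℓ (1 + 2 * u) t) (Set.Ioi 0) := by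
  obtain ⟨K, -, hK⟩ := exists_norm_heatTensor_le s ℓ
  refine Integrable.mono' ((integrableOn_betaWeight ha hab).mul_const (K * (1 + ‖t‖) ^ ℓ))
    ((measurable_betaWeight_smul_heatTensor s ℓ a b).comp
      (by fun_prop : Measurable fun u : ℝ => (u, t))).aestronglyMeasurable ?_
  exact (ae_restrict_iff' measurableSet_Ioi).mpr (Filter.Eventually.of_forall fun u hu =>
    norm_betaWeight_smul_heatTensor_le hK a b hu t)

lemma measurable_mixTensor {s : ℕ} (d ℓ : ℕ) : Measurable (mixTensor (s := s) d ℓ) := by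
  have h := (measurable_betaWeight_smul_heatTensor s ℓ ((ℓ : ℝ) / 2)
    ((d : ℝ) / 2 + ℓ)).stronglyMeasurable
  exact (h.integral_prod_left' (μ := volume.restrict (Set.Ioi (0 : ℝ)))).measurable

/-- The bound on heat tensors grows like v^{s+ℓ}, which lowers the exponent d/2 + ℓ of the weight to
d/2 - s. The weight stays integrable as long as this exceeds ℓ/2, that is 2s + ℓ < d. -/
lemma exists_norm_mixTensor_le {s d ℓ : ℕ} (hℓ : 1 ≤ ℓ) (hd : 2 * s + ℓ < d) :
    ∃ K : ℝ, ∀ t : EuclideanSpace ℝ (Fin s), ‖mixTensor d ℓ t‖ ≤ K * (1 + ‖t‖) ^ ℓ := by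
  obtain ⟨K, -, hK⟩ := exists_norm_heatTensor_le s ℓ
  have hℓ' : (0 : ℝ) < ℓ := by exact_mod_cast hℓ
  have hd' : 2 * (s : ℝ) + ℓ < d := by exact_mod_cast hd
  refine ⟨(∫ u in Set.Ioi (0 : ℝ), betaWeight ((ℓ : ℝ) / 2)
    ((d : ℝ) / 2 + ℓ - (s + ℓ : ℕ)) u) * K, fun t => ?_⟩
  have h := norm_integral_le_of_norm_le (μ := volume.restrict (Set.Ioi (0 : ℝ)))
    ((integrableOn_betaWeight (a := (ℓ : ℝ) / 2) (b := (d : ℝ) / 2 + ℓ - (s + ℓ : ℕ))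
      (by positivity)
      (by push_cast; linarith)).mul_const (K * (1 + ‖t‖) ^ ℓ))
    ((ae_restrict_iff' measurableSet_Ioi).mpr (Filter.Eventually.of_forall fun u hu =>
      norm_betaWeight_smul_heatTensor_le hK ((ℓ : ℝ) / 2) ((d : ℝ) / 2 + ℓ) hu t))
  rw [integral_mul_const] at h
  rw [mul_assoc]
  exact h

lemma integrable_mixTensor {s d ℓ : ℕ} (hℓ : 1 ≤ ℓ) (hd : 2 * s + ℓ < d) :
    Integrable (mixTensor (s := s) d ℓ) (stdGaussian (EuclideanSpace ℝ (Fin s))) := by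
  obtain ⟨K, hK⟩ := exists_norm_mixTensor_le hℓ hd
  exact integrable_of_norm_le_pow (measurable_mixTensor d ℓ).aestronglyMeasurable hK

lemma integrable_prod_betaWeight_smul_heatTensor {s d ℓ : ℕ} (hℓ : 1 ≤ ℓ) (hd : 2 * s + ℓ < d)
    {q : EuclideanSpace ℝ (Fin s) → ℝ} (hq : Measurable q) {M : ℝ} (hM : ∀ t, |q t| ≤ M) :
    Integrable (fun p : ℝ × EuclideanSpace ℝ (Fin s) => q p.2 •
      (betaWeight ((ℓ : ℝ) / 2) ((d : ℝ) / 2 + ℓ) p.1 • heatTensor ℓ (1 + 2 * p.1) p.2))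
      ((volume.restrict (Set.Ioi (0 : ℝ))).prod (stdGaussian (EuclideanSpace ℝ (Fin s)))) := by
  obtain ⟨K, hK1, hK⟩ := exists_norm_heatTensor_le s ℓ
  have hℓ' : (0 : ℝ) < ℓ := by exact_mod_cast hℓ
  have hd' : 2 * (s : ℝ) + ℓ < d := by exact_mod_cast hd
  have hmeas : Measurable fun p : ℝ × EuclideanSpace ℝ (Fin s) => q p.2 •
      (betaWeight ((ℓ : ℝ) / 2) ((d : ℝ) / 2 + ℓ) p.1 • heatTensor ℓ (1 + 2 * p.1) p.2) :=
    (hq.comp measurable_snd).smul (measurable_betaWeight_smul_heatTensor s ℓ _ _)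
  have hprod := ((integrableOn_betaWeight (a := (ℓ : ℝ) / 2)
    (b := (d : ℝ) / 2 + ℓ - (s + ℓ : ℕ)) (by positivity)
    (by push_cast; linarith))).mul_prod ((integrable_one_add_norm_pow s ℓ).const_mul (M * K))
  refine hprod.mono' hmeas.aestronglyMeasurable ?_
  have hae : ∀ᵐ p ∂((volume.restrict (Set.Ioi (0 : ℝ))).prod
      (stdGaussian (EuclideanSpace ℝ (Fin s)))), p.1 ∈ Set.Ioi (0 : ℝ) :=
    Measure.quasiMeasurePreserving_fst.ae (ae_restrict_mem measurableSet_Ioi)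
  filter_upwards [hae] with p hp
  have h1 := norm_betaWeight_smul_heatTensor_le hK ((ℓ : ℝ) / 2) ((d : ℝ) / 2 + ℓ) hp p.2
  rw [norm_smul]
  calc _ ≤ M * (betaWeight ((ℓ : ℝ) / 2) ((d : ℝ) / 2 + ℓ - (s + ℓ : ℕ)) p.1 *
        (K * (1 + ‖p.2‖) ^ ℓ)) := by
        refine mul_le_mul (hM _) h1 (norm_nonneg _) ((abs_nonneg _).trans (hM 0))
    _ = _ := by ring

lemma integral_smul_mixTensor {s d ℓ : ℕ} (hℓ : 1 ≤ ℓ) (hd : 2 * s + ℓ < d)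
    {q : EuclideanSpace ℝ (Fin s) → ℝ} (hq : Measurable q) {M : ℝ} (hM : ∀ t, |q t| ≤ M) :
    IntegrableOn (fun u => betaWeight ((ℓ : ℝ) / 2) ((d : ℝ) / 2 + ℓ) u •
      ∫ t, q t • heatTensor ℓ (1 + 2 * u) t ∂(stdGaussian (EuclideanSpace ℝ (Fin s))))
      (Set.Ioi (0 : ℝ)) ∧
    ∫ t, q t • mixTensor d ℓ t ∂(stdGaussian (EuclideanSpace ℝ (Fin s))) =
    ∫ u in Set.Ioi (0 : ℝ), betaWeight ((ℓ : ℝ) / 2) ((d : ℝ) / 2 + ℓ) u •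
      ∫ t, q t • heatTensor ℓ (1 + 2 * u) t ∂(stdGaussian (EuclideanSpace ℝ (Fin s))) := by
  have hint := integrable_prod_betaWeight_smul_heatTensor hℓ hd hq hM
  have e : ∀ u, betaWeight ((ℓ : ℝ) / 2) ((d : ℝ) / 2 + ℓ) u •
      ∫ t, q t • heatTensor ℓ (1 + 2 * u) t ∂(stdGaussian (EuclideanSpace ℝ (Fin s))) =
      ∫ t, q t • (betaWeight ((ℓ : ℝ) / 2) ((d : ℝ) / 2 + ℓ) u • heatTensor ℓ (1 + 2 * u) t)
        ∂(stdGaussian (EuclideanSpace ℝ (Fin s))) := fun u => by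
    rw [← integral_smul]
    exact integral_congr_ae (Filter.Eventually.of_forall fun t => smul_comm _ _ _)
  simp_rw [e]
  refine ⟨hint.integral_prod_left, ?_⟩
  simp_rw [mixTensor, ← integral_smul]
  exact (integral_integral_swap (f := fun u t => q t •
      (betaWeight ((ℓ : ℝ) / 2) ((d : ℝ) / 2 + ℓ) u • heatTensor ℓ (1 + 2 * u) t)) hint).symm

lemma integral_comp_frameProj_mul_inner_direction_eq_mixTensor {d s ℓ : ℕ}
    {W : Matrix (Fin d) (Fin s) ℝ} (hW : W ∈ Stiefel d s) (hℓ : 1 ≤ ℓ) (hd : 2 * s + ℓ < d)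
    {A : Tensor d ℓ} (hA : A ∈ tracelessSym d ℓ)
    {q : EuclideanSpace ℝ (Fin s) → ℝ} (hq : Measurable q) {M : ℝ} (hM : ∀ t, |q t| ≤ M) :
    ∫ x, q (frameProj W x) * inner ℝ A (tensorPower ℓ (‖x‖⁻¹ • x))
      ∂(stdGaussian (EuclideanSpace ℝ (Fin d))) =
    (Real.Gamma ((ℓ : ℝ) / 2))⁻¹ * inner ℝ A (frameTensor W ℓ
      (∫ t, q t • mixTensor d ℓ t ∂(stdGaussian (EuclideanSpace ℝ (Fin s))))) := by
  obtain ⟨hint, heq⟩ := integral_smul_mixTensor hℓ hd hq hM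
  rw [integral_comp_frameProj_mul_inner_direction hW hℓ hA hq hM, heq, inner_frameTensor_right,
    ← integral_inner hint]
  congr 1
  refine setIntegral_congr_fun measurableSet_Ioi fun u hu => ?_
  have hu' : (0 : ℝ) < u := hu
  have hr : 0 < √(1 + 2 * u) := Real.sqrt_pos.mpr (by positivity)
  simp only
  rw [integral_comp_smul_smul_hermiteProd hr, Real.sq_sqrt (by positivity), map_smul,
    inner_smul_right, inner_smul_right, inner_frameTensor_right, ← mul_assoc, ← mul_assoc]
  congr 1
  -- The exponent d/2 + ℓ of the weight collects (d + ℓ)/2 from the mixture over directions and ℓ/2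
  -- from the rescaling in dimension s.
  rw [sqrt_pow_inv (by positivity), sqrt_pow_inv (by positivity), betaWeight, mul_assoc,
    ← Real.rpow_add (by positivity)]
  congr 2
  push_cast
  ring

/-! ### Means of harmonic tensors of the direction -/

lemma norm_direction_le_one {d : ℕ} (x : EuclideanSpace ℝ (Fin d)) : ‖‖x‖⁻¹ • x‖ ≤ 1 := by
  rw [norm_smul, norm_inv, norm_norm]
  exact inv_mul_le_one

lemma measurable_harmonicTensor (d ℓ : ℕ) : Measurable (harmonicTensor d ℓ) := by
  have h : Continuous (harmonicTensor d ℓ) :=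
    ((projTF d ℓ).continuous.comp (continuous_tensorPower ℓ)).const_smul
      (kappa d ℓ * √(harmonicDim d ℓ))
  exact h.measurable

lemma norm_harmonicTensor_direction_le {d ℓ : ℕ} (x : EuclideanSpace ℝ (Fin d)) :
    ‖harmonicTensor d ℓ (‖x‖⁻¹ • x)‖ ≤ |kappa d ℓ * √(harmonicDim d ℓ)| := by
  rw [harmonicTensor, norm_smul, Real.norm_eq_abs]
  refine mul_le_of_le_one_right (abs_nonneg _) ((norm_projTF_le _).trans ?_)
  rw [norm_tensorPower]
  exact pow_le_one₀ (norm_nonneg _) (norm_direction_le_one x)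

lemma integrable_harmonicTensor_direction {d ℓ : ℕ} {μ : Measure (EuclideanSpace ℝ (Fin d))}
    [IsFiniteMeasure μ] :
    Integrable (fun x => harmonicTensor d ℓ (‖x‖⁻¹ • x)) μ :=
  Integrable.of_bound ((measurable_harmonicTensor d ℓ).comp (by fun_prop)).aestronglyMeasurable _
    (Filter.Eventually.of_forall norm_harmonicTensor_direction_le)

lemma inner_harmonicTensor {d ℓ : ℕ} (A : Tensor d ℓ) (z : EuclideanSpace ℝ (Fin d)) :
    inner ℝ A (harmonicTensor d ℓ z) =
      kappa d ℓ * √(harmonicDim d ℓ) * inner ℝ (projTF d ℓ A) (tensorPower ℓ z) := by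
  rw [harmonicTensor, inner_smul_right, inner_projTF_left]

lemma inner_integral_smul_harmonicTensor {d s ℓ : ℕ} {W : Matrix (Fin d) (Fin s) ℝ}
    {q : EuclideanSpace ℝ (Fin s) → ℝ} (hq : Measurable q) {M : ℝ} (hM : ∀ t, |q t| ≤ M)
    (A : Tensor d ℓ) :
    inner ℝ A (∫ x, q (frameProj W x) • harmonicTensor d ℓ (‖x‖⁻¹ • x)
      ∂(stdGaussian (EuclideanSpace ℝ (Fin d)))) = kappa d ℓ * √(harmonicDim d ℓ) *
      ∫ x, q (frameProj W x) * inner ℝ (projTF d ℓ A) (tensorPower ℓ (‖x‖⁻¹ • x))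
        ∂(stdGaussian (EuclideanSpace ℝ (Fin d))) := by
  have hint : Integrable (fun x => q (frameProj W x) • harmonicTensor d ℓ (‖x‖⁻¹ • x))
      (stdGaussian (EuclideanSpace ℝ (Fin d))) :=
    integrable_harmonicTensor_direction.bdd_smul M
      (hq.comp (measurable_frameProj W)).aestronglyMeasurable
      (Filter.Eventually.of_forall fun _ => hM _)
  rw [← integral_inner hint, ← integral_const_mul]
  refine integral_congr_ae (Filter.Eventually.of_forall fun x => ?_)
  simp only [inner_smul_right, inner_harmonicTensor]
  ring

lemma integral_smul_harmonicTensor {d s ℓ : ℕ} {W : Matrix (Fin d) (Fin s) ℝ}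
    (hW : W ∈ Stiefel d s) (hℓ : 1 ≤ ℓ) (hd : 2 * s + ℓ < d)
    {q : EuclideanSpace ℝ (Fin s) → ℝ} (hq : Measurable q) {M : ℝ} (hM : ∀ t, |q t| ≤ M) :
    ∫ x, q (frameProj W x) • harmonicTensor d ℓ (‖x‖⁻¹ • x)
      ∂(stdGaussian (EuclideanSpace ℝ (Fin d))) =
    (kappa d ℓ * √(harmonicDim d ℓ) * (Real.Gamma ((ℓ : ℝ) / 2))⁻¹) •
      projTF d ℓ (frameTensor W ℓ
        (∫ t, q t • mixTensor d ℓ t ∂(stdGaussian (EuclideanSpace ℝ (Fin s))))) := by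
  refine ext_inner_left ℝ fun A => ?_
  rw [inner_integral_smul_harmonicTensor hq hM,
    integral_comp_frameProj_mul_inner_direction_eq_mixTensor hW hℓ hd (projTF_mem d ℓ A) hq hM,
    inner_smul_right, inner_projTF_left]
  ring

/-- The range of the traceless part of framed tensors. -/
noncomputable def frameRange {d s : ℕ} (W : Matrix (Fin d) (Fin s) ℝ) (ℓ : ℕ) :
    Submodule ℝ (Tensor d ℓ) :=
  LinearMap.range ((projTF d ℓ).toLinearMap ∘ₗ frameTensor W ℓ)

lemma finrank_frameRange_le {d s : ℕ} (W : Matrix (Fin d) (Fin s) ℝ) (ℓ : ℕ) :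
    Module.finrank ℝ (frameRange W ℓ) ≤ s ^ ℓ := by
  refine (LinearMap.finrank_range_le _).trans (le_of_eq ?_)
  simp

lemma frameRange_le_tracelessSym {d s : ℕ} (W : Matrix (Fin d) (Fin s) ℝ) (ℓ : ℕ) :
    frameRange W ℓ ≤ tracelessSym d ℓ := by
  rintro _ ⟨B, rfl⟩
  exact projTF_mem d ℓ _

/-- A tensor A orthogonal to the range satisfies (Wᵀ)^{⊗ℓ} P_tf A = 0, which kills the Gaussian
mixture at each t. The argument avoids `mixTensor`, hence any lower bound on d in terms of ℓ. -/
lemma integral_smul_harmonicTensor_mem_frameRange {d s ℓ : ℕ} {W : Matrix (Fin d) (Fin s) ℝ}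
    (hW : W ∈ Stiefel d s) (hℓ : 1 ≤ ℓ)
    {q : EuclideanSpace ℝ (Fin s) → ℝ} (hq : Measurable q) {M : ℝ} (hM : ∀ t, |q t| ≤ M) :
    ∫ x, q (frameProj W x) • harmonicTensor d ℓ (‖x‖⁻¹ • x)
      ∂(stdGaussian (EuclideanSpace ℝ (Fin d))) ∈ frameRange W ℓ := by
  rw [← Submodule.orthogonal_orthogonal (frameRange W ℓ), Submodule.mem_orthogonal]
  intro A hA
  rw [inner_integral_smul_harmonicTensor hq hM]
  have h0 : frameTensor W.transpose ℓ (projTF d ℓ A) = 0 := by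
    refine ext_inner_right ℝ fun B => ?_
    rw [← inner_frameTensor_right, inner_projTF_left, inner_zero_left, real_inner_comm]
    exact hA _ ⟨B, rfl⟩
  rw [integral_comp_frameProj_mul_inner_direction hW hℓ (projTF_mem d ℓ A) hq hM]
  simp only [inner_frameTensor_right, h0, inner_zero_left, mul_zero, integral_zero]

/-! ### Conditional means under joint laws -/

section Conditioning

variable {Y E E' F : Type*} [MeasurableSpace Y] [MeasurableSpace E] [StandardBorelSpace E]
  [Nonempty E] [MeasurableSpace E'] [StandardBorelSpace E'] [Nonempty E'] [NormedAddCommGroup F]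
  [NormedSpace ℝ F] [CompleteSpace F]

/-- Conditional means are determined by their integrals over label events, so laws on different
spaces can be compared once their label marginals agree. -/
lemma condMean_ae_eq {μ : Measure (Y × E)} {μ' : Measure (Y × E')} [IsFiniteMeasure μ]
    [IsFiniteMeasure μ'] (hfst : μ.fst = μ'.fst) {f : E → F} {f' : E' → F}
    (hf : Integrable (fun p => f p.2) μ) (hf' : Integrable (fun p => f' p.2) μ')
    (h : ∀ S, MeasurableSet S →
      ∫ p in S ×ˢ Set.univ, f p.2 ∂μ = ∫ p in S ×ˢ Set.univ, f' p.2 ∂μ') :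
    (fun y => ∫ x, f x ∂μ.condKernel y) =ᵐ[μ.fst] fun y => ∫ x, f' x ∂μ'.condKernel y := by
  refine Integrable.ae_eq_of_forall_setIntegral_eq _ _ hf.integral_condKernel ?_ fun S hS _ => ?_
  · rw [hfst]
    exact hf'.integral_condKernel
  · rw [Measure.setIntegral_condKernel_univ_right (f := fun p => f p.2) hS hf.integrableOn, h S hS,
      hfst, Measure.setIntegral_condKernel_univ_right (f := fun p => f' p.2) hS hf'.integrableOn]

lemma convexOn_norm_sq : ConvexOn ℝ Set.univ fun x : F => ‖x‖ ^ 2 :=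
  (convexOn_norm convex_univ).pow (fun _ _ => norm_nonneg _) 2

/-- Jensen's inequality for the squared norm under almost every conditional law. -/
lemma norm_condMean_sq_le {μ : Measure (Y × E)} [IsFiniteMeasure μ] {f : E → F}
    (hf : Integrable (fun p => f p.2) μ) (hf2 : Integrable (fun p => ‖f p.2‖ ^ 2) μ) :
    ∀ᵐ y ∂μ.fst, ‖∫ x, f x ∂μ.condKernel y‖ ^ 2 ≤ ∫ x, ‖f x‖ ^ 2 ∂μ.condKernel y := by
  filter_upwards [hf.condKernel_ae, hf2.condKernel_ae] with y h1 h2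
  exact convexOn_norm_sq.map_integral_le (by fun_prop) isClosed_univ (by simp) h1 h2

lemma integrable_norm_condMean_sq {μ : Measure (Y × E)} [IsFiniteMeasure μ] {f : E → F}
    (hf : Integrable (fun p => f p.2) μ) (hf2 : Integrable (fun p => ‖f p.2‖ ^ 2) μ) :
    Integrable (fun y => ‖∫ x, f x ∂μ.condKernel y‖ ^ 2) μ.fst := by
  refine Integrable.mono' (g := fun y => ∫ x, ‖f x‖ ^ 2 ∂μ.condKernel y)
    hf2.integral_condKernel ?_ ?_
  · exact (hf.1.integral_condKernel).norm.pow 2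
  · filter_upwards [norm_condMean_sq_le hf hf2] with y hy
    rwa [Real.norm_eq_abs, abs_of_nonneg (by positivity)]

lemma integral_norm_condMean_sq_le {μ : Measure (Y × E)} [IsFiniteMeasure μ] {f : E → F}
    (hf : Integrable (fun p => f p.2) μ) (hf2 : Integrable (fun p => ‖f p.2‖ ^ 2) μ) :
    ∫ y, ‖∫ x, f x ∂μ.condKernel y‖ ^ 2 ∂μ.fst ≤ ∫ p, ‖f p.2‖ ^ 2 ∂μ := by
  rw [← Measure.integral_condKernel (f := fun p => ‖f p.2‖ ^ 2) hf2]
  exact integral_mono_ae (integrable_norm_condMean_sq hf hf2)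
    (Integrable.integral_condKernel (f := fun p => ‖f p.2‖ ^ 2) hf2) (norm_condMean_sq_le hf hf2)

end Conditioning

/-! ### The multi-index models -/

section Models

variable {Y : Type*} [MeasurableSpace Y] {d s : ℕ} (ρ : Kernel (EuclideanSpace ℝ (Fin s)) Y)
  [IsMarkovKernel ρ] (W : Matrix (Fin d) (Fin s) ℝ)

lemma snd_gaussianMIM : (gaussianMIM ρ W).snd = stdGaussian (EuclideanSpace ℝ (Fin d)) := by
  rw [gaussianMIM, Measure.snd_map_swap, Measure.fst_compProd]

lemma integrable_gaussianMIM {F : Type*} [NormedAddCommGroup F] {f : EuclideanSpace ℝ (Fin d) → F}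
    (hf : Integrable f (stdGaussian (EuclideanSpace ℝ (Fin d)))) :
    Integrable (fun p : Y × EuclideanSpace ℝ (Fin d) => f p.2) (gaussianMIM ρ W) := by
  rw [← snd_gaussianMIM ρ W] at hf
  exact hf.comp_measurable measurable_snd

lemma integral_gaussianMIM {F : Type*} [NormedAddCommGroup F] [NormedSpace ℝ F]
    {f : EuclideanSpace ℝ (Fin d) → F}
    (hf : AEStronglyMeasurable f (stdGaussian (EuclideanSpace ℝ (Fin d)))) :
    ∫ p, f p.2 ∂(gaussianMIM ρ W) = ∫ x, f x ∂(stdGaussian (EuclideanSpace ℝ (Fin d))) := by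
  rw [← snd_gaussianMIM ρ W] at hf ⊢
  exact (integral_map measurable_snd.aemeasurable hf).symm

/-- A label event S enters only through t ↦ ρ(t)(S), evaluated at Wᵀx and bounded by one. This is
the origin of the test functions q. -/
lemma setIntegral_gaussianMIM {F : Type*} [NormedAddCommGroup F] [NormedSpace ℝ F]
    [CompleteSpace F] {f : EuclideanSpace ℝ (Fin d) → F}
    (hf : Integrable f (stdGaussian (EuclideanSpace ℝ (Fin d)))) {S : Set Y}
    (hS : MeasurableSet S) :
    ∫ p in S ×ˢ Set.univ, f p.2 ∂(gaussianMIM ρ W) =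
      ∫ x, (ρ (frameProj W x)).real S • f x ∂(stdGaussian (EuclideanSpace ℝ (Fin d))) := by
  have hint : Integrable (fun p : EuclideanSpace ℝ (Fin d) × Y => f p.1)
      (stdGaussian (EuclideanSpace ℝ (Fin d)) ⊗ₘ
        ρ.comap (frameProj W) (measurable_frameProj W)) := by
    have h2 := hf
    rw [← Measure.fst_compProd (stdGaussian (EuclideanSpace ℝ (Fin d)))
      (ρ.comap (frameProj W) (measurable_frameProj W))] at h2
    exact h2.comp_measurable measurable_fst
  rw [gaussianMIM]
  have h := (MeasurableEquiv.prodComm (α := EuclideanSpace ℝ (Fin d))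
    (β := Y)).measurableEmbedding.setIntegral_map
    (μ := stdGaussian (EuclideanSpace ℝ (Fin d)) ⊗ₘ
        ρ.comap (frameProj W) (measurable_frameProj W)) (fun p => f p.2) (S ×ˢ Set.univ)
  refine h.trans ?_
  have e : (MeasurableEquiv.prodComm (α := EuclideanSpace ℝ (Fin d)) (β := Y)) ⁻¹'
      (S ×ˢ Set.univ) = Set.univ ×ˢ S := by
    ext p
    simp [MeasurableEquiv.prodComm]
  rw [e]
  have h3 := Measure.setIntegral_compProd MeasurableSet.univ hS
    (f := fun p : EuclideanSpace ℝ (Fin d) × Y => f p.1) hint.integrableOn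
  refine h3.trans ?_
  rw [Measure.restrict_univ]
  refine integral_congr_ae (Filter.Eventually.of_forall fun x => ?_)
  simp only [setIntegral_const]
  rfl

lemma measurable_kernel_real {S : Set Y} (hS : MeasurableSet S) :
    Measurable fun t => (ρ t).real S :=
  (ρ.measurable_coe hS).ennreal_toReal

lemma abs_kernel_real_le (S : Set Y) (t : EuclideanSpace ℝ (Fin s)) : |(ρ t).real S| ≤ 1 := by
  rw [abs_of_nonneg measureReal_nonneg]
  exact measureReal_le_one

/-- The model in dimension `s`, with the trivial frame. -/
noncomputable def baseMIM : Measure (Y × EuclideanSpace ℝ (Fin s)) :=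
  gaussianMIM ρ (1 : Matrix (Fin s) (Fin s) ℝ)

instance : IsProbabilityMeasure (baseMIM ρ) := by
  unfold baseMIM; infer_instance

/-- The conditional mean given the label, in the model of dimension `s`. -/
noncomputable def condMean {F : Type*} [NormedAddCommGroup F] [NormedSpace ℝ F]
    (f : EuclideanSpace ℝ (Fin s) → F) (y : Y) : F :=
  ∫ t, f t ∂((baseMIM ρ).condKernel y)

lemma frameProj_one (t : EuclideanSpace ℝ (Fin s)) :
    frameProj (1 : Matrix (Fin s) (Fin s) ℝ) t = t := by
  simp [frameProj]

lemma setIntegral_baseMIM {F : Type*} [NormedAddCommGroup F] [NormedSpace ℝ F]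
    [CompleteSpace F] {f : EuclideanSpace ℝ (Fin s) → F}
    (hf : Integrable f (stdGaussian (EuclideanSpace ℝ (Fin s)))) {S : Set Y}
    (hS : MeasurableSet S) :
    ∫ p in S ×ˢ Set.univ, f p.2 ∂(baseMIM ρ) =
      ∫ t, (ρ t).real S • f t ∂(stdGaussian (EuclideanSpace ℝ (Fin s))) := by
  rw [baseMIM, setIntegral_gaussianMIM ρ _ hf hS]
  simp_rw [frameProj_one]

variable {W}

lemma labelLaw_eq (hW : W ∈ Stiefel d s) : labelLaw ρ W = (baseMIM ρ).fst := by
  ext S hS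
  have h : ∀ {n : ℕ} (V : Matrix (Fin n) (Fin s) ℝ), (gaussianMIM ρ V).fst S =
      ∫⁻ x, ρ (frameProj V x) S ∂(stdGaussian (EuclideanSpace ℝ (Fin n))) := fun V => by
    rw [gaussianMIM, Measure.fst_map_swap, Measure.snd_apply hS,
      Measure.compProd_apply (measurable_snd hS)]
    rfl
  have hone : (1 : Matrix (Fin s) (Fin s) ℝ) ∈ Stiefel s s := by simp [Stiefel]
  rw [labelLaw, baseMIM, h, h, ← lintegral_map (ρ.measurable_coe hS) (measurable_frameProj W),
    ← lintegral_map (ρ.measurable_coe hS) (measurable_frameProj _), map_frameProj_stdGaussian hW,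
    map_frameProj_stdGaussian hone]

/-- Conditional means in the Gaussian model reduce to conditional means in dimension `s`. -/
lemma condMean_gaussianMIM {F : Type*} [NormedAddCommGroup F] [NormedSpace ℝ F]
    [CompleteSpace F] (hW : W ∈ Stiefel d s) {f : EuclideanSpace ℝ (Fin d) → F}
    {g : EuclideanSpace ℝ (Fin s) → F}
    (hf : Integrable f (stdGaussian (EuclideanSpace ℝ (Fin d))))
    (hg : Integrable g (stdGaussian (EuclideanSpace ℝ (Fin s))))
    (h : ∀ q : EuclideanSpace ℝ (Fin s) → ℝ, Measurable q → (∀ t, |q t| ≤ 1) →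
      ∫ x, q (frameProj W x) • f x ∂(stdGaussian (EuclideanSpace ℝ (Fin d))) =
        ∫ t, q t • g t ∂(stdGaussian (EuclideanSpace ℝ (Fin s)))) :
    (fun y => ∫ x, f x ∂((gaussianMIM ρ W).condKernel y)) =ᵐ[labelLaw ρ W] condMean ρ g := by
  refine condMean_ae_eq (labelLaw_eq ρ hW) (integrable_gaussianMIM ρ W hf)
    (integrable_gaussianMIM ρ _ hg) fun S hS => ?_
  rw [setIntegral_gaussianMIM ρ W hf hS, setIntegral_baseMIM ρ hg hS,
    h _ (measurable_kernel_real ρ hS) (abs_kernel_real_le ρ S)]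

lemma condMean_continuousLinearMap {F G : Type*} [NormedAddCommGroup F] [NormedSpace ℝ F]
    [CompleteSpace F] [NormedAddCommGroup G] [NormedSpace ℝ G] [CompleteSpace G]
    {g : EuclideanSpace ℝ (Fin s) → F}
    (hg : Integrable g (stdGaussian (EuclideanSpace ℝ (Fin s)))) (L : F →L[ℝ] G) :
    condMean ρ (fun t => L (g t)) =ᵐ[(baseMIM ρ).fst] fun y => L (condMean ρ g y) := by
  have h : ∀ᵐ y ∂(baseMIM ρ).fst, Integrable g ((baseMIM ρ).condKernel y) :=
    (integrable_gaussianMIM ρ 1 hg).condKernel_ae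
  filter_upwards [h] with y hy
  exact L.integral_comp_comm hy

lemma condMean_linearMap {k l m n : ℕ} {g : EuclideanSpace ℝ (Fin s) → Tensor m k}
    (hg : Integrable g (stdGaussian (EuclideanSpace ℝ (Fin s)))) (L : Tensor m k →ₗ[ℝ] Tensor n l) :
    condMean ρ (fun t => L (g t)) =ᵐ[(baseMIM ρ).fst] fun y => L (condMean ρ g y) :=
  condMean_continuousLinearMap ρ hg (LinearMap.toContinuousLinearMap L)

lemma hermiteCoeff_ae_eq (hW : W ∈ Stiefel d s) (k : ℕ) :
    hermiteCoeff ρ W k =ᵐ[labelLaw ρ W] fun y => (√(k.factorial : ℝ))⁻¹ •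
      frameTensor W k (condMean ρ (hermiteProd k 1) y) := by
  have h1 := condMean_gaussianMIM ρ hW (f := hermiteTensor d k)
    (g := fun t => (√(k.factorial : ℝ))⁻¹ • frameTensor W k (hermiteProd k 1 t))
    (by
      simp_rw [funext hermiteTensor_eq]
      exact (integrable_hermiteProd d k).smul ((√(k.factorial : ℝ))⁻¹))
    (((LinearMap.toContinuousLinearMap (frameTensor W k)).integrable_comp
      (integrable_hermiteProd s k)).smul ((√(k.factorial : ℝ))⁻¹)) fun q hq hM => by
      simp_rw [hermiteTensor_eq, smul_comm (q _)]
      rw [integral_smul, integral_smul, integral_comp_frameProj_smul_hermiteProd hW hq hM]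
      have := (LinearMap.toContinuousLinearMap (frameTensor W k)).integral_comp_comm
        (integrable_smul_hermiteProd (k := k) measurable_id hq hM)
      rw [LinearMap.coe_toContinuousLinearMap'] at this
      simp only [id, map_smul] at this
      rw [this]
  have h2 := condMean_linearMap ρ (integrable_hermiteProd s k)
    ((√(k.factorial : ℝ))⁻¹ • frameTensor W k)
  rw [← labelLaw_eq ρ hW] at h2
  exact h1.trans h2

lemma fst_directionalMIM : (directionalMIM ρ W).fst = labelLaw ρ W := by
  rw [directionalMIM, labelLaw, Measure.fst, Measure.map_map measurable_fst (by fun_prop)]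
  rfl

lemma integrable_directionalMIM {ℓ : ℕ} :
    Integrable (fun p : Y × EuclideanSpace ℝ (Fin d) => harmonicTensor d ℓ p.2)
      (directionalMIM ρ W) := by
  have hm : Measurable fun p : Y × EuclideanSpace ℝ (Fin d) => harmonicTensor d ℓ p.2 :=
    (measurable_harmonicTensor d ℓ).comp measurable_snd
  rw [directionalMIM, integrable_map_measure hm.aestronglyMeasurable (by fun_prop)]
  exact integrable_gaussianMIM ρ W integrable_harmonicTensor_direction

lemma harmonicCoeff_ae_eq_gaussian (ℓ : ℕ) :
    harmonicCoeff ρ W ℓ =ᵐ[labelLaw ρ W]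
      fun y => ∫ x, harmonicTensor d ℓ (‖x‖⁻¹ • x) ∂((gaussianMIM ρ W).condKernel y) := by
  have h := condMean_ae_eq (μ := directionalMIM ρ W) (μ' := gaussianMIM ρ W)
    (f := harmonicTensor d ℓ) (f' := fun x => harmonicTensor d ℓ (‖x‖⁻¹ • x))
    (fst_directionalMIM ρ) (integrable_directionalMIM ρ)
    (integrable_gaussianMIM ρ W integrable_harmonicTensor_direction) fun S hS => by
      have hm : Measurable fun p : Y × EuclideanSpace ℝ (Fin d) => harmonicTensor d ℓ p.2 :=
        (measurable_harmonicTensor d ℓ).comp measurable_snd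
      rw [directionalMIM, setIntegral_map (hS.prod MeasurableSet.univ)
        hm.aestronglyMeasurable (by fun_prop)]
      congr 2
  rw [fst_directionalMIM] at h
  exact h

lemma harmonicNormSq_eq (ℓ : ℕ) : harmonicNormSq ρ W ℓ = ∫ y, ‖∫ x, harmonicTensor d ℓ (‖x‖⁻¹ • x)
    ∂((gaussianMIM ρ W).condKernel y)‖ ^ 2 ∂(labelLaw ρ W) := by
  rw [harmonicNormSq, fst_directionalMIM]
  refine integral_congr_ae ?_
  filter_upwards [harmonicCoeff_ae_eq_gaussian ρ ℓ] with y hy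
  rw [hy]

lemma harmonicNormSq_eq_mixTensor (hW : W ∈ Stiefel d s) {ℓ : ℕ} (hℓ : 1 ≤ ℓ)
    (hd : 2 * s + ℓ < d) :
    harmonicNormSq ρ W ℓ = (kappa d ℓ * √(harmonicDim d ℓ) * (Real.Gamma ((ℓ : ℝ) / 2))⁻¹) ^ 2 *
      ∫ y, ‖projTF d ℓ (frameTensor W ℓ (condMean ρ (mixTensor d ℓ) y))‖ ^ 2 ∂(baseMIM ρ).fst := by
  set c := kappa d ℓ * √(harmonicDim d ℓ) * (Real.Gamma ((ℓ : ℝ) / 2))⁻¹ with hc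
  let L : Tensor s ℓ →L[ℝ] Tensor d ℓ :=
    c • (projTF d ℓ ∘L LinearMap.toContinuousLinearMap (frameTensor W ℓ))
  have hL : ∀ B, L B = c • projTF d ℓ (frameTensor W ℓ B) := fun B => rfl
  have h1 := condMean_gaussianMIM ρ hW (f := fun x => harmonicTensor d ℓ (‖x‖⁻¹ • x))
    (g := fun t => L (mixTensor d ℓ t)) integrable_harmonicTensor_direction
    (L.integrable_comp (integrable_mixTensor hℓ hd)) fun q hq hM => by
      have hi : Integrable (fun t => q t • mixTensor d ℓ t)
          (stdGaussian (EuclideanSpace ℝ (Fin s))) :=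
        (integrable_mixTensor hℓ hd).bdd_smul 1 hq.aestronglyMeasurable
          (Filter.Eventually.of_forall hM)
      rw [integral_smul_harmonicTensor hW hℓ hd hq hM, ← hc, ← hL, ← L.integral_comp_comm hi]
      simp_rw [map_smul]
  have h2 := condMean_continuousLinearMap ρ (integrable_mixTensor hℓ hd) L
  rw [← labelLaw_eq ρ hW] at h2 ⊢
  rw [harmonicNormSq_eq, ← integral_const_mul]
  refine integral_congr_ae ?_
  filter_upwards [h1, h2] with y hy1 hy2
  rw [hy1, hy2, hL, norm_smul, mul_pow, Real.norm_eq_abs, sq_abs]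

/-- A bound on harmonic coefficients which is uniform in the dimension. -/
lemma harmonicNormSq_le (hW : W ∈ Stiefel d s) (hd : 3 ≤ d) {ℓ : ℕ} (hℓ : 1 ≤ ℓ) :
    harmonicNormSq ρ W ℓ ≤ (s : ℝ) ^ ℓ := by
  let S := frameRange W ℓ
  let e := stdOrthonormalBasis ℝ S
  -- The conditional mean takes values in `frameRange W ℓ`, so it is unchanged by projecting the
  -- harmonic tensor onto that subspace.
  have h1 : (fun y => ∫ x, harmonicTensor d ℓ (‖x‖⁻¹ • x) ∂((gaussianMIM ρ W).condKernel y))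
      =ᵐ[labelLaw ρ W] fun y => ∫ x, S.starProjection (harmonicTensor d ℓ (‖x‖⁻¹ • x))
        ∂((gaussianMIM ρ W).condKernel y) := by
    have hi := integrable_harmonicTensor_direction (d := d) (ℓ := ℓ)
      (μ := stdGaussian (EuclideanSpace ℝ (Fin d)))
    refine condMean_ae_eq rfl (integrable_gaussianMIM ρ W hi)
      (f' := fun x => S.starProjection (harmonicTensor d ℓ (‖x‖⁻¹ • x)))
      (integrable_gaussianMIM ρ W (S.starProjection.integrable_comp hi)) fun T hT => ?_
    rw [setIntegral_gaussianMIM ρ W hi hT,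
      setIntegral_gaussianMIM ρ W (S.starProjection.integrable_comp hi) hT]
    have hq := measurable_kernel_real ρ hT
    have hM := abs_kernel_real_le ρ T
    have := S.starProjection.integral_comp_comm (hi.bdd_smul 1
      (hq.comp (measurable_frameProj W)).aestronglyMeasurable
      (Filter.Eventually.of_forall fun x => hM _))
    simp_rw [← map_smul]
    refine Eq.trans ?_ this.symm
    exact (Submodule.starProjection_eq_self_iff.mpr
      (integral_smul_harmonicTensor_mem_frameRange hW hℓ hq hM)).symm
  -- Along a unit traceless tensor, Jensen's inequality bounds the energy of the conditional mean by
  -- the unconditional second moment, which the normalization κ²N makes equal to one.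
  have h2 : ∀ a, ∫ y, ‖∫ x, inner ℝ (e a : Tensor d ℓ) (harmonicTensor d ℓ (‖x‖⁻¹ • x))
      ∂((gaussianMIM ρ W).condKernel y)‖ ^ 2 ∂(labelLaw ρ W) ≤ 1 ∧
      Integrable (fun y => ‖∫ x, inner ℝ (e a : Tensor d ℓ) (harmonicTensor d ℓ (‖x‖⁻¹ • x))
      ∂((gaussianMIM ρ W).condKernel y)‖ ^ 2) (labelLaw ρ W) := fun a => by
    have hA : (e a : Tensor d ℓ) ∈ tracelessSym d ℓ := frameRange_le_tracelessSym W ℓ (e a).2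
    have hnorm : ‖(e a : Tensor d ℓ)‖ = 1 := e.orthonormal.1 a
    have hi : Integrable (fun x => inner ℝ (e a : Tensor d ℓ) (harmonicTensor d ℓ (‖x‖⁻¹ • x)))
        (stdGaussian (EuclideanSpace ℝ (Fin d))) :=
      integrable_harmonicTensor_direction.const_inner _
    have hi2 : Integrable
        (fun x => ‖inner ℝ (e a : Tensor d ℓ) (harmonicTensor d ℓ (‖x‖⁻¹ • x))‖ ^ 2)
        (stdGaussian (EuclideanSpace ℝ (Fin d))) := by
      refine Integrable.of_bound (hi.1.norm.pow 2) (|kappa d ℓ * √(harmonicDim d ℓ)| ^ 2)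
        (Filter.Eventually.of_forall fun x => ?_)
      rw [norm_pow, norm_norm]
      gcongr
      refine (norm_inner_le_norm _ _).trans ?_
      rw [hnorm, one_mul]
      exact norm_harmonicTensor_direction_le x
    refine ⟨?_, integrable_norm_condMean_sq (integrable_gaussianMIM ρ W hi)
      (integrable_gaussianMIM ρ W hi2)⟩
    refine (integral_norm_condMean_sq_le (integrable_gaussianMIM ρ W hi)
      (integrable_gaussianMIM ρ W hi2)).trans (le_of_eq ?_)
    rw [integral_gaussianMIM ρ W hi2.1]
    have h3 := integral_inner_direction_sq (by omega : 1 ≤ d) hℓ hA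
    have h4 := kappa_sq_mul_harmonicDim hd hℓ
    have h5 : 0 < ∏ i ∈ Finset.range ℓ, ((d : ℝ) + 2 * i) := Finset.prod_pos fun i _ => by
      have : (0 : ℝ) < d := by exact_mod_cast (by omega : 0 < d)
      positivity
    simp_rw [inner_harmonicTensor, projTF_eq_self hA, Real.norm_eq_abs, sq_abs, mul_pow]
    rw [integral_const_mul, ← mul_pow]
    have h6 : (ℓ.factorial : ℝ) ≠ 0 := by positivity
    rw [hnorm, one_pow, mul_one] at h3
    apply mul_right_cancel₀ h6
    apply mul_right_cancel₀ h5.ne'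
    rw [one_mul, ← h4]
    rw [← h4] at h3
    linear_combination ((kappa d ℓ * √(harmonicDim d ℓ)) ^ 2 * (ℓ.factorial : ℝ)) * h3
  -- Parseval in `frameRange W ℓ`, whose dimension is at most s^ℓ.
  have h3 : ∀ᵐ y ∂(labelLaw ρ W), ‖∫ x, harmonicTensor d ℓ (‖x‖⁻¹ • x)
      ∂((gaussianMIM ρ W).condKernel y)‖ ^ 2 = ∑ a, ‖∫ x, inner ℝ (e a : Tensor d ℓ)
        (harmonicTensor d ℓ (‖x‖⁻¹ • x)) ∂((gaussianMIM ρ W).condKernel y)‖ ^ 2 := by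
    filter_upwards [h1] with y hy
    have hi := integrable_harmonicTensor_direction (d := d) (ℓ := ℓ)
      (μ := (gaussianMIM ρ W).condKernel y)
    rw [S.starProjection.integral_comp_comm hi] at hy
    set v := ∫ x, harmonicTensor d ℓ (‖x‖⁻¹ • x) ∂((gaussianMIM ρ W).condKernel y)
    have hv : v ∈ S := Submodule.starProjection_eq_self_iff.mp hy.symm
    have := e.sum_sq_norm_inner_right ⟨v, hv⟩
    simp_rw [integral_inner hi]
    exact this.symm
  rw [harmonicNormSq_eq, integral_congr_ae h3, integral_finsetSum _ fun a _ => (h2 a).2]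
  calc ∑ a, ∫ y, ‖∫ x, inner ℝ (e a : Tensor d ℓ) (harmonicTensor d ℓ (‖x‖⁻¹ • x))
      ∂((gaussianMIM ρ W).condKernel y)‖ ^ 2 ∂(labelLaw ρ W) ≤ ∑ a, (1 : ℝ) :=
        Finset.sum_le_sum fun a _ => (h2 a).1
    _ = (Module.finrank ℝ S : ℝ) := by simp
    _ ≤ (s : ℝ) ^ ℓ := by exact_mod_cast finrank_frameRange_le W ℓ

end Models

/-! ### The heat flow of Hermite tensors -/

/-- The identity for the derivative D of v^{n/2} h_n(√v x) in v is multiplied by v to avoid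
denominators; the induction differentiates the three-term recursion. -/
lemma exists_hasDerivAt_hermiteScaled (n : ℕ) (v x : ℝ) :
    ∃ D, HasDerivAt (fun v => hermiteScaled n v x) D v ∧
      v * D = n * hermiteScaled n v x + n * (n - 1) / 2 * v * hermiteScaled (n - 2) v x := by
  induction n using Nat.twoStepInduction with
  | zero => exact ⟨0, by simpa [hermiteScaled] using hasDerivAt_const v (1 : ℝ), by simp⟩
  | one =>
    refine ⟨x, ?_, by simp [hermiteScaled]⟩
    simpa [hermiteScaled] using (hasDerivAt_id v).mul_const x
  | more n h1 h2 =>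
    obtain ⟨D1, h1, e1⟩ := h1
    obtain ⟨D2, h2, e2⟩ := h2
    have h := (hasDerivAt_id v).mul ((h2.const_mul x).sub (h1.const_mul ((n : ℝ) + 1)))
    refine ⟨_, h, ?_⟩
    have r1 := hermiteScaled_succ (n + 1) v x
    have r2 : (n : ℝ) * hermiteScaled n v x = n * (v * (x * hermiteScaled (n - 1) v x -
        (n - 1) * hermiteScaled (n - 2) v x)) := by
      rcases n with _ | n
      · simp
      · rw [hermiteScaled_succ n]
        have : n + 1 - 2 = n - 1 := by omega
        rw [this]
        push_cast
        simp
    simp only [Nat.add_sub_cancel, id] at r1 e2 ⊢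
    have e : n + 1 - 2 = n - 1 := by omega
    rw [e] at e2
    push_cast at r1 r2 e1 e2 ⊢
    simp only [Pi.sub_apply]
    linear_combination v * x * e2 - v * (n + 1) * e1 - (n + 2) * r1 - (n + 1) / 2 * v * r2

/-- The one-dimensional heat kernel factors of the tensors `heatTensor`. -/
noncomputable def heatScaled (n : ℕ) (v x : ℝ) : ℝ :=
  √v * Real.exp (-((v - 1) / 2 * x ^ 2)) * hermiteScaled n v x

/-- `heatScaled n v` is (-1)^n times the n-th derivative of the N(0, 1/v) density, divided by the
standard density. With v = (1 - θ)⁻¹ the variance is 1 - θ, so this is the heat equation with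
decreasing variance, whence the factor -1/2. -/
lemma hasDerivAt_heatScaled (n : ℕ) {θ : ℝ} (hθ : θ < 1) (x : ℝ) :
    HasDerivAt (fun θ => heatScaled n (1 - θ)⁻¹ x) (-(1 / 2) * heatScaled (n + 2) (1 - θ)⁻¹ x)
      θ := by
  have h0 : (0 : ℝ) < 1 - θ := by linarith
  have hv : HasDerivAt (fun θ : ℝ => (1 - θ)⁻¹) ((1 - θ)⁻¹ ^ 2) θ := by
    refine ((((hasDerivAt_id θ).const_sub 1).inv) h0.ne').congr_deriv ?_
    simp [div_eq_mul_inv]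
  set v := (1 - θ)⁻¹ with hvdef
  have hv0 : 0 < v := inv_pos.mpr h0
  obtain ⟨D, hD, eD⟩ := exists_hasDerivAt_hermiteScaled n v x
  have hs : HasDerivAt (fun v => √v) (1 / (2 * √v)) v := Real.hasDerivAt_sqrt hv0.ne'
  have he : HasDerivAt (fun v : ℝ => Real.exp (-((v - 1) / 2 * x ^ 2)))
      (Real.exp (-((v - 1) / 2 * x ^ 2)) * (-(1 / 2 * x ^ 2))) v := by
    have := (((((hasDerivAt_id v).sub_const 1).div_const 2).mul_const (x ^ 2)).neg).exp
    simpa using this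
  have h := ((hs.mul he).mul hD).comp θ hv
  refine h.congr_deriv ?_
  have hsq : √v * √v = v := Real.mul_self_sqrt hv0.le
  have hsinv : 1 / (2 * √v) = √v / (2 * v) := by
    rw [div_eq_div_iff (by positivity) (by positivity)]
    linear_combination (-2) * hsq
  have r1 := hermiteScaled_succ (n + 1) v x
  have r2 := hermiteScaled_succ n v x
  have r3 : (n : ℝ) * hermiteScaled n v x = n * (v * (x * hermiteScaled (n - 1) v x -
      (n - 1) * hermiteScaled (n - 2) v x)) := by
    rcases n with _ | n
    · simp
    · rw [hermiteScaled_succ n]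
      have : n + 1 - 2 = n - 1 := by omega
      rw [this]
      push_cast
      simp
  simp only [Nat.add_sub_cancel] at r1
  push_cast at r1
  simp only [heatScaled, Pi.mul_apply]
  rw [hsinv, r1, r2]
  set E := Real.exp (-((v - 1) / 2 * x ^ 2))
  have e1 : √v / (2 * v) * v ^ 2 = √v * v / 2 := by field_simp
  linear_combination E * hermiteScaled n v x * e1 + √v * E * v * eD + √v * E * v / 2 * r3

lemma heatTensor_apply {s k : ℕ} (v : ℝ) (t : EuclideanSpace ℝ (Fin s)) (i : Fin k → Fin s) :
    heatTensor k v t i = ∏ j, heatScaled (indexCount i j) v (t j) := by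
  simp only [heatTensor, heatScaled, PiLp.smul_apply, hermiteProd_apply, smul_eq_mul,
    Finset.prod_mul_distrib, ← Real.exp_sum, Finset.prod_const, Finset.card_univ,
    Fintype.card_fin]
  rw [EuclideanSpace.real_norm_sq_eq, Finset.mul_sum, Finset.sum_neg_distrib]

/-- The heat equation adds two derivatives in one coordinate, that is, inserts a repeated index; the
sum over coordinates is a partial trace. -/
lemma hasDerivAt_heatTensor {s : ℕ} (k : ℕ) {θ : ℝ} (hθ : θ < 1)
    (t : EuclideanSpace ℝ (Fin s)) :
    HasDerivAt (fun θ => heatTensor k (1 - θ)⁻¹ t)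
      (-(1 / 2 : ℝ) • partialTrace s k (heatTensor (k + 2) (1 - θ)⁻¹ t)) θ := by
  have h : HasDerivAt (fun θ => fun i : Fin k → Fin s => heatTensor k (1 - θ)⁻¹ t i)
      (fun i => (-(1 / 2 : ℝ) • partialTrace s k (heatTensor (k + 2) (1 - θ)⁻¹ t)) i) θ := by
    rw [hasDerivAt_pi]
    intro i
    simp_rw [heatTensor_apply]
    refine (HasDerivAt.fun_finsetProd (u := Finset.univ) fun j _ =>
      hasDerivAt_heatScaled (indexCount i j) hθ (t j)).congr_deriv ?_
    simp only [partialTrace, PiLp.smul_apply, LinearMap.coe_mk, AddHom.coe_mk, heatTensor_apply,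
      indexCount_cons, smul_eq_mul, Finset.mul_sum]
    refine Finset.sum_congr rfl fun m _ => ?_
    rw [← Finset.mul_prod_erase Finset.univ _ (Finset.mem_univ m)]
    have e : ∀ j ∈ Finset.univ.erase m, heatScaled ((if m = j then 1 else 0) +
        ((if m = j then 1 else 0) + indexCount i j)) (1 - θ)⁻¹ (t j) =
        heatScaled (indexCount i j) (1 - θ)⁻¹ (t j) := fun j hj => by
      rw [if_neg (Finset.ne_of_mem_erase hj).symm, zero_add, zero_add]
    rw [Finset.prod_congr rfl e, if_pos rfl, show 1 + (1 + indexCount i m) = indexCount i m + 2 by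
      ring]
    ring
  exact ((PiLp.continuousLinearEquiv 2 ℝ (fun _ : Fin k → Fin s => ℝ)).symm.toContinuousLinearMap
    |>.hasFDerivAt.comp_hasDerivAt θ h)

lemma heatTensor_one {s : ℕ} (k : ℕ) (t : EuclideanSpace ℝ (Fin s)) :
    heatTensor k 1 t = hermiteProd k 1 t := by
  simp [heatTensor]

/-! ### Taylor expansion -/

/-- `F j` plays the role of the j-th derivative. The induction bounds the derivative of the
remainder by applying the statement to the shifted family, then compares the remainder with the
primitive of that bound. -/
lemma norm_sub_taylor_le {E : Type*} [NormedAddCommGroup E] [NormedSpace ℝ E] {θ M : ℝ}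
    (n : ℕ) (F : ℕ → ℝ → E)
    (hF : ∀ j, ∀ σ ∈ Set.Icc 0 θ, HasDerivAt (F j) (F (j + 1) σ) σ)
    (hM : ∀ σ ∈ Set.Icc 0 θ, ‖F n σ‖ ≤ M) {σ : ℝ} (hσ : σ ∈ Set.Icc 0 θ) :
    ‖F 0 σ - ∑ j ∈ Finset.range n, (σ ^ j / j.factorial) • F j 0‖ ≤ M * (σ ^ n / n.factorial) := by
  induction n generalizing F σ with
  | zero => simpa using hM σ hσ
  | succ n ih =>
    have hpow : ∀ (j : ℕ) (σ : ℝ), HasDerivAt (fun σ : ℝ => σ ^ (j + 1) / ((j + 1).factorial : ℝ))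
        (σ ^ j / (j.factorial : ℝ)) σ := fun j σ => by
      refine ((hasDerivAt_pow (j + 1) σ).div_const _).congr_deriv ?_
      rw [Nat.factorial_succ]
      have : (j.factorial : ℝ) ≠ 0 := by positivity
      push_cast
      field_simp
    have hG : ∀ σ ∈ Set.Icc 0 θ, HasDerivAt
        (fun σ => F 0 σ - ∑ j ∈ Finset.range (n + 1), (σ ^ j / j.factorial) • F j 0)
        (F 1 σ - ∑ j ∈ Finset.range n, (σ ^ j / j.factorial) • F (j + 1) 0) σ := fun σ hσ => by
      simp_rw [Finset.sum_range_succ']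
      refine (hF 0 σ hσ).sub ?_
      have := (HasDerivAt.fun_sum (u := Finset.range n) fun j _ =>
        (hpow j σ).smul_const (F (j + 1) 0)).add_const
          ((σ ^ 0 / (Nat.factorial 0 : ℝ)) • F 0 0)
      simpa using this
    refine image_norm_le_of_norm_deriv_right_le_deriv_boundary (a := 0) (b := θ)
      (f := fun σ => F 0 σ - ∑ j ∈ Finset.range (n + 1), (σ ^ j / j.factorial) • F j 0)
      (f' := fun σ => F 1 σ - ∑ j ∈ Finset.range n, (σ ^ j / j.factorial) • F (j + 1) 0)
      (B := fun σ => M * (σ ^ (n + 1) / ((n + 1).factorial : ℝ)))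
      (B' := fun σ => M * (σ ^ n / (n.factorial : ℝ)))
      (fun σ hσ => (hG σ hσ).continuousAt.continuousWithinAt)
      (fun σ hσ => (hG σ (Set.Ico_subset_Icc_self hσ)).hasDerivWithinAt) ?_
      (fun σ => (hpow n σ).const_mul M) (fun σ hσ => ?_) hσ
    · simp [Finset.sum_range_succ']
    · exact ih (fun j => F (j + 1)) (fun j => hF (j + 1)) hM (Set.Ico_subset_Icc_self hσ)

/-- The coefficients of the Taylor expansion of the heat flow. -/
noncomputable def taylorTensor {s : ℕ} (ℓ j : ℕ) (t : EuclideanSpace ℝ (Fin s)) : Tensor s ℓ :=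
  ((-(1 / 2 : ℝ)) ^ j / j.factorial) • iterTrace s ℓ j (hermiteProd (ℓ + 2 * j) 1 t)

/-- Taylor's formula in θ = 1 - v⁻¹. For σ in [0, θ] the parameter (1 - σ)⁻¹ stays between 1 and v,
so the growth bound on heat tensors of order ℓ + 2n controls the n-th derivative. -/
lemma exists_norm_heatTensor_sub_taylor_le (s ℓ n : ℕ) :
    ∃ K : ℝ, 0 ≤ K ∧ ∃ q : ℕ, ∀ (v : ℝ) (t : EuclideanSpace ℝ (Fin s)), 1 ≤ v →
      ‖heatTensor ℓ v t - ∑ j ∈ Finset.range n, (1 - v⁻¹) ^ j • taylorTensor ℓ j t‖ ≤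
        K * v ^ q * (1 - v⁻¹) ^ n * (1 + ‖t‖) ^ q := by
  obtain ⟨K, hK1, hK⟩ := exists_norm_heatTensor_le s (ℓ + 2 * n)
  let L : Tensor s (ℓ + 2 * n) →L[ℝ] Tensor s ℓ := LinearMap.toContinuousLinearMap
    (((-(1 / 2 : ℝ)) ^ n) • iterTrace s ℓ n)
  refine ⟨‖L‖ * K, by positivity, s + (ℓ + 2 * n), fun v t hv => ?_⟩
  have hv0 : 0 < v := by linarith
  have hθ0 : 0 ≤ 1 - v⁻¹ := by
    have := inv_le_one_of_one_le₀ hv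
    linarith
  have hθ1 : 1 - v⁻¹ < 1 := by
    have := inv_pos.mpr hv0
    linarith
  have h := norm_sub_taylor_le (θ := 1 - v⁻¹) (M := ‖L‖ * (K * v ^ (s + (ℓ + 2 * n)) *
      (1 + ‖t‖) ^ (ℓ + 2 * n))) n
    (fun j σ => ((-(1 / 2 : ℝ)) ^ j) • iterTrace s ℓ j (heatTensor (ℓ + 2 * j) (1 - σ)⁻¹ t))
    (fun j σ hσ => by
      have h1 := hasDerivAt_heatTensor (ℓ + 2 * j) (hσ.2.trans_lt hθ1) t
      have h2 := (LinearMap.toContinuousLinearMap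
        ((-(1 / 2 : ℝ)) ^ j • iterTrace s ℓ j)).hasFDerivAt.comp_hasDerivAt σ h1
      refine h2.congr_deriv ?_
      change (-(1 / 2 : ℝ)) ^ j • iterTrace s ℓ j (-(1 / 2 : ℝ) • partialTrace s (ℓ + 2 * j)
        (heatTensor (ℓ + 2 * j + 2) (1 - σ)⁻¹ t)) = _
      rw [map_smul, pow_succ, mul_smul]
      rfl)
    (fun σ hσ => by
      have hσ1 : 0 < 1 - σ := by linarith [hσ.2]
      have hs1 : 1 ≤ (1 - σ)⁻¹ := (one_le_inv₀ hσ1).mpr (by linarith [hσ.1])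
      have hs2 : (1 - σ)⁻¹ ≤ v := by
        rw [inv_le_comm₀ hσ1 hv0]
        linarith [hσ.2]
      refine (L.le_opNorm _).trans ?_
      refine mul_le_mul_of_nonneg_left ((hK _ t hs1).trans ?_) (norm_nonneg _)
      gcongr) (σ := 1 - v⁻¹) (Set.right_mem_Icc.mpr hθ0)
  have e : (1 - (1 - v⁻¹))⁻¹ = v := by simp
  simp only [e, pow_zero, one_smul, iterTrace, LinearMap.id_coe, id, sub_zero, inv_one,
    heatTensor_one, Nat.mul_zero, Nat.add_zero] at h
  have e2 : ∑ j ∈ Finset.range n, (1 - v⁻¹) ^ j • taylorTensor ℓ j t =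
      ∑ j ∈ Finset.range n, ((1 - v⁻¹) ^ j / j.factorial) •
        (-(1 / 2 : ℝ)) ^ j • iterTrace s ℓ j (hermiteProd (ℓ + 2 * j) 1 t) := by
    refine Finset.sum_congr rfl fun j _ => ?_
    rw [taylorTensor, smul_smul, smul_smul]
    congr 1
    ring
  rw [e2]
  refine h.trans ?_
  have hf : (1 : ℝ) ≤ n.factorial := by exact_mod_cast n.factorial_pos
  have ht : 1 ≤ 1 + ‖t‖ := by linarith [norm_nonneg t]
  have h1 : (1 - v⁻¹) ^ n / (n.factorial : ℝ) ≤ (1 - v⁻¹) ^ n :=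
    div_le_self (pow_nonneg hθ0 n) hf
  have h2 : (1 + ‖t‖) ^ (ℓ + 2 * n) ≤ (1 + ‖t‖) ^ (s + (ℓ + 2 * n)) :=
    pow_le_pow_right₀ ht (by omega)
  calc ‖L‖ * (K * v ^ (s + (ℓ + 2 * n)) * (1 + ‖t‖) ^ (ℓ + 2 * n)) *
        ((1 - v⁻¹) ^ n / (n.factorial : ℝ))
      ≤ ‖L‖ * (K * v ^ (s + (ℓ + 2 * n)) * (1 + ‖t‖) ^ (s + (ℓ + 2 * n))) * (1 - v⁻¹) ^ n := by
        gcongr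
    _ = _ := by ring

/-! ### Expansion of the mixtures of heat tensors -/

/-- The moments of the mixing law, along the Taylor expansion of the heat flow. -/
noncomputable def betaCoeff (d ℓ j : ℕ) : ℝ :=
  2 ^ j * ∫ u in Set.Ioi (0 : ℝ), betaWeight ((ℓ : ℝ) / 2 + j) ((d : ℝ) / 2 + ℓ + j) u

/-- Since 1 - (1 + 2u)⁻¹ = 2u(1 + 2u)⁻¹, each factor raises both parameters of the weight by one. -/
lemma betaWeight_mul_one_sub_inv_pow {a b u : ℝ} (hu : 0 < u) (j : ℕ) :
    betaWeight a b u * (1 - (1 + 2 * u)⁻¹) ^ j = 2 ^ j * betaWeight (a + j) (b + j) u := by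
  have h1 : 1 - (1 + 2 * u)⁻¹ = 2 * u * (1 + 2 * u)⁻¹ := by field_simp; ring
  have h2 : (0 : ℝ) < 1 + 2 * u := by positivity
  unfold betaWeight
  rw [h1, mul_pow, mul_pow, add_sub_right_comm, Real.rpow_add hu, neg_add, Real.rpow_add h2,
    Real.rpow_natCast, Real.rpow_neg h2.le (j : ℝ), Real.rpow_natCast, inv_pow]
  ring

lemma integral_betaWeight_mul_pow (d ℓ j : ℕ) :
    ∫ u in Set.Ioi (0 : ℝ), betaWeight ((ℓ : ℝ) / 2) ((d : ℝ) / 2 + ℓ) u *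
      (1 - (1 + 2 * u)⁻¹) ^ j = betaCoeff d ℓ j := by
  rw [betaCoeff, ← integral_const_mul]
  exact setIntegral_congr_fun measurableSet_Ioi fun u hu => betaWeight_mul_one_sub_inv_pow hu j

/-- The second parameter d/2 + ℓ + j lies between d/2 and (1 + ℓ + j)d, so the two bounds on beta
integrals turn into powers of d. -/
lemma exists_betaCoeff_bounds {ℓ : ℕ} (hℓ : 1 ≤ ℓ) (j : ℕ) :
    ∃ c : ℝ, 0 < c ∧ ∃ c' : ℝ, 0 < c' ∧ ∀ d : ℕ, 2 ≤ d →
      c * (d : ℝ) ^ (-((ℓ : ℝ) / 2 + j)) ≤ betaCoeff d ℓ j ∧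
      betaCoeff d ℓ j ≤ c' * (d : ℝ) ^ (-((ℓ : ℝ) / 2 + j)) := by
  have hℓ' : (1 : ℝ) ≤ ℓ := by exact_mod_cast hℓ
  set a : ℝ := (ℓ : ℝ) / 2 + j with ha
  have ha0 : 0 < a := by positivity
  obtain ⟨K, hK0, hK⟩ := exists_integral_betaWeight_le ha0
  refine ⟨2 ^ j * (Real.exp (-2) / a * (1 + ℓ + j : ℝ) ^ (-a)), by positivity,
    2 ^ j * (K * 2 ^ a), by positivity, fun d hd => ?_⟩
  have hd' : (2 : ℝ) ≤ d := by exact_mod_cast hd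
  have hd0 : (0 : ℝ) < d := by linarith
  have hj : (0 : ℝ) ≤ j := by positivity
  have hb0 : 0 < (d : ℝ) / 2 + ℓ + j := by positivity
  constructor
  · rw [betaCoeff, mul_assoc, mul_assoc]
    refine mul_le_mul_of_nonneg_left (le_trans ?_ (le_integral_betaWeight ha0 (by linarith)))
      (by positivity)
    refine mul_le_mul_of_nonneg_left ?_ (by positivity)
    rw [← Real.mul_rpow (by positivity) hd0.le]
    refine Real.rpow_le_rpow_of_nonpos hb0 ?_ (by linarith)
    nlinarith
  · rw [betaCoeff, mul_assoc, mul_assoc]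
    refine mul_le_mul_of_nonneg_left ((hK _ (by linarith)).trans ?_) (by positivity)
    refine mul_le_mul_of_nonneg_left ?_ hK0.le
    have : (2 : ℝ) ^ a * (d : ℝ) ^ (-a) = ((d : ℝ) / 2) ^ (-a) := by
      rw [Real.div_rpow hd0.le (by norm_num), Real.rpow_neg (by norm_num : (0 : ℝ) ≤ 2) a,
        div_inv_eq_mul, mul_comm]
    rw [this]
    exact Real.rpow_le_rpow_of_nonpos (by positivity) (by linarith) (by linarith)

/-- The Taylor polynomial of a mixture of heat tensors. -/
noncomputable def mixTaylor {s : ℕ} (d ℓ n : ℕ) (t : EuclideanSpace ℝ (Fin s)) : Tensor s ℓ :=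
  ∑ j ∈ Finset.range n, betaCoeff d ℓ j • taylorTensor ℓ j t

lemma exists_norm_mixTensor_sub_mixTaylor_le (s : ℕ) {ℓ : ℕ} (hℓ : 1 ≤ ℓ) (n : ℕ) :
    ∃ K : ℝ, 0 ≤ K ∧ ∃ q D : ℕ, ∀ d : ℕ, D ≤ d → ∀ t : EuclideanSpace ℝ (Fin s),
      ‖mixTensor d ℓ t - mixTaylor d ℓ n t‖ ≤
        K * (d : ℝ) ^ (-((ℓ : ℝ) / 2 + n)) * (1 + ‖t‖) ^ q := by
  obtain ⟨K, hK0, q, hK⟩ := exists_norm_heatTensor_sub_taylor_le s ℓ n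
  have hℓ' : (1 : ℝ) ≤ ℓ := by exact_mod_cast hℓ
  set a : ℝ := (ℓ : ℝ) / 2 with ha
  have ha0 : 0 < a := by positivity
  have han : 0 < a + n := by positivity
  obtain ⟨K', hK'0, hK'⟩ := exists_integral_betaWeight_le han
  -- The factor v^q of the remainder lowers the second parameter to b + n - q; the threshold on d
  -- keeps this above both d/4 and a + n + 1, and makes the mixture itself integrable.
  refine ⟨K * (2 ^ n * (K' * 4 ^ (a + n))), by positivity, q, 4 * q + 4 + 4 * s + ℓ,
    fun d hd t => ?_⟩
  have hd' : 4 * (q : ℝ) + 4 + 4 * s + ℓ ≤ d := by exact_mod_cast hd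
  have hs0 : (0 : ℝ) ≤ s := by positivity
  have hq0 : (0 : ℝ) ≤ q := by positivity
  have hd0 : (0 : ℝ) < d := by linarith
  have hn0 : (0 : ℝ) ≤ n := by positivity
  set b : ℝ := (d : ℝ) / 2 + ℓ with hb
  have hmix := integrableOn_betaWeight_smul_heatTensor (s := s) (ℓ := ℓ) (a := a) (b := b) ha0
    (by push_cast; linarith) t
  have hj : ∀ j : ℕ, IntegrableOn (fun u => (betaWeight a b u * (1 - (1 + 2 * u)⁻¹) ^ j) •
      taylorTensor ℓ j t) (Set.Ioi 0) := fun j => by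
    refine Integrable.smul_const ?_ _
    refine IntegrableOn.congr_fun ((integrableOn_betaWeight (a := a + j) (b := b + j)
      (by positivity) (by linarith)).const_mul (2 ^ j)) (fun u hu => ?_) measurableSet_Ioi
    exact (betaWeight_mul_one_sub_inv_pow hu j).symm
  have e : mixTensor d ℓ t - mixTaylor d ℓ n t = ∫ u in Set.Ioi (0 : ℝ), (betaWeight a b u •
      heatTensor ℓ (1 + 2 * u) t - ∑ j ∈ Finset.range n,
        (betaWeight a b u * (1 - (1 + 2 * u)⁻¹) ^ j) • taylorTensor ℓ j t) := by
    rw [integral_sub hmix (integrable_finsetSum _ fun j _ => hj j),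
      integral_finsetSum _ fun j _ => hj j]
    simp_rw [integral_smul_const, ha, hb, integral_betaWeight_mul_pow]
    rfl
  have hbd : a + n + 1 ≤ b + n - q := by linarith
  have hint : IntegrableOn (fun u => betaWeight (a + n) (b + n - q) u) (Set.Ioi 0) :=
    integrableOn_betaWeight han (by linarith)
  rw [e]
  have h := norm_integral_le_of_norm_le (μ := volume.restrict (Set.Ioi (0 : ℝ)))
    (f := fun u => betaWeight a b u •
      heatTensor ℓ (1 + 2 * u) t - ∑ j ∈ Finset.range n,
        (betaWeight a b u * (1 - (1 + 2 * u)⁻¹) ^ j) • taylorTensor ℓ j t)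
    (hint.const_mul (K * 2 ^ n * (1 + ‖t‖) ^ q))
    ((ae_restrict_iff' measurableSet_Ioi).mpr (Filter.Eventually.of_forall fun u hu => by
      have hu' : (0 : ℝ) < u := hu
      have e1 : ∑ j ∈ Finset.range n, (betaWeight a b u * (1 - (1 + 2 * u)⁻¹) ^ j) •
          taylorTensor ℓ j t = betaWeight a b u • ∑ j ∈ Finset.range n,
            (1 - (1 + 2 * u)⁻¹) ^ j • taylorTensor ℓ j t := by
        rw [Finset.smul_sum]
        exact Finset.sum_congr rfl fun j _ => mul_smul _ _ _
      rw [e1, ← smul_sub, norm_smul, Real.norm_eq_abs, abs_of_nonneg (betaWeight_nonneg hu')]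
      refine (mul_le_mul_of_nonneg_left (hK (1 + 2 * u) t (by linarith))
        (betaWeight_nonneg hu')).trans (le_of_eq ?_)
      have e2 := betaWeight_mul_one_sub_inv_pow (a := a) (b := b) hu' n
      rw [← betaWeight_mul_pow hu']
      linear_combination (K * (1 + 2 * u) ^ q * (1 + ‖t‖) ^ q) * e2))
  refine h.trans ?_
  rw [integral_const_mul]
  have h3 : (b + n - q) ^ (-(a + n)) ≤ 4 ^ (a + n) * (d : ℝ) ^ (-(a + n)) := by
    have : (4 : ℝ) ^ (a + n) * (d : ℝ) ^ (-(a + n)) = ((d : ℝ) / 4) ^ (-(a + n)) := by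
      rw [Real.div_rpow hd0.le (by norm_num), Real.rpow_neg (by norm_num : (0:ℝ) ≤ 4) (a + n),
        div_inv_eq_mul, mul_comm]
    rw [this]
    exact Real.rpow_le_rpow_of_nonpos (by positivity) (by linarith) (by linarith)
  calc _ ≤ K * 2 ^ n * (1 + ‖t‖) ^ q * (K' * (4 ^ (a + n) * (d : ℝ) ^ (-(a + n)))) := by
        refine mul_le_mul_of_nonneg_left ((hK' _ hbd).trans ?_) (by positivity)
        exact mul_le_mul_of_nonneg_left h3 hK'0.le
    _ = _ := by ring

/-! ### Analyticity of the heat flow -/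

lemma integrable_exp_mul_comp_smul {d : ℕ} {r : ℝ} (hr : 0 < r)
    {f : EuclideanSpace ℝ (Fin d) → ℝ}
    (hf : Integrable f (stdGaussian (EuclideanSpace ℝ (Fin d)))) :
    Integrable (fun x => Real.exp (-((r ^ 2 - 1) / 2 * ‖x‖ ^ 2)) * f (r • x))
      (stdGaussian (EuclideanSpace ℝ (Fin d))) := by
  rw [stdGaussian_eq_withDensity, integrable_withDensity_iff_integrable_smul'
    (measurable_gaussianDensity d).ennreal_ofReal
    (Filter.Eventually.of_forall fun x => ENNReal.ofReal_lt_top)] at hf ⊢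
  simp_rw [ENNReal.toReal_ofReal (gaussianDensity_pos _).le] at hf ⊢
  refine ((integrable_comp_smul_iff volume _ hr.ne').mpr hf).congr
    (Filter.Eventually.of_forall fun x => ?_)
  simp only [gaussianDensity, smul_eq_mul, norm_smul, Real.norm_eq_abs, abs_of_pos hr]
  rw [mul_assoc, mul_assoc, ← mul_assoc (Real.exp (-‖x‖ ^ 2 / 2)), ← Real.exp_add]
  congr 3
  ring

/-- Measurable functions of polynomial growth. -/
def PolyGrowth {s : ℕ} (f : EuclideanSpace ℝ (Fin s) → ℝ) : Prop :=
  Measurable f ∧ ∃ (K : ℝ) (q : ℕ), ∀ t, |f t| ≤ K * (1 + ‖t‖) ^ q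

lemma PolyGrowth.mul_coord {s : ℕ} {f : EuclideanSpace ℝ (Fin s) → ℝ} (hf : PolyGrowth f)
    (j : Fin s) : PolyGrowth fun t => f t * t j := by
  obtain ⟨hm, K, q, hK⟩ := hf
  refine ⟨hm.mul (by fun_prop), K, q + 1, fun t => ?_⟩
  have h1 : |t j| ≤ 1 + ‖t‖ := by
    have := PiLp.norm_apply_le t j
    rw [Real.norm_eq_abs] at this
    linarith
  rw [abs_mul, pow_succ, ← mul_assoc]
  exact mul_le_mul (hK t) h1 (abs_nonneg _) ((abs_nonneg _).trans (hK t))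

/-- A dilation by √v trades the exponential for a Gaussian of variance 1/v. For v < 1 the
exponential grows, but the Gaussian decay still wins because v > 0. -/
lemma PolyGrowth.integrable_mul_exp {s : ℕ} {f : EuclideanSpace ℝ (Fin s) → ℝ}
    (hf : PolyGrowth f) {v : ℝ} (hv : 0 < v) :
    Integrable (fun t => f t * Real.exp (-((v - 1) / 2 * ‖t‖ ^ 2)))
      (stdGaussian (EuclideanSpace ℝ (Fin s))) := by
  obtain ⟨hm, K, q, hK⟩ := hf
  set r := √v with hr
  have hr0 : 0 < r := Real.sqrt_pos.mpr hv
  have hK0 : 0 ≤ K := by simpa using (abs_nonneg _).trans (hK 0)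
  have h1 : Integrable (fun t => f (r⁻¹ • t)) (stdGaussian (EuclideanSpace ℝ (Fin s))) := by
    refine integrable_of_norm_le_pow (q := q) (K := K * (1 + r⁻¹) ^ q)
      (hm.comp (measurable_const_smul _)).aestronglyMeasurable fun t => ?_
    rw [Real.norm_eq_abs, mul_assoc, ← mul_pow]
    refine (hK _).trans ?_
    rw [norm_smul, norm_inv, Real.norm_eq_abs, abs_of_pos hr0]
    gcongr
    nlinarith [norm_nonneg t, inv_pos.mpr hr0]
  have h2 := integrable_exp_mul_comp_smul hr0 h1
  refine h2.congr (Filter.Eventually.of_forall fun t => ?_)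
  simp only [smul_smul, inv_mul_cancel₀ hr0.ne', one_smul]
  rw [hr, Real.sq_sqrt hv.le, mul_comm]

/-- The integral is the moment generating function of -‖t‖²/2, at v - 1, under the measure with
density f. Such functions are analytic in the interior of their domain, which contains (-1, ∞). -/
lemma PolyGrowth.analyticOnNhd_of_nonneg {s : ℕ} {f : EuclideanSpace ℝ (Fin s) → ℝ}
    (hf : PolyGrowth f) (h0 : ∀ t, 0 ≤ f t) :
    AnalyticOnNhd ℝ (fun v => ∫ t, f t * Real.exp (-((v - 1) / 2 * ‖t‖ ^ 2))
      ∂(stdGaussian (EuclideanSpace ℝ (Fin s)))) (Set.Ioi 0) := by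
  set μ := (stdGaussian (EuclideanSpace ℝ (Fin s))).withDensity fun t => ENNReal.ofReal (f t)
    with hμ
  let X : EuclideanSpace ℝ (Fin s) → ℝ := fun t => -(‖t‖ ^ 2 / 2)
  have hlt : ∀ᵐ t ∂(stdGaussian (EuclideanSpace ℝ (Fin s))), ENNReal.ofReal (f t) < ∞ :=
    Filter.Eventually.of_forall fun t => ENNReal.ofReal_lt_top
  have hX : ∀ (v : ℝ) (t : EuclideanSpace ℝ (Fin s)),
      (v - 1) * X t = -((v - 1) / 2 * ‖t‖ ^ 2) := fun v t => by
    simp only [X]; ring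
  have hmgf : ∀ v, ∫ t, f t * Real.exp (-((v - 1) / 2 * ‖t‖ ^ 2))
      ∂(stdGaussian (EuclideanSpace ℝ (Fin s))) = mgf X μ (v - 1) := fun v => by
    rw [mgf, hμ, integral_withDensity_eq_integral_toReal_smul hf.1.ennreal_ofReal hlt]
    simp only [ENNReal.toReal_ofReal (h0 _), smul_eq_mul, hX]
  have hset : Set.Ioi (-1) ⊆ integrableExpSet X μ := fun u hu => by
    have hv : 0 < u + 1 := by linarith [Set.mem_Ioi.mp hu]
    have h := hf.integrable_mul_exp hv
    change Integrable _ μ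
    rw [hμ, integrable_withDensity_iff_integrable_smul' hf.1.ennreal_ofReal hlt]
    simp only [ENNReal.toReal_ofReal (h0 _), smul_eq_mul]
    refine h.congr (Filter.Eventually.of_forall fun t => ?_)
    simp only
    rw [← hX, add_sub_cancel_right]
  have hset' : Set.Ioi (-1) ⊆ interior (integrableExpSet X μ) :=
    interior_maximal hset isOpen_Ioi
  simp_rw [hmgf]
  intro v hv
  have hv' : (0 : ℝ) < v := hv
  exact (analyticAt_mgf (hset' (show (-1 : ℝ) < v - 1 by linarith))).fun_comp
    (f := fun v : ℝ => v - 1) (analyticAt_id.sub analyticAt_const)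

lemma PolyGrowth.analyticOnNhd {s : ℕ} {f : EuclideanSpace ℝ (Fin s) → ℝ}
    (hf : PolyGrowth f) :
    AnalyticOnNhd ℝ (fun v => ∫ t, f t * Real.exp (-((v - 1) / 2 * ‖t‖ ^ 2))
      ∂(stdGaussian (EuclideanSpace ℝ (Fin s)))) (Set.Ioi 0) := by
  obtain ⟨hm, K, q, hK⟩ := hf
  have hp : PolyGrowth fun t => max (f t) 0 := by
    refine ⟨hm.max measurable_const, K, q, fun t => le_trans ?_ (hK t)⟩
    rw [abs_of_nonneg (le_max_right _ _)]
    exact max_le (le_abs_self _) (abs_nonneg _)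
  have hn : PolyGrowth fun t => max (-f t) 0 := by
    refine ⟨hm.neg.max measurable_const, K, q, fun t => le_trans ?_ (hK t)⟩
    rw [abs_of_nonneg (le_max_right _ _)]
    exact max_le (neg_le_abs _) (abs_nonneg _)
  refine ((hp.analyticOnNhd_of_nonneg fun t => le_max_right _ _).sub
    (hn.analyticOnNhd_of_nonneg fun t => le_max_right _ _)).congr isOpen_Ioi fun v hv => ?_
  rw [Pi.sub_apply, ← integral_sub (hp.integrable_mul_exp hv) (hn.integrable_mul_exp hv)]
  refine integral_congr_ae (Filter.Eventually.of_forall fun t => ?_)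
  simp only [← sub_mul]
  congr 1
  rcases le_total (f t) 0 with h | h
  · rw [max_eq_right h, max_eq_left (by linarith)]; ring
  · rw [max_eq_left h, max_eq_right (by linarith)]; ring

/-- Families of functions whose moments, with weights of polynomial growth and along the heat flow,
are analytic. -/
def AnalyticMoments {s : ℕ} (g : ℝ → EuclideanSpace ℝ (Fin s) → ℝ) : Prop :=
  ∀ f : EuclideanSpace ℝ (Fin s) → ℝ, PolyGrowth f →
    (∀ v, 0 < v → Integrable (fun t => f t * g v t * Real.exp (-((v - 1) / 2 * ‖t‖ ^ 2)))
      (stdGaussian (EuclideanSpace ℝ (Fin s)))) ∧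
    AnalyticOnNhd ℝ (fun v => ∫ t, f t * g v t * Real.exp (-((v - 1) / 2 * ‖t‖ ^ 2))
      ∂(stdGaussian (EuclideanSpace ℝ (Fin s)))) (Set.Ioi 0)

lemma analyticMoments_one (s : ℕ) :
    AnalyticMoments fun (_ : ℝ) (_ : EuclideanSpace ℝ (Fin s)) => 1 := fun f hf => by
  simp only [mul_one]
  exact ⟨fun v hv => hf.integrable_mul_exp hv, hf.analyticOnNhd⟩

lemma AnalyticMoments.const_mul {s : ℕ} {g : ℝ → EuclideanSpace ℝ (Fin s) → ℝ}
    (hg : AnalyticMoments g) {c : ℝ → ℝ} (hc : AnalyticOnNhd ℝ c (Set.Ioi 0)) :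
    AnalyticMoments fun v t => c v * g v t := fun f hf => by
  have e : ∀ v t, f t * (c v * g v t) * Real.exp (-((v - 1) / 2 * ‖t‖ ^ 2)) =
      c v * (f t * g v t * Real.exp (-((v - 1) / 2 * ‖t‖ ^ 2))) := fun v t => by ring
  simp_rw [e, integral_const_mul]
  exact ⟨fun v hv => ((hg f hf).1 v hv).const_mul _, hc.mul (hg f hf).2⟩

/-- The coordinate is absorbed into the test function; this is why the definition quantifies over
all f of polynomial growth. -/
lemma AnalyticMoments.coord_mul {s : ℕ} {g : ℝ → EuclideanSpace ℝ (Fin s) → ℝ}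
    (hg : AnalyticMoments g) (j : Fin s) : AnalyticMoments fun v t => t j * g v t := fun f hf => by
  simp_rw [← mul_assoc]
  exact hg _ (hf.mul_coord j)

lemma AnalyticMoments.sub {s : ℕ} {g g' : ℝ → EuclideanSpace ℝ (Fin s) → ℝ}
    (hg : AnalyticMoments g) (hg' : AnalyticMoments g') :
    AnalyticMoments fun v t => g v t - g' v t := fun f hf => by
  simp_rw [mul_sub, sub_mul]
  refine ⟨fun v hv => ((hg f hf).1 v hv).sub ((hg' f hf).1 v hv), ?_⟩
  refine ((hg f hf).2.sub (hg' f hf).2).congr isOpen_Ioi fun v hv => ?_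
  exact (integral_sub ((hg f hf).1 v hv) ((hg' f hf).1 v hv)).symm

lemma AnalyticMoments.hermiteScaled_mul {s : ℕ} {g : ℝ → EuclideanSpace ℝ (Fin s) → ℝ}
    (hg : AnalyticMoments g) (n : ℕ) (j : Fin s) :
    AnalyticMoments fun v t => hermiteScaled n v (t j) * g v t := by
  induction n using Nat.twoStepInduction with
  | zero => simpa only [hermiteScaled, one_mul] using hg
  | one =>
    simp only [hermiteScaled, mul_assoc]
    exact (hg.coord_mul j).const_mul analyticOnNhd_id
  | more n h1 h2 =>
    simp only [hermiteScaled, mul_assoc, sub_mul]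
    exact ((h2.coord_mul j).sub (h1.const_mul analyticOnNhd_const)).const_mul analyticOnNhd_id

lemma analyticMoments_hermiteProd {s k : ℕ} (i : Fin k → Fin s) :
    AnalyticMoments fun v (t : EuclideanSpace ℝ (Fin s)) => hermiteProd k v t i := by
  simp only [hermiteProd_apply]
  have h : ∀ T : Finset (Fin s), AnalyticMoments fun v (t : EuclideanSpace ℝ (Fin s)) =>
      ∏ j ∈ T, hermiteScaled (indexCount i j) v (t j) := fun T => by
    induction T using Finset.induction_on with
    | empty => simpa using analyticMoments_one s
    | insert j T hj ih =>
      simp only [Finset.prod_insert hj]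
      exact ih.hermiteScaled_mul _ j
  exact h _

/-- Otherwise h = (v - 1)^n g near 1 with g(1) ≠ 0, and flatness to order n + 1 from the right
forces g(1) = 0. -/
lemma eqOn_zero_of_analyticOnNhd_of_flat {h : ℝ → ℝ} (hh : AnalyticOnNhd ℝ h (Set.Ioi 0))
    (hflat : ∀ n : ℕ, ∃ K : ℝ, ∀ v ∈ Set.Ioc (1 : ℝ) 2, |h v| ≤ K * (v - 1) ^ n) :
    Set.EqOn h 0 (Set.Ioi 0) := by
  have h1 : (1 : ℝ) ∈ Set.Ioi (0 : ℝ) := Set.mem_Ioi.mpr one_pos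
  refine hh.eqOn_zero_of_preconnected_of_eventuallyEq_zero isPreconnected_Ioi h1 ?_
  by_contra hne
  obtain ⟨n, g, hg, hg1, hgeq⟩ := (hh 1 h1).exists_eventuallyEq_pow_smul_nonzero_iff.mpr hne
  obtain ⟨K, hK⟩ := hflat (n + 1)
  have hev : ∀ᶠ v in nhdsWithin (1 : ℝ) (Set.Ioi 1), |g v| ≤ K * (v - 1) := by
    have hmem : Set.Ioc (1 : ℝ) 2 ∈ nhdsWithin (1 : ℝ) (Set.Ioi 1) :=
      Ioc_mem_nhdsGT (by norm_num)
    filter_upwards [hmem, nhdsWithin_le_nhds hgeq] with v hv hgv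
    have hpos : 0 < v - 1 := by linarith [hv.1]
    have := hK v hv
    rw [hgv, smul_eq_mul, abs_mul, abs_of_pos (by positivity), pow_succ, ← mul_assoc,
      mul_comm K, mul_assoc] at this
    exact le_of_mul_le_mul_left this (by positivity)
  have ht1 : Filter.Tendsto (fun v => |g v|) (nhdsWithin (1 : ℝ) (Set.Ioi 1)) (nhds |g 1|) :=
    (hg.continuousAt.abs).mono_left nhdsWithin_le_nhds
  have ht2 : Filter.Tendsto (fun v : ℝ => K * (v - 1)) (nhdsWithin (1 : ℝ) (Set.Ioi 1))
      (nhds (K * (1 - 1))) :=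
    (Continuous.tendsto (by fun_prop) 1).mono_left nhdsWithin_le_nhds
  have := le_of_tendsto_of_tendsto ht1 ht2 hev
  rw [sub_self, mul_zero] at this
  exact hg1 (abs_eq_zero.mp (le_antisymm this (abs_nonneg _)))

lemma integrable_taylorTensor {s : ℕ} (ℓ j : ℕ) :
    Integrable (taylorTensor (s := s) ℓ j) (stdGaussian (EuclideanSpace ℝ (Fin s))) :=
  ((LinearMap.toContinuousLinearMap (iterTrace s ℓ j)).integrable_comp
    (integrable_hermiteProd s (ℓ + 2 * j))).smul ((-(1 / 2 : ℝ)) ^ j / j.factorial)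

/-- When all averaged Taylor coefficients vanish, the averaged flow equals its own remainder of any
order, and 1 - v⁻¹ ≤ v - 1. -/
lemma exists_norm_integral_smul_heatTensor_le {s ℓ : ℕ} {q : EuclideanSpace ℝ (Fin s) → ℝ}
    (hq : Measurable q) (hM : ∀ t, |q t| ≤ 1)
    (h0 : ∀ j, ∫ t, q t • taylorTensor ℓ j t ∂(stdGaussian (EuclideanSpace ℝ (Fin s))) = 0)
    (n : ℕ) : ∃ K : ℝ, ∀ v ∈ Set.Ioc (1 : ℝ) 2,
      ‖∫ t, q t • heatTensor ℓ v t ∂(stdGaussian (EuclideanSpace ℝ (Fin s)))‖ ≤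
        K * (v - 1) ^ n := by
  obtain ⟨K, hK0, m, hK⟩ := exists_norm_heatTensor_sub_taylor_le s ℓ n
  refine ⟨K * 2 ^ m * ∫ t, (1 + ‖t‖) ^ m ∂(stdGaussian (EuclideanSpace ℝ (Fin s))),
    fun v hv => ?_⟩
  have hv1 : 1 ≤ v := hv.1.le
  have hv0 : 0 < v := by linarith
  have hj : ∀ j, Integrable (fun t => (1 - v⁻¹) ^ j • (q t • taylorTensor ℓ j t))
      (stdGaussian (EuclideanSpace ℝ (Fin s))) := fun j =>
    ((integrable_taylorTensor ℓ j).bdd_smul 1 hq.aestronglyMeasurable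
      (Filter.Eventually.of_forall hM)).smul ((1 - v⁻¹) ^ j)
  have e : ∫ t, q t • heatTensor ℓ v t ∂(stdGaussian (EuclideanSpace ℝ (Fin s))) =
      ∫ t, (q t • heatTensor ℓ v t - ∑ j ∈ Finset.range n,
        (1 - v⁻¹) ^ j • (q t • taylorTensor ℓ j t))
        ∂(stdGaussian (EuclideanSpace ℝ (Fin s))) := by
    rw [integral_sub (integrable_smul_heatTensor hv1 hq hM)
      (integrable_finsetSum _ fun j _ => hj j),
      integral_finsetSum _ fun j _ => hj j]
    simp_rw [integral_smul, h0, smul_zero, Finset.sum_const_zero, sub_zero]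
  have hθ : 1 - v⁻¹ ≤ v - 1 := by
    have : v * v⁻¹ = 1 := mul_inv_cancel₀ hv0.ne'
    have hi := inv_pos.mpr hv0
    nlinarith
  have hθ0 : 0 ≤ 1 - v⁻¹ := by
    have := inv_le_one_of_one_le₀ hv1
    linarith
  rw [e]
  refine (norm_integral_le_of_norm_le
    ((integrable_one_add_norm_pow s m).const_mul (K * 2 ^ m * (v - 1) ^ n))
    (Filter.Eventually.of_forall fun t => ?_)).trans (le_of_eq ?_)
  · simp_rw [smul_comm _ (q t)]
    rw [← Finset.smul_sum, ← smul_sub, norm_smul, Real.norm_eq_abs]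
    refine (mul_le_of_le_one_left (norm_nonneg _) (hM t)).trans ((hK v t hv1).trans ?_)
    have := hv.2
    gcongr
  · rw [integral_const_mul]
    ring

/-- Taylor estimates alone would only make the flow smaller than every power of v - 1; analyticity
upgrades this to exact vanishing. -/
lemma integral_smul_heatTensor_eq_zero {s ℓ : ℕ} {q : EuclideanSpace ℝ (Fin s) → ℝ}
    (hq : Measurable q) (hM : ∀ t, |q t| ≤ 1)
    (h0 : ∀ j, ∫ t, q t • taylorTensor ℓ j t ∂(stdGaussian (EuclideanSpace ℝ (Fin s))) = 0)
    {v : ℝ} (hv : 1 ≤ v) :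
    ∫ t, q t • heatTensor ℓ v t ∂(stdGaussian (EuclideanSpace ℝ (Fin s))) = 0 := by
  ext i
  have hqg : PolyGrowth q := ⟨hq, 1, 0, fun t => by simpa using hM t⟩
  obtain ⟨-, han⟩ := analyticMoments_hermiteProd i q hqg
  -- The factor √v^s is split off to leave an analytic moment; being at least one for v ≥ 1, it does
  -- no harm to the flatness bound.
  have e : ∀ v, 1 ≤ v → (∫ t, q t • heatTensor ℓ v t ∂(stdGaussian (EuclideanSpace ℝ (Fin s)))) i =
      √v ^ s * ∫ t, q t * hermiteProd ℓ v t i * Real.exp (-((v - 1) / 2 * ‖t‖ ^ 2))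
        ∂(stdGaussian (EuclideanSpace ℝ (Fin s))) := fun v hv => by
    have := (EuclideanSpace.proj (𝕜 := ℝ) i).integral_comp_comm
      (integrable_smul_heatTensor (k := ℓ) hv hq hM)
    refine this.symm.trans ?_
    rw [← integral_const_mul]
    refine integral_congr_ae (Filter.Eventually.of_forall fun t => ?_)
    change q t * ((√v ^ s * Real.exp (-((v - 1) / 2 * ‖t‖ ^ 2))) * hermiteProd ℓ v t i) = _
    ring
  have hz := eqOn_zero_of_analyticOnNhd_of_flat han fun n => by
    obtain ⟨K, hK⟩ := exists_norm_integral_smul_heatTensor_le hq hM h0 n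
    refine ⟨K, fun v hv => le_trans ?_ (hK v hv)⟩
    have h1 := PiLp.norm_apply_le
      (∫ t, q t • heatTensor ℓ v t ∂(stdGaussian (EuclideanSpace ℝ (Fin s)))) i
    refine le_trans ?_ h1
    rw [e v hv.1.le, Real.norm_eq_abs, abs_mul]
    refine le_mul_of_one_le_left (abs_nonneg _) ?_
    rw [abs_of_nonneg (by positivity)]
    exact one_le_pow₀ (Real.one_le_sqrt.mpr hv.1.le)
  have hzv := hz (show (0 : ℝ) < v by linarith)
  rw [e v hv]
  exact mul_eq_zero_of_right _ hzv

lemma integral_smul_mixTensor_eq_zero {s d ℓ : ℕ} (hℓ : 1 ≤ ℓ) (hd : 2 * s + ℓ < d)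
    {q : EuclideanSpace ℝ (Fin s) → ℝ} (hq : Measurable q) (hM : ∀ t, |q t| ≤ 1)
    (h0 : ∀ j, ∫ t, q t • taylorTensor ℓ j t ∂(stdGaussian (EuclideanSpace ℝ (Fin s))) = 0) :
    ∫ t, q t • mixTensor d ℓ t ∂(stdGaussian (EuclideanSpace ℝ (Fin s))) = 0 := by
  rw [(integral_smul_mixTensor hℓ hd hq hM).2]
  refine setIntegral_eq_zero_of_forall_eq_zero fun u hu => ?_
  have hu' : (0 : ℝ) < u := hu
  rw [integral_smul_heatTensor_eq_zero hq hM h0 (by linarith), smul_zero]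

section Models

variable {Y : Type*} [MeasurableSpace Y] {s : ℕ} (ρ : Kernel (EuclideanSpace ℝ (Fin s)) Y)
  [IsMarkovKernel ρ]

lemma condMean_ae_eq_zero_iff {F : Type*} [NormedAddCommGroup F] [NormedSpace ℝ F]
    [CompleteSpace F] {f : EuclideanSpace ℝ (Fin s) → F}
    (hf : Integrable f (stdGaussian (EuclideanSpace ℝ (Fin s)))) :
    condMean ρ f =ᵐ[(baseMIM ρ).fst] 0 ↔ ∀ S, MeasurableSet S →
      ∫ t, (ρ t).real S • f t ∂(stdGaussian (EuclideanSpace ℝ (Fin s))) = 0 := by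
  have hint := integrable_gaussianMIM ρ (1 : Matrix (Fin s) (Fin s) ℝ) hf
  have key : ∀ S, MeasurableSet S → ∫ y in S, condMean ρ f y ∂(baseMIM ρ).fst =
      ∫ t, (ρ t).real S • f t ∂(stdGaussian (EuclideanSpace ℝ (Fin s))) := fun S hS => by
    rw [← setIntegral_baseMIM ρ hf hS]
    exact Measure.setIntegral_condKernel_univ_right (f := fun p => f p.2) hS hint.integrableOn
  constructor
  · intro h S hS
    rw [← key S hS, setIntegral_congr_ae hS (h.mono fun y hy _ => hy)]
    simp
  · intro h
    refine Integrable.ae_eq_zero_of_forall_setIntegral_eq_zero hint.integral_condKernel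
      fun S hS _ => ?_
    exact (key S hS).trans (h S hS)

lemma condMean_mixTensor_ae_eq_zero {d ℓ : ℕ} (hℓ : 1 ≤ ℓ) (hd : 2 * s + ℓ < d)
    (h : ∀ j, condMean ρ (taylorTensor ℓ j) =ᵐ[(baseMIM ρ).fst] 0) :
    condMean ρ (mixTensor d ℓ) =ᵐ[(baseMIM ρ).fst] 0 := by
  rw [condMean_ae_eq_zero_iff ρ (integrable_mixTensor hℓ hd)]
  intro S hS
  refine integral_smul_mixTensor_eq_zero hℓ hd (measurable_kernel_real ρ hS)
    (abs_kernel_real_le ρ S) fun j => ?_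
  exact (condMean_ae_eq_zero_iff ρ (integrable_taylorTensor ℓ j)).mp (h j) S hS

end Models

/-! ### Energies of contracted Hermite coefficients -/

/-- No integrability is assumed: an undefined integral is zero, which lies in S. -/
lemma integral_mem_submodule {α F : Type*} [MeasurableSpace α] {μ : Measure α}
    [NormedAddCommGroup F] [InnerProductSpace ℝ F] [FiniteDimensional ℝ F] (S : Submodule ℝ F)
    {f : α → F} (h : ∀ a, f a ∈ S) : ∫ a, f a ∂μ ∈ S := by
  by_cases hf : Integrable f μ
  · rw [← Submodule.starProjection_eq_self_iff, ← S.starProjection.integral_comp_comm hf]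
    exact integral_congr_ae (Filter.Eventually.of_forall fun a =>
      Submodule.starProjection_eq_self_iff.mpr (h a))
  · rw [integral_undef hf]
    exact S.zero_mem

lemma mixTensor_mem_symTensors {s : ℕ} (d ℓ : ℕ) (t : EuclideanSpace ℝ (Fin s)) :
    mixTensor d ℓ t ∈ symTensors s ℓ :=
  integral_mem_submodule _ fun _ => Submodule.smul_mem _ _
    (Submodule.smul_mem _ _ (hermiteProd_mem_symTensors _ _ _))

lemma integrable_norm_sq_of_norm_le_pow {d q : ℕ} {F : Type*} [NormedAddCommGroup F]
    {f : EuclideanSpace ℝ (Fin d) → F} {K : ℝ}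
    (hf : AEStronglyMeasurable f (stdGaussian (EuclideanSpace ℝ (Fin d))))
    (h : ∀ x, ‖f x‖ ≤ K * (1 + ‖x‖) ^ q) :
    Integrable (fun x => ‖f x‖ ^ 2) (stdGaussian (EuclideanSpace ℝ (Fin d))) := by
  refine integrable_of_norm_le_pow (K := K ^ 2) (q := q * 2) (hf.norm.pow 2) fun x => ?_
  rw [norm_pow, norm_norm, pow_mul, ← mul_pow]
  exact pow_le_pow_left₀ (norm_nonneg _) (h x) 2

lemma integrable_norm_sq_hermiteProd (d k : ℕ) :
    Integrable (fun x => ‖hermiteProd (d := d) k 1 x‖ ^ 2)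
      (stdGaussian (EuclideanSpace ℝ (Fin d))) := by
  obtain ⟨K, -, hK⟩ := exists_norm_hermiteProd_le d k
  refine integrable_norm_sq_of_norm_le_pow (K := K) (q := k)
    (continuous_hermiteProd k 1).aestronglyMeasurable fun x => ?_
  simpa using hK 1 x le_rfl

section Models

variable {Y : Type*} [MeasurableSpace Y] {d s : ℕ} (ρ : Kernel (EuclideanSpace ℝ (Fin s)) Y)
  [IsMarkovKernel ρ] {W : Matrix (Fin d) (Fin s) ℝ}

lemma condMean_mem_symTensors {k : ℕ} {f : EuclideanSpace ℝ (Fin s) → Tensor s k}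
    (h : ∀ t, f t ∈ symTensors s k) (y : Y) : condMean ρ f y ∈ symTensors s k :=
  integral_mem_submodule _ h

lemma integrable_condMean {F : Type*} [NormedAddCommGroup F] [NormedSpace ℝ F] [CompleteSpace F]
    {f : EuclideanSpace ℝ (Fin s) → F}
    (hf : Integrable f (stdGaussian (EuclideanSpace ℝ (Fin s)))) :
    Integrable (condMean ρ f) (baseMIM ρ).fst :=
  Integrable.integral_condKernel (f := fun p : Y × EuclideanSpace ℝ (Fin s) => f p.2)
    (integrable_gaussianMIM ρ 1 hf)

lemma integrable_condKernel_baseMIM {F : Type*} [NormedAddCommGroup F]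
    {f : EuclideanSpace ℝ (Fin s) → F}
    (hf : Integrable f (stdGaussian (EuclideanSpace ℝ (Fin s)))) :
    ∀ᵐ y ∂(baseMIM ρ).fst, Integrable f ((baseMIM ρ).condKernel y) :=
  (integrable_gaussianMIM ρ 1 hf).condKernel_ae

lemma integrable_norm_sq_condMean {F : Type*} [NormedAddCommGroup F] [NormedSpace ℝ F]
    [CompleteSpace F] {f : EuclideanSpace ℝ (Fin s) → F}
    (hf : Integrable f (stdGaussian (EuclideanSpace ℝ (Fin s))))
    (hf2 : Integrable (fun t => ‖f t‖ ^ 2) (stdGaussian (EuclideanSpace ℝ (Fin s)))) :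
    Integrable (fun y => ‖condMean ρ f y‖ ^ 2) (baseMIM ρ).fst :=
  integrable_norm_condMean_sq (integrable_gaussianMIM ρ 1 hf) (integrable_gaussianMIM ρ 1 hf2)

lemma integral_norm_sq_condMean_le {F : Type*} [NormedAddCommGroup F] [NormedSpace ℝ F]
    [CompleteSpace F] {f : EuclideanSpace ℝ (Fin s) → F}
    (hf : Integrable f (stdGaussian (EuclideanSpace ℝ (Fin s))))
    (hf2 : Integrable (fun t => ‖f t‖ ^ 2) (stdGaussian (EuclideanSpace ℝ (Fin s)))) :
    ∫ y, ‖condMean ρ f y‖ ^ 2 ∂(baseMIM ρ).fst ≤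
      ∫ t, ‖f t‖ ^ 2 ∂(stdGaussian (EuclideanSpace ℝ (Fin s))) := by
  rw [← integral_gaussianMIM ρ (1 : Matrix (Fin s) (Fin s) ℝ) hf2.1]
  exact integral_norm_condMean_sq_le (integrable_gaussianMIM ρ 1 hf)
    (integrable_gaussianMIM ρ 1 hf2)

/-- Projecting the image of symmetric tensors under a frame onto traceless tensors preserves `L²`
norms up to constants. -/
lemma integral_norm_sq_projTF_frameTensor_bounds {α : Type*} [MeasurableSpace α] {ν : Measure α}
    (hW : W ∈ Stiefel d s) (hd : 2 * s ≤ d) {ℓ : ℕ} {g : α → Tensor s ℓ}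
    (hg : AEStronglyMeasurable g ν) (hg2 : Integrable (fun y => ‖g y‖ ^ 2) ν)
    (hsym : ∀ y, g y ∈ symTensors s ℓ) :
    (∫ y, ‖g y‖ ^ 2 ∂ν ≤ 2 ^ ℓ * ∫ y, ‖projTF d ℓ (frameTensor W ℓ (g y))‖ ^ 2 ∂ν) ∧
      ∫ y, ‖projTF d ℓ (frameTensor W ℓ (g y))‖ ^ 2 ∂ν ≤ ∫ y, ‖g y‖ ^ 2 ∂ν := by
  have hle : ∀ y, ‖projTF d ℓ (frameTensor W ℓ (g y))‖ ^ 2 ≤ ‖g y‖ ^ 2 := fun y => by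
    refine pow_le_pow_left₀ (norm_nonneg _) ?_ 2
    rw [← norm_frameTensor hW (g y)]
    exact norm_projTF_le _
  have hm : AEStronglyMeasurable (fun y => ‖projTF d ℓ (frameTensor W ℓ (g y))‖ ^ 2) ν :=
    (((projTF d ℓ).continuous.comp
      (LinearMap.continuous_of_finiteDimensional (frameTensor W ℓ))).comp_aestronglyMeasurable
        hg).norm.pow 2
  have hint : Integrable (fun y => ‖projTF d ℓ (frameTensor W ℓ (g y))‖ ^ 2) ν :=
    hg2.mono' hm (Filter.Eventually.of_forall fun y => by
      rw [norm_pow, norm_norm]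
      exact hle y)
  refine ⟨?_, integral_mono hint hg2 hle⟩
  rw [← integral_const_mul]
  exact integral_mono hg2 (hint.const_mul _) fun y =>
    norm_sq_le_norm_projTF_frameTensor hW hd (hsym y)

/-- The squared `L²` norm of the iterated trace of a Hermite coefficient, in dimension `s`. -/
noncomputable def traceEnergy (ℓ j : ℕ) : ℝ :=
  ∫ y, ‖iterTrace s ℓ j (condMean ρ (hermiteProd (ℓ + 2 * j) 1) y)‖ ^ 2 ∂(baseMIM ρ).fst

lemma traceEnergy_nonneg (ℓ j : ℕ) : 0 ≤ traceEnergy ρ ℓ j :=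
  integral_nonneg fun _ => by positivity

lemma integrable_iterTrace_condMean (ℓ j : ℕ) :
    AEStronglyMeasurable (fun y => iterTrace s ℓ j (condMean ρ (hermiteProd (ℓ + 2 * j) 1) y))
      (baseMIM ρ).fst ∧
    Integrable (fun y => ‖iterTrace s ℓ j (condMean ρ (hermiteProd (ℓ + 2 * j) 1) y)‖ ^ 2)
      (baseMIM ρ).fst := by
  let L := LinearMap.toContinuousLinearMap (iterTrace s ℓ j)
  have hm : AEStronglyMeasurable (fun y => L (condMean ρ (hermiteProd (ℓ + 2 * j) 1) y))
      (baseMIM ρ).fst :=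
    L.continuous.comp_aestronglyMeasurable
      (integrable_condMean ρ (integrable_hermiteProd s (ℓ + 2 * j))).1
  refine ⟨hm, ((integrable_norm_sq_condMean ρ (integrable_hermiteProd s (ℓ + 2 * j))
    (integrable_norm_sq_hermiteProd s _)).const_mul (‖L‖ ^ 2)).mono' (hm.norm.pow 2)
      (Filter.Eventually.of_forall fun y => ?_)⟩
  rw [norm_pow, norm_norm, ← mul_pow]
  exact pow_le_pow_left₀ (norm_nonneg _) (L.le_opNorm _) 2

lemma iterTrace_condMean_ae_eq_zero {ℓ j : ℕ} (h : traceEnergy ρ ℓ j = 0) :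
    (fun y => iterTrace s ℓ j (condMean ρ (hermiteProd (ℓ + 2 * j) 1) y))
      =ᵐ[(baseMIM ρ).fst] 0 := by
  have := (integral_eq_zero_iff_of_nonneg (fun _ => by positivity)
    (integrable_iterTrace_condMean ρ ℓ j).2).mp h
  filter_upwards [this] with y hy
  simpa using hy

lemma condMean_taylorTensor_ae_eq (ℓ j : ℕ) :
    condMean ρ (taylorTensor ℓ j) =ᵐ[(baseMIM ρ).fst] fun y =>
      ((-(1 / 2 : ℝ)) ^ j / j.factorial) •
        iterTrace s ℓ j (condMean ρ (hermiteProd (ℓ + 2 * j) 1) y) :=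
  condMean_linearMap ρ (integrable_hermiteProd s (ℓ + 2 * j))
    (((-(1 / 2 : ℝ)) ^ j / j.factorial) • iterTrace s ℓ j)

lemma condMean_taylorTensor_ae_eq_zero {ℓ j : ℕ} (h : traceEnergy ρ ℓ j = 0) :
    condMean ρ (taylorTensor ℓ j) =ᵐ[(baseMIM ρ).fst] 0 := by
  filter_upwards [condMean_taylorTensor_ae_eq ρ ℓ j, iterTrace_condMean_ae_eq_zero ρ h]
    with y h1 h2
  rw [h1, h2]
  simp

/-! ### The generative exponent and the contraction index -/

lemma hermiteNormSq_eq (hW : W ∈ Stiefel d s) (k : ℕ) :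
    hermiteNormSq ρ W k = ((√(k.factorial : ℝ))⁻¹) ^ 2 * traceEnergy ρ k 0 := by
  rw [hermiteNormSq, traceEnergy, ← integral_const_mul, ← labelLaw_eq ρ hW]
  refine integral_congr_ae ?_
  filter_upwards [hermiteCoeff_ae_eq ρ hW k] with y hy
  rw [hy, norm_smul, norm_frameTensor hW, mul_pow, Real.norm_eq_abs, sq_abs]
  rfl

lemma genExponent_eq (hW : W ∈ Stiefel d s) :
    genExponent ρ W = sInf {k : ℕ | 1 ≤ k ∧ 0 < traceEnergy ρ k 0} := by
  rw [genExponent]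
  congr 1
  ext k
  have : 0 < ((√(k.factorial : ℝ))⁻¹) ^ 2 := by positivity
  simp only [Set.mem_ofPred_eq, hermiteNormSq_eq ρ hW, mul_pos_iff_of_pos_left this]

/-- Here j < ⌈(k - ℓ)/2⌉ means ℓ + 2j < k, so the Hermite coefficient vanishes before any trace is
taken. If there is no generative exponent, its default value 0 makes the gap 0 and the claim empty.
-/
lemma traceEnergy_eq_zero_of_lt_halfGap (hW : W ∈ Stiefel d s) {ℓ j : ℕ} (hℓ : 1 ≤ ℓ)
    (hj : j < halfGap ρ W ℓ) : traceEnergy ρ ℓ j = 0 := by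
  have h1 : ℓ + 2 * j < genExponent ρ W := by
    have := Nat.lt_ceil.mp hj
    rify
    linarith
  have h2 := Nat.notMem_of_lt_sInf (h1.trans_eq (genExponent_eq ρ hW))
  have h3 : traceEnergy ρ (ℓ + 2 * j) 0 = 0 := by
    refine le_antisymm (not_lt.mp fun h => h2 ⟨by omega, h⟩) (traceEnergy_nonneg ρ _ _)
  have h4 := iterTrace_condMean_ae_eq_zero ρ h3
  have h5 : (fun y => ‖iterTrace s ℓ j (condMean ρ (hermiteProd (ℓ + 2 * j) 1) y)‖ ^ 2)
      =ᵐ[(baseMIM ρ).fst] 0 := by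
    filter_upwards [h4] with y hy
    have hy' : condMean ρ (hermiteProd (ℓ + 2 * j) 1) y = 0 := hy
    simp [hy']
  rw [traceEnergy, integral_congr_ae h5]
  simp

/-- Traces commute with the frame, and the traceless projection costs at most a factor 2^ℓ, so
positivity can be read off in dimension s without the projection. -/
lemma contraction_pos_iff (hW : W ∈ Stiefel d s) (hd : 2 * s ≤ d) (ℓ j : ℕ) :
    0 < ∫ y, ‖projTF d ℓ (iterTrace d ℓ j (hermiteCoeff ρ W (ℓ + 2 * j) y))‖ ^ 2 ∂(labelLaw ρ W) ↔
      0 < traceEnergy ρ ℓ j := by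
  set c : ℝ := (√((ℓ + 2 * j).factorial : ℝ))⁻¹
  have hc : 0 < c ^ 2 := by positivity
  have h1 : ∫ y, ‖projTF d ℓ (iterTrace d ℓ j (hermiteCoeff ρ W (ℓ + 2 * j) y))‖ ^ 2
      ∂(labelLaw ρ W) = c ^ 2 * ∫ y, ‖projTF d ℓ (frameTensor W ℓ
        (iterTrace s ℓ j (condMean ρ (hermiteProd (ℓ + 2 * j) 1) y)))‖ ^ 2 ∂(baseMIM ρ).fst := by
    rw [← integral_const_mul, ← labelLaw_eq ρ hW]
    refine integral_congr_ae ?_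
    filter_upwards [hermiteCoeff_ae_eq ρ hW (ℓ + 2 * j)] with y hy
    rw [hy, map_smul, iterTrace_frameTensor hW, map_smul, norm_smul, mul_pow, Real.norm_eq_abs,
      sq_abs]
  obtain ⟨h2, h3⟩ := integral_norm_sq_projTF_frameTensor_bounds hW hd
    (integrable_iterTrace_condMean ρ ℓ j).1 (integrable_iterTrace_condMean ρ ℓ j).2
    fun y => iterTrace_mem_symTensors j
      (condMean_mem_symTensors ρ (hermiteProd_mem_symTensors _ _) y)
  rw [h1, mul_pos_iff_of_pos_left hc]
  refine ⟨fun h => h.trans_le h3, fun h => ?_⟩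
  have := h.trans_le h2
  exact pos_of_mul_pos_right this (by positivity)

lemma contractionIndex_eq (hW : W ∈ Stiefel d s) (hd : 2 * s ≤ d) (ℓ : ℕ) :
    contractionIndex ρ W ℓ =
      ⨅ j ∈ {j : ℕ | 0 < traceEnergy ρ ℓ (halfGap ρ W ℓ + j)}, (j : ℕ∞) := by
  rw [contractionIndex]
  simp only [contraction_pos_iff ρ hW hd]

lemma directionalRate_eq_zero (hW : W ∈ Stiefel d s) (hd : 2 * s ≤ d) {ℓ : ℕ}
    (h : ∀ j, traceEnergy ρ ℓ j = 0) : directionalRate ρ W ℓ = 0 := by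
  rw [directionalRate, if_pos]
  rw [contractionIndex_eq ρ hW hd]
  simp [h]

/-- No trace is nonzero before the gap, so the gap and the contraction index add up to the first
nonzero order J. -/
lemma directionalRate_eq (hW : W ∈ Stiefel d s) (hd : 2 * s ≤ d) {ℓ J : ℕ} (hℓ : 1 ≤ ℓ)
    (hJ : 0 < traceEnergy ρ ℓ J) (h0 : ∀ j < J, traceEnergy ρ ℓ j = 0) :
    directionalRate ρ W ℓ = (d : ℝ) ^ (-(2 * J : ℝ)) := by
  have hgap : halfGap ρ W ℓ ≤ J := by
    by_contra hlt
    exact hJ.ne' (traceEnergy_eq_zero_of_lt_halfGap ρ hW hℓ (not_le.mp hlt))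
  have hidx : contractionIndex ρ W ℓ = ((J - halfGap ρ W ℓ : ℕ) : ℕ∞) := by
    rw [contractionIndex_eq ρ hW hd]
    refine le_antisymm (iInf₂_le _ ?_) (le_iInf₂ fun j hj => ?_)
    · simp only [Set.mem_ofPred_eq]
      rwa [Nat.add_sub_cancel' hgap]
    · have hj' : 0 < traceEnergy ρ ℓ (halfGap ρ W ℓ + j) := hj
      have : J ≤ halfGap ρ W ℓ + j := by
        by_contra hlt
        exact hj'.ne' (h0 _ (not_le.mp hlt))
      exact_mod_cast (by omega : J - halfGap ρ W ℓ ≤ j)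
  rw [directionalRate, hidx, if_neg (ENat.natCast_ne_top _), ENat.toNat_natCast, Nat.cast_sub hgap]
  congr 1
  ring

/-! ### Rates -/

/-- The J-th Taylor term has size d^{-(ℓ/2+J)} by the bounds on `betaCoeff`, and the remainder after
it is smaller by a factor 1/d in L²; conditioning does not increase the L² norm of the remainder. -/
lemma exists_mixTensor_energy_bounds {ℓ J : ℕ} (hℓ : 1 ≤ ℓ) (hJ : 0 < traceEnergy ρ ℓ J)
    (h0 : ∀ j < J, traceEnergy ρ ℓ j = 0) :
    ∃ c : ℝ, 0 < c ∧ ∃ c' : ℝ, 0 < c' ∧ ∃ D : ℕ, ∀ d : ℕ, D ≤ d →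
      c * ((d : ℝ) ^ (-((ℓ : ℝ) / 2 + J))) ^ 2 ≤
        ∫ y, ‖condMean ρ (mixTensor d ℓ) y‖ ^ 2 ∂(baseMIM ρ).fst ∧
      ∫ y, ‖condMean ρ (mixTensor d ℓ) y‖ ^ 2 ∂(baseMIM ρ).fst ≤
        c' * ((d : ℝ) ^ (-((ℓ : ℝ) / 2 + J))) ^ 2 := by
  obtain ⟨b, hb0, b', hb'0, hb⟩ := exists_betaCoeff_bounds hℓ J
  obtain ⟨K, hK0, q, D, hK⟩ := exists_norm_mixTensor_sub_mixTaylor_le s hℓ (J + 1)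
  set a : ℝ := (-(1 / 2 : ℝ)) ^ J / J.factorial with ha
  have ha0 : 0 < a ^ 2 := by positivity
  set τ := traceEnergy ρ ℓ J with hτ
  let T : Y → Tensor s ℓ := fun y => iterTrace s ℓ J (condMean ρ (hermiteProd (ℓ + 2 * J) 1) y)
  have hT2 : Integrable (fun y => ‖T y‖ ^ 2) (baseMIM ρ).fst :=
    (integrable_iterTrace_condMean ρ ℓ J).2
  set M : ℝ := ∫ t, ((1 + ‖t‖) ^ q) ^ 2 ∂(stdGaussian (EuclideanSpace ℝ (Fin s))) with hM
  have hM0 : 0 ≤ M := integral_nonneg fun _ => by positivity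
  set A : ℝ := K ^ 2 * M with hA
  have hA0 : 0 ≤ A := by positivity
  -- The triangle inequality keeps half of the leading energy, bounded below by b²a²τ x², and the
  -- last term of the threshold makes the remainder at most a quarter of that bound.
  refine ⟨b ^ 2 * (a ^ 2 * τ) / 4, by positivity, 2 * b' ^ 2 * (a ^ 2 * τ) + 2 * A, by positivity,
    D + 2 * s + ℓ + 2 + ⌈4 * A / (b ^ 2 * (a ^ 2 * τ))⌉₊, fun d hd => ?_⟩
  set x : ℝ := (d : ℝ) ^ (-((ℓ : ℝ) / 2 + J)) with hx
  obtain ⟨hβ1, hβ2⟩ := hb d (by omega)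
  rw [← hx] at hβ1 hβ2
  set β := betaCoeff d ℓ J with hβ
  have hd1 : (1 : ℝ) ≤ d := by exact_mod_cast (by omega : 1 ≤ d)
  have hd0 : (0 : ℝ) < d := by linarith
  have hx0 : 0 < x := by positivity
  have hxd : (d : ℝ) ^ (-((ℓ : ℝ) / 2 + (J + 1 : ℕ))) = x / d := by
    rw [hx, ← Real.rpow_sub_one hd0.ne']
    congr 1
    push_cast
    ring
  have hmix := integrable_mixTensor (s := s) hℓ (by omega : 2 * s + ℓ < d)
  let R : EuclideanSpace ℝ (Fin s) → Tensor s ℓ := fun t =>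
    mixTensor d ℓ t - mixTaylor d ℓ (J + 1) t
  have htay : Integrable (mixTaylor (s := s) d ℓ (J + 1))
      (stdGaussian (EuclideanSpace ℝ (Fin s))) :=
    integrable_finsetSum _ fun j _ => (integrable_taylorTensor ℓ j).smul (betaCoeff d ℓ j)
  have hR : Integrable R (stdGaussian (EuclideanSpace ℝ (Fin s))) := hmix.sub htay
  have hRle : ∀ t, ‖R t‖ ≤ K * (x / d) * (1 + ‖t‖) ^ q := fun t => by
    rw [← hxd]
    exact hK d (by omega) t
  have hR2 := integrable_norm_sq_of_norm_le_pow hR.1 hRle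
  have hRE : ∫ y, ‖condMean ρ R y‖ ^ 2 ∂(baseMIM ρ).fst ≤ A * (x / d) ^ 2 := by
    refine (integral_norm_sq_condMean_le ρ hR hR2).trans ?_
    have hq2 : Integrable (fun t : EuclideanSpace ℝ (Fin s) => ((1 + ‖t‖) ^ q) ^ 2)
        (stdGaussian (EuclideanSpace ℝ (Fin s))) := by
      simp_rw [← pow_mul]
      exact integrable_one_add_norm_pow s _
    calc ∫ t, ‖R t‖ ^ 2 ∂(stdGaussian (EuclideanSpace ℝ (Fin s)))
        ≤ ∫ t, (K * (x / d)) ^ 2 * ((1 + ‖t‖) ^ q) ^ 2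
          ∂(stdGaussian (EuclideanSpace ℝ (Fin s))) := by
          refine integral_mono hR2 (hq2.const_mul _) fun t => ?_
          simp only
          rw [← mul_pow]
          exact pow_le_pow_left₀ (norm_nonneg _) (hRle t) 2
      _ = A * (x / d) ^ 2 := by
          rw [integral_const_mul, hA, ← hM]
          ring
  have hCR := integrable_norm_sq_condMean ρ hR hR2
  have hmix2 : Integrable (fun t => ‖mixTensor (s := s) d ℓ t‖ ^ 2)
      (stdGaussian (EuclideanSpace ℝ (Fin s))) := by
    obtain ⟨K', hK'⟩ := exists_norm_mixTensor_le (s := s) hℓ (by omega : 2 * s + ℓ < d)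
    exact integrable_norm_sq_of_norm_le_pow hmix.1 hK'
  have hCM := integrable_norm_sq_condMean ρ hmix hmix2
  -- The terms of order j < J vanish by `h0`, so the conditional mean is the J-th Taylor term plus
  -- that of R.
  have hae : ∀ᵐ y ∂(baseMIM ρ).fst,
      condMean ρ (mixTensor d ℓ) y = (β * a) • T y + condMean ρ R y := by
    have hz : ∀ᵐ y ∂(baseMIM ρ).fst, ∀ j, j < J → condMean ρ (taylorTensor ℓ j) y = 0 :=
      ae_all_iff.mpr fun j => by
        by_cases hj : j < J
        · filter_upwards [condMean_taylorTensor_ae_eq_zero ρ (h0 j hj)] with y hy _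
          exact hy
        · exact Filter.Eventually.of_forall fun y h => absurd h hj
    have hi : ∀ᵐ y ∂(baseMIM ρ).fst, ∀ j,
        Integrable (taylorTensor (s := s) ℓ j) ((baseMIM ρ).condKernel y) :=
      ae_all_iff.mpr fun j => integrable_condKernel_baseMIM ρ (integrable_taylorTensor ℓ j)
    filter_upwards [hz, hi, integrable_condKernel_baseMIM ρ hmix,
      condMean_taylorTensor_ae_eq ρ ℓ J] with y h1 h2 h3 h4
    have e : condMean ρ R y = condMean ρ (mixTensor d ℓ) y -
        ∑ j ∈ Finset.range (J + 1), betaCoeff d ℓ j • condMean ρ (taylorTensor ℓ j) y := by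
      have hs : ∀ j ∈ Finset.range (J + 1), Integrable (fun t => betaCoeff d ℓ j •
          taylorTensor (s := s) ℓ j t) ((baseMIM ρ).condKernel y) :=
        fun j _ => (h2 j).smul (betaCoeff d ℓ j)
      simp only [condMean, R, mixTaylor]
      rw [integral_sub h3 (integrable_finsetSum _ hs), integral_finsetSum _ hs]
      simp_rw [integral_smul]
    rw [e, Finset.sum_range_succ, Finset.sum_eq_zero fun j hj => by
      rw [h1 j (Finset.mem_range.mp hj), smul_zero], h4, zero_add, smul_smul]
    change _ = (β * a) • T y + (_ - (β * a) • T y)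
    rw [add_sub_cancel]
  have hTE : ∫ y, (β * a) ^ 2 * ‖T y‖ ^ 2 ∂(baseMIM ρ).fst = β ^ 2 * (a ^ 2 * τ) := by
    rw [integral_const_mul, mul_pow, mul_assoc]
    rfl
  have hupper : ∫ y, ‖condMean ρ (mixTensor d ℓ) y‖ ^ 2 ∂(baseMIM ρ).fst ≤
      2 * (β ^ 2 * (a ^ 2 * τ)) + 2 * ∫ y, ‖condMean ρ R y‖ ^ 2 ∂(baseMIM ρ).fst := by
    rw [← hTE, ← integral_const_mul, ← integral_const_mul,
      ← integral_add ((hT2.const_mul _).const_mul _) (hCR.const_mul _)]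
    refine integral_mono_ae hCM (((hT2.const_mul _).const_mul _).add (hCR.const_mul _)) ?_
    filter_upwards [hae] with y hy
    rw [hy]
    have h1 := norm_add_le ((β * a) • T y) (condMean ρ R y)
    have h2 : (β * a) ^ 2 * ‖T y‖ ^ 2 = ‖(β * a) • T y‖ ^ 2 := by
      rw [norm_smul, Real.norm_eq_abs, mul_pow |β * a|, sq_abs]
    rw [h2]
    nlinarith [sq_nonneg (‖(β * a) • T y‖ - ‖condMean ρ R y‖),
      norm_nonneg ((β * a) • T y + condMean ρ R y)]
  have hlower : β ^ 2 * (a ^ 2 * τ) ≤ 2 * ∫ y, ‖condMean ρ (mixTensor d ℓ) y‖ ^ 2 ∂(baseMIM ρ).fst +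
      2 * ∫ y, ‖condMean ρ R y‖ ^ 2 ∂(baseMIM ρ).fst := by
    rw [← hTE, ← integral_const_mul, ← integral_const_mul,
      ← integral_add (hCM.const_mul _) (hCR.const_mul _)]
    refine integral_mono_ae (hT2.const_mul _) ((hCM.const_mul _).add (hCR.const_mul _)) ?_
    filter_upwards [hae] with y hy
    have h1 := norm_sub_le (condMean ρ (mixTensor d ℓ) y) (condMean ρ R y)
    have h2 : (β * a) ^ 2 * ‖T y‖ ^ 2 = ‖condMean ρ (mixTensor d ℓ) y - condMean ρ R y‖ ^ 2 := by
      rw [hy, add_sub_cancel_right, norm_smul, Real.norm_eq_abs, mul_pow |β * a|, sq_abs]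
    rw [h2]
    nlinarith [sq_nonneg (‖condMean ρ (mixTensor d ℓ) y‖ - ‖condMean ρ R y‖),
      norm_nonneg (condMean ρ (mixTensor d ℓ) y - condMean ρ R y)]
  have hβ1' : (b * x) ^ 2 ≤ β ^ 2 := pow_le_pow_left₀ (by positivity) hβ1 2
  have hβ2' : β ^ 2 ≤ (b' * x) ^ 2 := pow_le_pow_left₀ ((by positivity : 0 ≤ b * x).trans hβ1) hβ2 2
  have haτ : 0 < a ^ 2 * τ := by positivity
  have hxd2 : (x / d) ^ 2 ≤ x ^ 2 :=
    pow_le_pow_left₀ (by positivity) (div_le_self hx0.le hd1) 2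
  constructor
  · have h1 : A * (x / d) ^ 2 ≤ b ^ 2 * (a ^ 2 * τ) / 4 * x ^ 2 := by
      have h2 : 4 * A / (b ^ 2 * (a ^ 2 * τ)) ≤ d := by
        refine (Nat.le_ceil _).trans ?_
        exact_mod_cast (by omega : ⌈4 * A / (b ^ 2 * (a ^ 2 * τ))⌉₊ ≤ d)
      rw [div_le_iff₀ (by positivity)] at h2
      have h3 : (x / d) ^ 2 = x ^ 2 / d ^ 2 := div_pow _ _ _
      rw [h3, ← mul_div_assoc, div_le_iff₀ (by positivity)]
      have h4 : A ≤ b ^ 2 * (a ^ 2 * τ) / 4 * d ^ 2 := by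
        have : (d : ℝ) ≤ d ^ 2 := by nlinarith
        have : (d : ℝ) * (b ^ 2 * (a ^ 2 * τ)) ≤ d ^ 2 * (b ^ 2 * (a ^ 2 * τ)) := by gcongr
        linarith
      calc A * x ^ 2 ≤ b ^ 2 * (a ^ 2 * τ) / 4 * d ^ 2 * x ^ 2 := by gcongr
        _ = _ := by ring
    have h5 := mul_le_mul_of_nonneg_right hβ1' haτ.le
    rw [mul_pow] at h5
    linarith
  · have h5 := mul_le_mul_of_nonneg_right hβ2' haτ.le
    rw [mul_pow] at h5
    have h6 := mul_le_mul_of_nonneg_left hxd2 hA0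
    linarith

lemma normalization_bounds {ℓ : ℕ} (hd : 3 ≤ d) (hℓ : 1 ≤ ℓ) :
    (d : ℝ) ^ ℓ ≤ (kappa d ℓ * √(harmonicDim d ℓ)) ^ 2 * ℓ.factorial ∧
      (kappa d ℓ * √(harmonicDim d ℓ)) ^ 2 * ℓ.factorial ≤ (1 + 2 * (ℓ : ℝ)) ^ ℓ * (d : ℝ) ^ ℓ := by
  rw [kappa_sq_mul_harmonicDim hd hℓ]
  have hd1 : (1 : ℝ) ≤ d := by exact_mod_cast (by omega : 1 ≤ d)
  constructor
  · calc (d : ℝ) ^ ℓ = ∏ _i ∈ Finset.range ℓ, (d : ℝ) := by simp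
      _ ≤ _ := Finset.prod_le_prod (fun i _ => by positivity) fun i _ => by
        have : (0 : ℝ) ≤ i := by positivity
        linarith
  · calc ∏ i ∈ Finset.range ℓ, ((d : ℝ) + 2 * i)
        ≤ ∏ _i ∈ Finset.range ℓ, ((1 + 2 * (ℓ : ℝ)) * d) :=
          Finset.prod_le_prod (fun i _ => by positivity) fun i hi => by
            have : (i : ℝ) ≤ ℓ := by exact_mod_cast (Finset.mem_range.mp hi).le
            nlinarith
      _ = _ := by simp [mul_pow]

lemma harmonicNormSq_bounds_mixTensor (hW : W ∈ Stiefel d s) {ℓ : ℕ} (hℓ : 1 ≤ ℓ)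
    (hd : 2 * s + ℓ < d) (hd3 : 3 ≤ d) :
    (2 ^ ℓ * ℓ.factorial * Real.Gamma ((ℓ : ℝ) / 2) ^ 2 : ℝ)⁻¹ * (d : ℝ) ^ ℓ *
        ∫ y, ‖condMean ρ (mixTensor d ℓ) y‖ ^ 2 ∂(baseMIM ρ).fst ≤ harmonicNormSq ρ W ℓ ∧
      harmonicNormSq ρ W ℓ ≤
        (1 + 2 * (ℓ : ℝ)) ^ ℓ * (ℓ.factorial * Real.Gamma ((ℓ : ℝ) / 2) ^ 2 : ℝ)⁻¹ * (d : ℝ) ^ ℓ *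
          ∫ y, ‖condMean ρ (mixTensor d ℓ) y‖ ^ 2 ∂(baseMIM ρ).fst := by
  have hmix := integrable_mixTensor (s := s) hℓ hd
  have hmix2 : Integrable (fun t => ‖mixTensor (s := s) d ℓ t‖ ^ 2)
      (stdGaussian (EuclideanSpace ℝ (Fin s))) := by
    obtain ⟨K', hK'⟩ := exists_norm_mixTensor_le (s := s) hℓ hd
    exact integrable_norm_sq_of_norm_le_pow hmix.1 hK'
  obtain ⟨h1, h2⟩ := integral_norm_sq_projTF_frameTensor_bounds hW (by omega)
    (integrable_condMean ρ hmix).1 (integrable_norm_sq_condMean ρ hmix hmix2)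
    (condMean_mem_symTensors ρ (mixTensor_mem_symTensors d ℓ))
  obtain ⟨h3, h4⟩ := normalization_bounds (ℓ := ℓ) hd3 hℓ
  rw [harmonicNormSq_eq_mixTensor ρ hW hℓ hd, mul_pow, inv_pow]
  set E := ∫ y, ‖condMean ρ (mixTensor d ℓ) y‖ ^ 2 ∂(baseMIM ρ).fst
  set P := ∫ y, ‖projTF d ℓ (frameTensor W ℓ (condMean ρ (mixTensor d ℓ) y))‖ ^ 2 ∂(baseMIM ρ).fst
  set N := (kappa d ℓ * √(harmonicDim d ℓ)) ^ 2
  have hΓ : 0 < Real.Gamma ((ℓ : ℝ) / 2) := Real.Gamma_pos_of_pos (by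
    have : (0 : ℝ) < ℓ := by exact_mod_cast hℓ
    positivity)
  set G := Real.Gamma ((ℓ : ℝ) / 2)
  have hf : (0 : ℝ) < ℓ.factorial := by positivity
  set f : ℝ := (ℓ.factorial : ℝ)
  have hE : 0 ≤ E := integral_nonneg fun _ => by positivity
  have hP : 0 ≤ P := integral_nonneg fun _ => by positivity
  constructor
  · calc (2 ^ ℓ * f * G ^ 2)⁻¹ * (d : ℝ) ^ ℓ * E
        ≤ (2 ^ ℓ * f * G ^ 2)⁻¹ * (N * f) * (2 ^ ℓ * P) := by gcongr
      _ = N * (G ^ 2)⁻¹ * P := by field_simp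
  · calc N * (G ^ 2)⁻¹ * P = (f * G ^ 2)⁻¹ * (N * f) * P := by field_simp
      _ ≤ (f * G ^ 2)⁻¹ * ((1 + 2 * (ℓ : ℝ)) ^ ℓ * (d : ℝ) ^ ℓ) * E := by gcongr
      _ = _ := by ring

lemma harmonicNormSq_eq_zero (hW : W ∈ Stiefel d s) {ℓ : ℕ} (hℓ : 1 ≤ ℓ)
    (hd : 2 * s + ℓ < d) (h : ∀ j, traceEnergy ρ ℓ j = 0) : harmonicNormSq ρ W ℓ = 0 := by
  have h1 := condMean_mixTensor_ae_eq_zero ρ hℓ hd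
    fun j => condMean_taylorTensor_ae_eq_zero ρ (h j)
  have h2 : (fun y => ‖projTF d ℓ (frameTensor W ℓ (condMean ρ (mixTensor d ℓ) y))‖ ^ 2)
      =ᵐ[(baseMIM ρ).fst] 0 := by
    filter_upwards [h1] with y hy
    simp [hy]
  rw [harmonicNormSq_eq_mixTensor ρ hW hℓ hd, integral_congr_ae h2]
  simp

/-- The normalization κ²N, of order d^ℓ, cancels the factor d^{-ℓ} in the energy d^{-ℓ-2J} of the
mixture. -/
lemma exists_harmonicNormSq_bounds {ℓ J : ℕ} (hℓ : 1 ≤ ℓ) (hJ : 0 < traceEnergy ρ ℓ J)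
    (h0 : ∀ j < J, traceEnergy ρ ℓ j = 0) :
    ∃ c : ℝ, 0 < c ∧ ∃ c' : ℝ, 0 < c' ∧ ∃ D : ℕ, ∀ d : ℕ, D ≤ d → ∀ W ∈ Stiefel d s,
      c * (d : ℝ) ^ (-(2 * J : ℝ)) ≤ harmonicNormSq ρ W ℓ ∧
      harmonicNormSq ρ W ℓ ≤ c' * (d : ℝ) ^ (-(2 * J : ℝ)) := by
  obtain ⟨c, hc, c', hc', D, hD⟩ := exists_mixTensor_energy_bounds ρ hℓ hJ h0
  have hΓ : 0 < Real.Gamma ((ℓ : ℝ) / 2) := Real.Gamma_pos_of_pos (by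
    have : (0 : ℝ) < ℓ := by exact_mod_cast hℓ
    positivity)
  refine ⟨(2 ^ ℓ * ℓ.factorial * Real.Gamma ((ℓ : ℝ) / 2) ^ 2 : ℝ)⁻¹ * c, by positivity,
    (1 + 2 * (ℓ : ℝ)) ^ ℓ * (ℓ.factorial * Real.Gamma ((ℓ : ℝ) / 2) ^ 2 : ℝ)⁻¹ * c', by positivity,
    D + 2 * s + ℓ + 3, fun d hd W hW => ?_⟩
  obtain ⟨h1, h2⟩ := harmonicNormSq_bounds_mixTensor ρ hW hℓ (by omega) (by omega)
  obtain ⟨h3, h4⟩ := hD d (by omega)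
  have hd0 : (0 : ℝ) < d := by exact_mod_cast (by omega : 0 < d)
  have e : (d : ℝ) ^ ℓ * ((d : ℝ) ^ (-((ℓ : ℝ) / 2 + J))) ^ 2 = (d : ℝ) ^ (-(2 * J : ℝ)) := by
    rw [← Real.rpow_natCast, ← Real.rpow_natCast _ 2, ← Real.rpow_mul hd0.le,
      ← Real.rpow_add hd0]
    congr 1
    push_cast
    ring
  rw [← e]
  constructor
  · refine le_trans (le_trans (le_of_eq ?_) (mul_le_mul_of_nonneg_left h3
      (by positivity : 0 ≤ (2 ^ ℓ * ℓ.factorial * Real.Gamma ((ℓ : ℝ) / 2) ^ 2 : ℝ)⁻¹ *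
        (d : ℝ) ^ ℓ))) h1
    ring
  · refine h2.trans ((mul_le_mul_of_nonneg_left h4 (by positivity)).trans (le_of_eq ?_))
    ring

/-- Either some trace is nonzero and its first order gives the rate, or none is; then the rate is
zero, and analyticity makes the harmonic coefficient vanish exactly. -/
lemma exists_harmonicNormSq_directionalRate_bounds {ℓ : ℕ} (hℓ : 1 ≤ ℓ) :
    ∃ c : ℝ, 0 < c ∧ ∃ c' : ℝ, 0 < c' ∧ ∃ D : ℕ, ∀ d : ℕ, D ≤ d → ∀ W ∈ Stiefel d s,
      c * directionalRate ρ W ℓ ≤ harmonicNormSq ρ W ℓ ∧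
      harmonicNormSq ρ W ℓ ≤ c' * directionalRate ρ W ℓ := by
  classical
  by_cases h : ∃ j, 0 < traceEnergy ρ ℓ j
  · have h0 : ∀ j < Nat.find h, traceEnergy ρ ℓ j = 0 := fun j hj =>
      le_antisymm (not_lt.mp (Nat.find_min h hj)) (traceEnergy_nonneg ρ ℓ j)
    obtain ⟨c, hc, c', hc', D, hD⟩ := exists_harmonicNormSq_bounds ρ hℓ (Nat.find_spec h) h0
    refine ⟨c, hc, c', hc', D + 2 * s, fun d hd W hW => ?_⟩
    rw [directionalRate_eq ρ hW (by omega) hℓ (Nat.find_spec h) h0]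
    exact hD d (by omega) W hW
  · push Not at h
    have h0 : ∀ j, traceEnergy ρ ℓ j = 0 := fun j => le_antisymm (h j) (traceEnergy_nonneg ρ ℓ j)
    refine ⟨1, one_pos, 1, one_pos, 2 * s + ℓ + 1, fun d hd W hW => ?_⟩
    rw [directionalRate_eq_zero ρ hW (by omega) h0,
      harmonicNormSq_eq_zero ρ hW hℓ (by omega) h0]
    simp

end Models

/-! ### Comparison of the complexities -/

lemma comparable_div {A h c₁ c₂ c c' : ℝ} (hA : 0 ≤ A) (hc₁ : 0 < c₁) (h₁ : c₁ ≤ h) (h₂ : h ≤ c₂)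
    (hc : c ≤ c₂⁻¹) (hc' : c₁⁻¹ ≤ c') :
    Comparable c c' (ENNReal.ofReal A / ENNReal.ofReal h) A := by
  have hh : 0 < h := hc₁.trans_le h₁
  rw [Comparable, ← ENNReal.ofReal_div_of_pos hh]
  constructor <;> refine ENNReal.ofReal_le_ofReal ?_ <;> rw [div_eq_inv_mul]
  · refine mul_le_mul_of_nonneg_right (hc.trans ?_) hA
    exact inv_anti₀ hh h₂
  · refine mul_le_mul_of_nonneg_right (le_trans ?_ hc') hA
    exact inv_anti₀ hc₁ h₁

lemma div_le_mul_div {A B h g c₁ C c' : ℝ} (hA : 0 ≤ A) (hB : 0 < B) (hc₁ : 0 < c₁) (h₁ : c₁ ≤ h)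
    (hc' : 0 < c') (hCc : C / c₁ ≤ c') (hg : g * A ≤ C * B) :
    ENNReal.ofReal A / ENNReal.ofReal h ≤
      ENNReal.ofReal c' * (ENNReal.ofReal B / ENNReal.ofReal g) := by
  have hh : 0 < h := hc₁.trans_le h₁
  -- A vanishing harmonic coefficient makes the right-hand side infinite.
  rcases le_or_gt g 0 with hg0 | hg0
  · rw [ENNReal.ofReal_of_nonpos hg0, ENNReal.div_zero (ENNReal.ofReal_pos.mpr hB).ne',
      ENNReal.mul_top (ENNReal.ofReal_pos.mpr hc').ne']
    exact le_top
  · rw [← ENNReal.ofReal_div_of_pos hh, ← ENNReal.ofReal_div_of_pos hg0,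
      ← ENNReal.ofReal_mul hc'.le]
    refine ENNReal.ofReal_le_ofReal ?_
    have h2 : A / h ≤ A / c₁ := div_le_div_of_nonneg_left hA hc₁ h₁
    have h3 : A ≤ C * B / g := by
      rw [le_div_iff₀ hg0]
      linarith
    calc A / h ≤ A / c₁ := h2
      _ ≤ C * B / g / c₁ := by gcongr
      _ = C / c₁ * (B / g) := by ring
      _ ≤ c' * (B / g) := by gcongr

section Models

variable {Y : Type*} [MeasurableSpace Y] {s : ℕ} (ρ : Kernel (EuclideanSpace ℝ (Fin s)) Y)
  [IsMarkovKernel ρ]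

/-- The contraction index can only decrease the rate, so the comparison of degrees may ignore it and
use the gap alone. -/
lemma exists_harmonicNormSq_le {k ℓ : ℕ} (hℓ : 1 ≤ ℓ)
    (hk : ∀ (d : ℕ), ∀ W ∈ Stiefel d s, genExponent ρ W = k) :
    ∃ c : ℝ, 0 < c ∧ ∃ D : ℕ, ∀ d : ℕ, D ≤ d → ∀ W ∈ Stiefel d s,
      harmonicNormSq ρ W ℓ ≤ c * (d : ℝ) ^ (-(2 * (⌈((k : ℝ) - ℓ) / 2⌉₊ : ℝ))) := by
  obtain ⟨_, _, c, hc, D, hD⟩ := exists_harmonicNormSq_directionalRate_bounds ρ hℓ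
  refine ⟨c, hc, D + 1, fun d hd W hW => ((hD d (by omega) W hW).2).trans ?_⟩
  refine mul_le_mul_of_nonneg_left ?_ hc.le
  have hd1 : (1 : ℝ) ≤ d := by exact_mod_cast (by omega : 1 ≤ d)
  rw [directionalRate]
  split_ifs
  · positivity
  · refine Real.rpow_le_rpow_of_exponent_le hd1 ?_
    rw [halfGap, hk d W hW]
    have : (0 : ℝ) ≤ ((contractionIndex ρ W ℓ).toNat : ℝ) := by positivity
    linarith

/-- A comparison of degree `ℓ` with the generative exponent, for exponents `e` that grow fast
enough. -/
lemma exists_harmonicNormSq_mul_rpow_le {k : ℕ} (hk1 : 1 ≤ k)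
    (hk : ∀ (d : ℕ), ∀ W ∈ Stiefel d s, genExponent ρ W = k) :
    ∃ C : ℝ, 0 < C ∧ ∃ D : ℕ, ∀ d : ℕ, D ≤ d → ∀ W ∈ Stiefel d s, ∀ ℓ : ℕ, 1 ≤ ℓ → ∀ e : ℕ → ℝ,
      (ℓ ≤ k → e k - e ℓ ≤ 2 * (⌈((k : ℝ) - ℓ) / 2⌉₊ : ℝ)) →
      (k < ℓ → ((ℓ : ℝ) - max k 2) / 2 ≤ e ℓ - e k) →
      harmonicNormSq ρ W ℓ * (d : ℝ) ^ e k ≤ C * (d : ℝ) ^ e ℓ := by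
  choose! c hc D hD using fun ℓ (hℓ : 1 ≤ ℓ) => exists_harmonicNormSq_le ρ hℓ hk
  have hc0 : ∀ ℓ ∈ Finset.Icc 1 k, 0 ≤ c ℓ := fun ℓ hℓ => (hc ℓ (Finset.mem_Icc.mp hℓ).1).le
  have hsum : 0 ≤ ∑ ℓ ∈ Finset.Icc 1 k, c ℓ := Finset.sum_nonneg hc0
  -- Degrees up to k are finitely many, so their constants and thresholds are summed; all degrees
  -- above k share the constant s^{max(k,2)} and the threshold s² ≤ d.
  refine ⟨∑ ℓ ∈ Finset.Icc 1 k, c ℓ + (s : ℝ) ^ (max k 2) + 1, by positivity,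
    ∑ ℓ ∈ Finset.Icc 1 k, D ℓ + s ^ 2 + 3, fun d hd W hW ℓ hℓ e h1 h2 => ?_⟩
  have hd1 : (1 : ℝ) ≤ d := by exact_mod_cast (by omega : 1 ≤ d)
  have hd0 : (0 : ℝ) < d := by linarith
  have hsp : (0 : ℝ) ≤ (s : ℝ) ^ (max k 2) := by positivity
  rcases le_or_gt ℓ k with hle | hlt
  · have hmem : ℓ ∈ Finset.Icc 1 k := Finset.mem_Icc.mpr ⟨hℓ, hle⟩
    have hDl : D ℓ ≤ d := by
      have := Finset.single_le_sum (f := D) (fun i _ => Nat.zero_le _) hmem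
      omega
    have hcl : c ℓ ≤ ∑ ℓ ∈ Finset.Icc 1 k, c ℓ := Finset.single_le_sum hc0 hmem
    have h3 := hD ℓ hℓ d hDl W hW
    calc harmonicNormSq ρ W ℓ * (d : ℝ) ^ e k
        ≤ c ℓ * (d : ℝ) ^ (-(2 * (⌈((k : ℝ) - ℓ) / 2⌉₊ : ℝ))) * (d : ℝ) ^ e k := by gcongr
      _ = c ℓ * (d : ℝ) ^ (-(2 * (⌈((k : ℝ) - ℓ) / 2⌉₊ : ℝ)) + e k) := by
          rw [mul_assoc, ← Real.rpow_add hd0]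
      _ ≤ c ℓ * (d : ℝ) ^ e ℓ := by
          refine mul_le_mul_of_nonneg_left (Real.rpow_le_rpow_of_exponent_le hd1 ?_) (hc ℓ hℓ).le
          linarith [h1 hle]
      _ ≤ _ := by
          gcongr
          linarith
  · have h3 := harmonicNormSq_le ρ hW (by omega : 3 ≤ d) hℓ
    -- Each degree beyond max(k, 2) costs a factor s ≤ d^{1/2}, paid for by the growth of e.
    -- Counting starts at 2 because for k = 1 the sample exponent max(ℓ/2, 1) and the runtime
    -- exponent take equal values at ℓ = 1 and ℓ = 2.
    have hm : max k 2 ≤ ℓ := by omega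
    have hs : (s : ℝ) ≤ (d : ℝ) ^ ((1 : ℝ) / 2) := by
      rw [← Real.sqrt_eq_rpow]
      refine Real.le_sqrt_of_sq_le ?_
      exact_mod_cast (by omega : s ^ 2 ≤ d)
    have h4 : (s : ℝ) ^ ℓ ≤ (s : ℝ) ^ (max k 2) * (d : ℝ) ^ (((ℓ : ℝ) - max k 2) / 2) := by
      calc (s : ℝ) ^ ℓ = (s : ℝ) ^ (max k 2) * (s : ℝ) ^ (ℓ - max k 2) := by
            rw [← pow_add, Nat.add_sub_cancel' hm]
        _ ≤ (s : ℝ) ^ (max k 2) * ((d : ℝ) ^ ((1 : ℝ) / 2)) ^ (ℓ - max k 2) := by gcongr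
        _ = _ := by
            rw [← Real.rpow_natCast _ (ℓ - max k 2), ← Real.rpow_mul hd0.le, Nat.cast_sub hm]
            congr 2
            push_cast
            ring
    calc harmonicNormSq ρ W ℓ * (d : ℝ) ^ e k
        ≤ (s : ℝ) ^ (max k 2) * (d : ℝ) ^ (((ℓ : ℝ) - max k 2) / 2) * (d : ℝ) ^ e k := by
          gcongr
          exact h3.trans h4
      _ = (s : ℝ) ^ (max k 2) * (d : ℝ) ^ (((ℓ : ℝ) - max k 2) / 2 + e k) := by
          rw [mul_assoc, ← Real.rpow_add hd0]
      _ ≤ (s : ℝ) ^ (max k 2) * (d : ℝ) ^ e ℓ := by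
          refine mul_le_mul_of_nonneg_left (Real.rpow_le_rpow_of_exponent_le hd1 ?_) hsp
          linarith [h2 hlt]
      _ ≤ _ := by
          gcongr
          linarith

end Models

lemma sub_le_two_mul_ceil {k ℓ : ℕ} :
    (k : ℝ) - ℓ ≤ 2 * (⌈((k : ℝ) - ℓ) / 2⌉₊ : ℝ) := by
  linarith [Nat.le_ceil (((k : ℝ) - ℓ) / 2)]

lemma parity_eq (ℓ : ℕ) : parity ℓ = 0 ∧ ℓ % 2 = 0 ∨ parity ℓ = 1 ∧ ℓ % 2 = 1 := by
  rcases Nat.mod_two_eq_zero_or_one ℓ with h | h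
  · exact Or.inl ⟨by simp [parity, h], h⟩
  · exact Or.inr ⟨by simp [parity, h], h⟩

/-- For k odd and ℓ even, k - ℓ is odd and the ceiling gains 1, which covers the extra 1/2; in all
other cases the parity term is not positive. -/
lemma sub_add_parity_le_two_mul_ceil {k ℓ : ℕ} :
    (k : ℝ) - ℓ + (parity k - parity ℓ) / 2 ≤ 2 * (⌈((k : ℝ) - ℓ) / 2⌉₊ : ℝ) := by
  have h := sub_le_two_mul_ceil (k := k) (ℓ := ℓ)
  rcases parity_eq k with ⟨h1, h1'⟩ | ⟨h1, h1'⟩ <;>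
    rcases parity_eq ℓ with ⟨h2, h2'⟩ | ⟨h2, h2'⟩ <;>
    rw [h1, h2]
  · linarith
  · linarith
  · have h3 : k ≤ ℓ + 2 * ⌈((k : ℝ) - ℓ) / 2⌉₊ := by
      rify
      linarith
    have h4 : k + 1 ≤ ℓ + 2 * ⌈((k : ℝ) - ℓ) / 2⌉₊ := by omega
    rify at h4
    linarith
  · linarith

lemma max_add_parity_sub_le {k ℓ : ℕ} (h : ℓ ≤ k) :
    (max (k : ℝ) (3 / 2) + parity k / 2) - (max (ℓ : ℝ) (3 / 2) + parity ℓ / 2) ≤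
      2 * (⌈((k : ℝ) - ℓ) / 2⌉₊ : ℝ) := by
  have h1 := sub_add_parity_le_two_mul_ceil (k := k) (ℓ := ℓ)
  have h2 : (ℓ : ℝ) ≤ k := by exact_mod_cast h
  have h3 : max (k : ℝ) (3 / 2) ≤ max (ℓ : ℝ) (3 / 2) + (k - ℓ) :=
    max_le (by linarith [le_max_left (ℓ : ℝ) (3 / 2)]) (by linarith [le_max_right (ℓ : ℝ) (3 / 2)])
  linarith

/-- For k ≥ 2 parity loses at most 1/2, while ℓ - k ≥ 1 exceeds its half by at least 1/2. For k = 1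
the subtracted exponent is 3/2 + 1/2 = 2. -/
lemma le_max_add_parity_sub {k ℓ : ℕ} (hk : 1 ≤ k) (h : k < ℓ) :
    ((ℓ : ℝ) - (max k 2 : ℕ)) / 2 ≤
      (max (ℓ : ℝ) (3 / 2) + parity ℓ / 2) - (max (k : ℝ) (3 / 2) + parity k / 2) := by
  have h2 : (2 : ℝ) ≤ ℓ := by exact_mod_cast (by omega : 2 ≤ ℓ)
  have h3 : (k : ℝ) + 1 ≤ ℓ := by exact_mod_cast h
  have h4 : 0 ≤ parity ℓ := by rcases parity_eq ℓ with h | h <;> linarith [h.1]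
  rw [max_eq_left (by linarith : (3 / 2 : ℝ) ≤ ℓ)]
  rcases Nat.lt_or_ge k 2 with hk2 | hk2
  · obtain rfl : k = 1 := by omega
    have h5 : parity 1 = 1 := by simp [parity]
    rw [h5]
    norm_num
    linarith
  · have h5 : (2 : ℝ) ≤ k := by exact_mod_cast hk2
    have h6 : parity k ≤ 1 := by rcases parity_eq k with h | h <;> linarith [h.1]
    rw [max_eq_left (by linarith : (3 / 2 : ℝ) ≤ k), max_eq_left hk2]
    linarith

/-! ### Optimality of the generative exponent -/

section Models

variable {Y : Type*} [MeasurableSpace Y] {s : ℕ} (ρ : Kernel (EuclideanSpace ℝ (Fin s)) Y)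
  [IsMarkovKernel ρ]

/-- At degree k the first nonzero trace has order J = 0, so the harmonic norm is of order one. The
four comparisons then reduce to inequalities between exponents of d, the factor log d being common
to both runtimes. -/
lemma exists_complexity_bounds {k : ℕ} (hk1 : 1 ≤ k)
    (hk : ∀ (d : ℕ), ∀ W ∈ Stiefel d s, genExponent ρ W = k) (hpos : 0 < traceEnergy ρ k 0) :
    ∃ c > (0 : ℝ), ∃ c' > (0 : ℝ), ∃ D : ℕ, ∀ d ≥ D, ∀ W ∈ Stiefel d s,
      (∀ ℓ : ℕ, 1 ≤ ℓ →
        sampleAlign ρ W k ≤ ENNReal.ofReal c' * sampleAlign ρ W ℓ ∧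
        queryAlign ρ W k ≤ ENNReal.ofReal c' * queryAlign ρ W ℓ ∧
        unfoldingSamples ρ W k ≤ ENNReal.ofReal c' * unfoldingSamples ρ W ℓ ∧
        unfoldingRuntime ρ W k ≤ ENNReal.ofReal c' * unfoldingRuntime ρ W ℓ) ∧
      Comparable c c' (sampleAlign ρ W k) ((d : ℝ) ^ ((k : ℝ) / 2)) ∧
      Comparable c c' (queryAlign ρ W k) ((d : ℝ) ^ (k : ℝ)) ∧
      Comparable c c' (unfoldingSamples ρ W k) ((d : ℝ) ^ max ((k : ℝ) / 2) 1) ∧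
      Comparable c c' (unfoldingRuntime ρ W k)
        ((d : ℝ) ^ (max (k : ℝ) (3 / 2) + parity k / 2) * Real.log d) := by
  obtain ⟨c₁, hc₁, c₂, hc₂, D₁, hD₁⟩ := exists_harmonicNormSq_bounds ρ hk1 hpos
    (fun j hj => absurd hj (Nat.not_lt_zero j))
  obtain ⟨C, hC, D₂, hD₂⟩ := exists_harmonicNormSq_mul_rpow_le ρ hk1 hk
  refine ⟨c₂⁻¹, by positivity, max (C / c₁) c₁⁻¹, by positivity, D₁ + D₂ + 2,
    fun d hd W hW => ?_⟩
  obtain ⟨h₁, h₂⟩ := hD₁ d (by omega) W hW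
  simp only [Nat.cast_zero, mul_zero, neg_zero, Real.rpow_zero, mul_one] at h₁ h₂
  have hc' : 0 < max (C / c₁) c₁⁻¹ := by positivity
  have hd2 : (2 : ℝ) ≤ d := by exact_mod_cast (by omega : 2 ≤ d)
  have hd0 : (0 : ℝ) < d := by linarith
  have hlog : 0 < Real.log d := Real.log_pos (by linarith)
  have hpow : ∀ x : ℝ, 0 < (d : ℝ) ^ x := fun x => Real.rpow_pos_of_pos hd0 x
  refine ⟨fun ℓ hℓ => ?_,
    comparable_div (hpow _).le hc₁ h₁ h₂ le_rfl (le_max_right _ _),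
    comparable_div (hpow _).le hc₁ h₁ h₂ le_rfl (le_max_right _ _),
    comparable_div (hpow _).le hc₁ h₁ h₂ le_rfl (le_max_right _ _),
    comparable_div (mul_pos (hpow _) hlog).le hc₁ h₁ h₂ le_rfl (le_max_right _ _)⟩
  have key := hD₂ d (by omega) W hW ℓ hℓ
  have hceil := sub_le_two_mul_ceil (k := k) (ℓ := ℓ)
  have hm : (k : ℝ) ≤ (max k 2 : ℕ) := by exact_mod_cast le_max_left k 2
  have hm2 : (2 : ℝ) ≤ (max k 2 : ℕ) := by exact_mod_cast le_max_right k 2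
  refine ⟨div_le_mul_div (hpow _).le (hpow _) hc₁ h₁ hc' (le_max_left _ _)
      (key (fun ℓ => (ℓ : ℝ) / 2) (fun h => ?_) (fun h => ?_)),
    div_le_mul_div (hpow _).le (hpow _) hc₁ h₁ hc' (le_max_left _ _)
      (key (fun ℓ => (ℓ : ℝ)) (fun h => ?_) (fun h => ?_)),
    div_le_mul_div (hpow _).le (hpow _) hc₁ h₁ hc' (le_max_left _ _)
      (key (fun ℓ => max ((ℓ : ℝ) / 2) 1) (fun h => ?_) (fun h => ?_)),
    div_le_mul_div (mul_pos (hpow _) hlog).le (mul_pos (hpow _) hlog) hc₁ h₁ hc' (le_max_left _ _)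
      ?_⟩
  · have : (ℓ : ℝ) ≤ k := by exact_mod_cast h
    linarith
  · linarith
  · linarith
  · have : (k : ℝ) ≤ ℓ := by exact_mod_cast h.le
    have : (max k 2 : ℕ) ≤ (ℓ : ℝ) := by exact_mod_cast (by omega : max k 2 ≤ ℓ)
    linarith
  · have : (ℓ : ℝ) ≤ k := by exact_mod_cast h
    have : max ((k : ℝ) / 2) 1 ≤ max ((ℓ : ℝ) / 2) 1 + (k - ℓ) / 2 :=
      max_le (by linarith [le_max_left ((ℓ : ℝ) / 2) 1])
        (by linarith [le_max_right ((ℓ : ℝ) / 2) 1])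
    linarith
  · have h5 : max ((k : ℝ) / 2) 1 ≤ ((max k 2 : ℕ) : ℝ) / 2 := max_le (by linarith) (by linarith)
    have := le_max_left ((ℓ : ℝ) / 2) 1
    linarith
  · have h6 := key (fun ℓ => max (ℓ : ℝ) (3 / 2) + parity ℓ / 2)
      (fun h => max_add_parity_sub_le h) (fun h => le_max_add_parity_sub hk1 h)
    rw [← mul_assoc, ← mul_assoc]
    exact mul_le_mul_of_nonneg_right h6 hlog.le

end Models

end DirMIM

/-! ### The main theorem -/

theorem mainTheorem7 {Y : Type*} [MeasurableSpace Y] {s : ℕ}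
    (ρ : Kernel (EuclideanSpace ℝ (Fin s)) Y) [IsMarkovKernel ρ]
    (C : ℝ) (J d₀ : ℕ) (hC : √(s : ℝ) < C)
    (hdecay : ∀ d ≥ d₀, ∀ W ∈ DirMIM.Stiefel d s, ∀ j ≥ J,
      √(DirMIM.hermiteNormSq ρ W j) ≤ C ^ (-(j : ℝ) / 2)) :
    (∀ ℓ : ℕ, 1 ≤ ℓ → ∃ c > (0 : ℝ), ∃ c' > (0 : ℝ), ∃ D : ℕ,
      ∀ d ≥ D, ∀ W ∈ DirMIM.Stiefel d s, ℓ ≤ DirMIM.genExponent ρ W →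
        c * DirMIM.directionalRate ρ W ℓ ≤ DirMIM.harmonicNormSq ρ W ℓ ∧
        DirMIM.harmonicNormSq ρ W ℓ ≤ c' * DirMIM.directionalRate ρ W ℓ) ∧
    (∃ c > (0 : ℝ), ∃ c' > (0 : ℝ), ∃ D : ℕ,
      ∀ d ≥ D, ∀ W ∈ DirMIM.Stiefel d s, ∀ k : ℕ, 1 ≤ k → k = DirMIM.genExponent ρ W →
        (∀ ℓ : ℕ, 1 ≤ ℓ →
          DirMIM.sampleAlign ρ W k ≤ ENNReal.ofReal c' * DirMIM.sampleAlign ρ W ℓ ∧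
          DirMIM.queryAlign ρ W k ≤ ENNReal.ofReal c' * DirMIM.queryAlign ρ W ℓ ∧
          DirMIM.unfoldingSamples ρ W k ≤ ENNReal.ofReal c' * DirMIM.unfoldingSamples ρ W ℓ ∧
          DirMIM.unfoldingRuntime ρ W k ≤ ENNReal.ofReal c' * DirMIM.unfoldingRuntime ρ W ℓ) ∧
        DirMIM.Comparable c c' (DirMIM.sampleAlign ρ W k) ((d : ℝ) ^ ((k : ℝ) / 2)) ∧
        DirMIM.Comparable c c' (DirMIM.queryAlign ρ W k) ((d : ℝ) ^ (k : ℝ)) ∧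
        DirMIM.Comparable c c' (DirMIM.unfoldingSamples ρ W k)
          ((d : ℝ) ^ max ((k : ℝ) / 2) 1) ∧
        DirMIM.Comparable c c' (DirMIM.unfoldingRuntime ρ W k)
          ((d : ℝ) ^ (max (k : ℝ) (3 / 2) + DirMIM.parity k / 2) * Real.log d)) := by
  refine ⟨fun ℓ hℓ => ?_, ?_⟩
  · obtain ⟨c, hc, c', hc', D, hD⟩ := DirMIM.exists_harmonicNormSq_directionalRate_bounds ρ hℓ
    exact ⟨c, hc, c', hc', D, fun d hd W hW _ => hD d hd W hW⟩
  -- This exponent is computed in dimension s, hence is common to all d and W.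
  · set k₀ := sInf {k : ℕ | 1 ≤ k ∧ 0 < DirMIM.traceEnergy ρ k 0} with hk₀
    have hgen : ∀ (d : ℕ), ∀ W ∈ DirMIM.Stiefel d s, DirMIM.genExponent ρ W = k₀ :=
      fun d W hW => DirMIM.genExponent_eq ρ hW
    -- The value 0 means that no generative exponent exists; the claim is then empty because k ≥ 1.
    rcases Nat.eq_zero_or_pos k₀ with h0 | h0
    · refine ⟨1, one_pos, 1, one_pos, 0, fun d _ W hW k hk1 hk => ?_⟩
      rw [hgen d W hW] at hk
      omega
    · have hpos := (Nat.sInf_mem (Nat.nonempty_of_pos_sInf h0)).2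
      obtain ⟨c, hc, c', hc', D, hD⟩ := DirMIM.exists_complexity_bounds ρ h0 hgen hpos
      refine ⟨c, hc, c', hc', D, fun d hd W hW k _ hk => ?_⟩
      obtain rfl : k = k₀ := hk.trans (hgen d W hW)
      exact hD d hd W hW
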